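/- Let $L,H>0$, $\Omega=(0,L)^2\times(-H,0)$, $0=z_0>z_1>\dots>z_l=-H$, $\Omega_j=(0,L)^2\times(z_j,z_{j-1})$ for $1\le j\le l$, and let $D=D_j$ in $\Omega_j$ with constants $D_j>0$. All Sobolev spaces on $\Omega$ and $\Omega_j$ consist of functions that are $L$-periodic in the horizontal variables $x,y$. Let $\mathcal V$ be the closure, in the $H^1(\Omega)$-norm, of the continuous functions on $\overline\Omega$ that are smooth on each $\overline{\Omega_j}$, horizontally periodic, and zero at $z=0$ and $z=-H$, with $\|\psi\|_{\mathcal V}=\|\sqrt D\,\nabla\psi\|_{L^2(\Omega)}$. Let $\mathcal W=\{\psi\in\mathcal V:\ \partial_x\psi,\ \partial_y\psi,\ D\partial_z\psi\in H^1(\Omega)\}$ with $$\|\psi\|_{\mathcal W}^2=\|\psi\|_{H^1(\Omega)}^2+\|\partial_x\psi\|_{H^1(\Omega)}^2+\|\partial_y\psi\|_{H^1(\Omega)}^2+\|D\partial_z\psi\|_{H^1(\Omega)}^2,$$ and let $\mathcal L\psi=-\nabla\cdot(D\nabla\psi)$ for $\psi\in\mathcal W$. Then $L^2(\Omega)$ has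 an orthonormal basis $(w_k)_{k\ge1}\subset\mathcal W$ of eigenfunctions, $\mathcal Lw_k=\lambda_kw_k$, with $0<\lambda_1\le\lambda_2\le\cdots$ and $\lambda_k\to\infty$. For $\sigma\ge 0$ put $$\|\psi\|_{\mathcal H^{\sigma}}^2=\sum_{k}\lambda_k^{\sigma}\,|(\psi,w_k)_{L^2(\Omega)}|^2\in[0,\infty],\qquad \mathcal H^{\sigma}=\mathrm{dom}(\mathcal L^{\sigma/2})=\{\psi\in L^2(\Omega):\|\psi\|_{\mathcal H^\sigma}<\infty\}.$$ For $\psi\in\mathcal V$ and $s\in(0,1)$ put $$K^2(t,\psi)=\inf_{\psi_1\in\mathcal W}\big(\|\psi-\psi_1\|_{\mathcal V}^2+t^2\|\psi_1\|_{\mathcal W}^2\big),\qquad \|\psi\|_{s,\mathcal V,\mathcal W}=\Big(\int_0^\infty t^{-2s}K^2(t,\psi)\,\frac{dt}{t}\Big)^{1/2}\in[0,\infty].$$ For every $s\in(0,1)$ the following hold, with constants that do not depend on $\psi$ or on the choice of the eigenbasis. (1) $\mathcal H^{1+s}=\{\psi\in\mathcal V:\|\psi\|_{s,\mathcal V,\mathcal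 W}<\infty\}$, and there are $c,C>0$ such that $c\,\|\psi\|_{s,\mathcal V,\mathcal W}\le\|\psi\|_{\mathcal H^{1+s}}\le C\,\|\psi\|_{s,\mathcal V,\mathcal W}$ for all $\psi\in\mathcal V$. (2) For every $j=1,\dots,l$ there is $C>0$ such that every $\psi\in\mathcal W$ satisfies $\|\psi\|_{\mathcal H^{1+s}}<\infty$, $\psi|_{\Omega_j}\in H^1(\Omega_j)$ and $$\|\psi\|_{H^{1+s}(\Omega_j)}\le C\,\|\psi\|_{\mathcal H^{1+s}}.$$ Here $\|\cdot\|_{H^{1+s}(\Omega_j)}$ is the Sobolev--Slobodeckij norm $$\|\psi\|_{H^{1+s}(\Omega_j)}^2=\|\psi\|_{H^1(\Omega_j)}^2+\sum_{i=1}^3\int_{\Omega_j}\int_{\Omega_j}\frac{|\partial_i\psi(p)-\partial_i\psi(q)|^2}{d(p,q)^{3+2s}}\,dq\,dp,$$ where $d(p,q)\le|p-q|$ is the distance modulo horizontal translations by vectors of $L\mathbb Z^2$. -/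

import Mathlib

open MeasureTheory Set Filter Topology
open scoped ENNReal NNReal ContDiff

noncomputable section

namespace Layered

/-- Physical space `ℝ³`; the coordinates `0`, `1`, `2` are `x`, `y`, `z`. -/
abbrev Space : Type := EuclideanSpace ℝ (Fin 3)

/-- The unit vector in the `i`-th coordinate direction. -/
def unitVec (i : Fin 3) : Space := EuclideanSpace.single i (1 : ℝ)

/-- The box `(0,L)² × (a,b)`. -/
def box (L a b : ℝ) : Set Space :=
  {p | p 0 ∈ Ioo 0 L ∧ p 1 ∈ Ioo 0 L ∧ p 2 ∈ Ioo a b}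

/-- Lebesgue measure on the box `(0,L)² × (a,b)`. -/
abbrev boxMeasure (L a b : ℝ) : Measure Space := volume.restrict (box L a b)

/-- The classical partial derivative. -/
def partialDeriv (i : Fin 3) (φ : Space → ℝ) (p : Space) : ℝ := fderiv ℝ φ p (unitVec i)

/-! ### Sobolev spaces on a box, with periodicity in the horizontal directions -/

/-- Test functions on the horizontally periodic slab over `(a,b)`: smooth, `L`-periodic in `x` and
`y`, with vertical support in a compact subset of `(a,b)`. -/
structure IsTest (L a b : ℝ) (φ : Space → ℝ) : Prop where
  smooth : ContDiff ℝ ∞ φ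
  periodic_x : ∀ p, φ (p + L • unitVec 0) = φ p
  periodic_y : ∀ p, φ (p + L • unitVec 1) = φ p
  vertical_support : ∃ a' b' : ℝ, a < a' ∧ b' < b ∧ ∀ p, φ p ≠ 0 → p 2 ∈ Icc a' b'

/-- `g` is a weak (horizontally periodic) `i`-th partial derivative of `u` on `(0,L)² × (a,b)`. -/
def HasWeakPartial (L a b : ℝ) (i : Fin 3) (u g : Space → ℝ) : Prop :=
  ∀ φ : Space → ℝ, IsTest L a b φ →
    ∫ p in box L a b, u p * partialDeriv i φ p = - ∫ p in box L a b, g p * φ p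

/-- `u` belongs to `H¹((0,L)² × (a,b))`, with periodicity in the horizontal directions. -/
def MemH1 (L a b : ℝ) (u : Space → ℝ) : Prop :=
  MemLp u 2 (boxMeasure L a b) ∧
    ∀ i, ∃ g, MemLp g 2 (boxMeasure L a b) ∧ HasWeakPartial L a b i u g

open Classical in
/-- The weak partial derivative `∂ᵢu` in `L²`, unique almost everywhere if it exists (and `0` if it
does not; it is used only where it exists). -/
def weakPartial (L a b : ℝ) (i : Fin 3) (u : Space → ℝ) : Space → ℝ :=
  if h : ∃ g, MemLp g 2 (boxMeasure L a b) ∧ HasWeakPartial L a b i u g then h.choose else 0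

/-- `‖u‖²` in `L²((0,L)² × (a,b))`. -/
def l2Sq (L a b : ℝ) (u : Space → ℝ) : ℝ≥0∞ := ∫⁻ p in box L a b, ‖u p‖ₑ ^ 2

/-- `‖u‖²` in `H¹((0,L)² × (a,b))`. -/
def h1Sq (L a b : ℝ) (u : Space → ℝ) : ℝ≥0∞ :=
  l2Sq L a b u + ∑ i, l2Sq L a b (weakPartial L a b i u)

/-- The distance of two points modulo horizontal translations by multiples of `L`.
It is at most the Euclidean distance. -/
def perDist (L : ℝ) (p q : Space) : ℝ :=
  Real.sqrt (‖((p 0 - q 0 : ℝ) : AddCircle L)‖ ^ 2 + ‖((p 1 - q 1 : ℝ) : AddCircle L)‖ ^ 2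
    + (p 2 - q 2) ^ 2)

/-- The square of the Sobolev--Slobodeckij seminorm of order `s ∈ (0,1)` on the horizontally
periodic layer over `(a,b)`. It dominates the one formed with the Euclidean distance. -/
def slobodeckijSq (L a b s : ℝ) (u : Space → ℝ) : ℝ≥0∞ :=
  ∫⁻ p in box L a b, ∫⁻ q in box L a b,
    ENNReal.ofReal ((u p - u q) ^ 2 / perDist L p q ^ (3 + 2 * s))

/-- The fractional Sobolev norm of `H^{1+s}((0,L)² × (a,b))`, `s ∈ (0,1)`. -/
def sobolevNorm (L a b s : ℝ) (u : Space → ℝ) : ℝ≥0∞ :=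
  (h1Sq L a b u + ∑ i, slobodeckijSq L a b s (weakPartial L a b i u)) ^ (1 / 2 : ℝ)

/-! ### The layered medium and its diffusion operator -/

/-- A medium occupying `(0,L)² × (-H,0)` and divided into `l` layers by the planes
`0 = z₀ > z₁ > ⋯ > z_l = -H`, with a positive constant diffusivity in each layer. The layer with
index `j : Fin l` lies between the heights `z j.succ` and `z j.castSucc`. -/
structure Medium (l : ℕ) where
  L : ℝ
  H : ℝ
  z : Fin (l + 1) → ℝ
  diff : Fin l → ℝ
  L_pos : 0 < L
  H_pos : 0 < H
  z_zero : z 0 = 0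
  z_last : z (Fin.last l) = -H
  z_anti : StrictAnti z
  diff_pos : ∀ j, 0 < diff j

namespace Medium

variable {l : ℕ} (M : Medium l)

/-- The diffusivity `D`, equal to `D_j` in the `j`-th layer. -/
def D (p : Space) : ℝ :=
  ∑ j : Fin l, (Ioc (M.z j.succ) (M.z j.castSucc)).indicator (fun _ => M.diff j) (p 2)

/-- The space `𝓗 = L²(Ω)` with `Ω = (0,L)² × (-H,0)`. -/
abbrev L2 : Type := Lp ℝ 2 (boxMeasure M.L (-M.H) 0)

/-- The weak partial derivative on `Ω`. -/
def wd (i : Fin 3) (u : Space → ℝ) : Space → ℝ := weakPartial M.L (-M.H) 0 i u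

/-- Continuous functions on the closed slab `-H ≤ z ≤ 0`, smooth up to the boundary in every layer,
periodic in the horizontal directions and zero at `z = 0` and `z = -H`. -/
structure IsPiecewiseSmooth (f : Space → ℝ) : Prop where
  continuousOn : ContinuousOn f {p | p 2 ∈ Icc (-M.H) 0}
  smooth : ∀ j : Fin l, ∃ g : Space → ℝ, ContDiff ℝ ∞ g ∧
    EqOn f g {p | p 2 ∈ Icc (M.z j.succ) (M.z j.castSucc)}
  periodic_x : ∀ p : Space, p 2 ∈ Icc (-M.H) 0 → f (p + M.L • unitVec 0) = f p
  periodic_y : ∀ p : Space, p 2 ∈ Icc (-M.H) 0 → f (p + M.L • unitVec 1) = f p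
  zero_top : ∀ p : Space, p 2 = 0 → f p = 0
  zero_bottom : ∀ p : Space, p 2 = -M.H → f p = 0

/-- The space `𝓥`: the closure of the piecewise smooth functions above in `H¹(Ω)`. -/
def V : Set M.L2 :=
  {u | MemH1 M.L (-M.H) 0 u ∧ ∀ ε : ℝ≥0∞, 0 < ε →
    ∃ f, M.IsPiecewiseSmooth f ∧ h1Sq M.L (-M.H) 0 (fun p => u p - f p) < ε}

/-- `‖u‖²_𝓥 = ‖√D ∇u‖²` in `L²(Ω)`. -/
def vSq (u : Space → ℝ) : ℝ≥0∞ :=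
  ∑ i, l2Sq M.L (-M.H) 0 (fun p => Real.sqrt (M.D p) * M.wd i u p)

/-- The space `𝓦`: the `ψ ∈ 𝓥` such that `∂ₓψ`, `∂_yψ` and `D ∂_zψ` lie in `H¹(Ω)`. -/
def W : Set M.L2 :=
  {u | u ∈ M.V ∧ MemH1 M.L (-M.H) 0 (M.wd 0 u) ∧ MemH1 M.L (-M.H) 0 (M.wd 1 u) ∧
    MemH1 M.L (-M.H) 0 (fun p => M.D p * M.wd 2 u p)}

/-- `‖u‖²_𝓦`. -/
def wSq (u : Space → ℝ) : ℝ≥0∞ :=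
  h1Sq M.L (-M.H) 0 u + h1Sq M.L (-M.H) 0 (M.wd 0 u) + h1Sq M.L (-M.H) 0 (M.wd 1 u)
    + h1Sq M.L (-M.H) 0 (fun p => M.D p * M.wd 2 u p)

/-- The operator `𝓛ψ = -∇·(D∇ψ)`, for `ψ ∈ 𝓦`. -/
def op (u : Space → ℝ) (p : Space) : ℝ :=
  - ∑ i, M.wd i (fun q => M.D q * M.wd i u q) p

/-- `w` is an orthonormal basis of `L²(Ω)` that consists of eigenfunctions `w k ∈ 𝓦` of `𝓛`,
with the eigenvalues `lam k`. -/
def IsEigenbasis (lam : ℕ → ℝ) (w : HilbertBasis ℕ ℝ M.L2) : Prop :=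
  ∀ k, w k ∈ M.W ∧
    M.op (w k) =ᵐ[boxMeasure M.L (-M.H) 0] fun p => lam k * (w k : M.L2) p

/-- The norm `(∑ₖ λₖ^σ |(ψ, wₖ)|²)^{1/2}` of the fractional-power space
`𝓗^σ = dom(𝓛^{σ/2})`; it is `∞` outside this space. -/
def fracNorm (lam : ℕ → ℝ) (w : HilbertBasis ℕ ℝ M.L2) (σ : ℝ) (u : M.L2) : ℝ≥0∞ :=
  (∑' k, ENNReal.ofReal (lam k ^ σ * (inner ℝ u (w k)) ^ 2)) ^ (1 / 2 : ℝ)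

/-- The `K`-functional `K²(t,ψ,𝓥,𝓦)` for `ψ ∈ 𝓥`. -/
def KSq (t : ℝ) (u : M.L2) : ℝ≥0∞ :=
  ⨅ v ∈ M.W, M.vSq (u - v : M.L2) + ENNReal.ofReal (t ^ 2) * M.wSq v

/-- The norm `‖ψ‖_{s,𝓥,𝓦}` of the real interpolation space between `𝓥` and `𝓦`, for `ψ ∈ 𝓥`. -/
def interpNorm (s : ℝ) (u : M.L2) : ℝ≥0∞ :=
  (∫⁻ t in Ioi (0 : ℝ), ENNReal.ofReal (t ^ (-2 * s) / t) * M.KSq t u) ^ (1 / 2 : ℝ)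

end Medium

end Layered

end

noncomputable section

namespace Layered

/-! ### Boxes and horizontally periodic functions -/

/-! Everything is reduced to three equivalences: expansion coefficients in an eigenbasis describe
`𝓥`, they describe `𝓦`, and they describe the `K`-functional between the two.

The space `𝓥` is the `H¹`-closure of the test functions with vertical support inside the slab
(`Medium.mem_V_iff`). A piecewise smooth function becomes such a test function when the height is
reparametrized so as to be constant near every interface, and the reparametrizations have uniformly
bounded slopes. Hence `𝓥` is a Hilbert space with the energy form of `𝓛`, coercive by a Poincaré
inequality in `z`.

The norm of `𝓦` is comparable with `‖𝓛u‖`. One direction is the triangle inequality. The other is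
elliptic regularity (`exists_regularity_const`): `D` depends on the height alone, so horizontal
difference quotients commute with the operator and Nirenberg's method gives all second derivatives
involving `x` or `y`; the equation then gives `∂_z(D∂_z u)`. The jumps of `D` do no harm because
only the flux `D∂_z u` is differentiated in `z`.

The embedding `J` of the energy space into `L²` is compact, since averages over a fine grid
approximate functions with a bounded gradient. The operator `J J*` is compact, symmetric and
positive, and its eigenvalues are `1/(1+λ)`. For any eigenbasis, Parseval in `L²` and in the energy
space gives `‖u‖²_𝓥 = ∑ λ c²` and `‖𝓛u‖² = ∑ λ² c²`, where `c` denotes the coefficients of `u`.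

Minimizing mode by mode, `K²(t,u)` is comparable with `∑ t²λ²/(1+t²λ) c²`
(`IsEigenbasis.modeSum_le_KSq`, `exists_KSq_le_const`). Integrating against `t^{-2s} dt/t` and
substituting `√λ t` turns each weight into a constant times `λ^{1+s}`. This is (1).

For (2) no interpolation theorem for Sobolev spaces is needed. In one layer `D` is constant, so an
element of `𝓦` has an `H¹` gradient there. Splitting `u = (u - v) + v` with `v ∈ 𝓦` shows that the
squared `L²`-norm of the increment of `∂ᵢu` under a translation by `h` is at most a constant times
`K²(|h|,u)` (`shiftSq_le_KSq`). The Slobodeckij seminorm is bounded by the integral of these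
increments against `|h|^{-3-2s}` over space, and the same scaling as before returns `λ^{1+s}`. Both
uses of increments, compactness and (2), rest on the translation estimate `shiftSq_le`. -/

theorem unitVec_apply (i j : Fin 3) : unitVec i j = if j = i then 1 else 0 := by
  simp [unitVec]

/-- Invariance under horizontal translations by multiples of `L`. -/
def HPeriodic {α : Type*} (L : ℝ) (F : Space → α) : Prop :=
  ∀ i : Fin 3, i ≠ 2 → ∀ p, F (p + L • unitVec i) = F p

theorem measurable_coord (i : Fin 3) : Measurable fun p : Space => p i := by fun_prop

theorem volume_hyperplane (i : Fin 3) (c : ℝ) : volume {p : Space | p i = c} = 0 := by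
  have h := (PiLp.volume_preserving_toLp (Fin 3)).measure_preimage
    (s := {p : Space | p i = c})
    (measurableSet_eq_fun (measurable_coord i) measurable_const).nullMeasurableSet
  rw [← h]
  exact Measure.pi_hyperplane (fun _ => (volume : Measure ℝ)) i c

/-- Periods are handled one direction at a time: integrals of an invariant function over two
fundamental domains of the same group agree, so a period slab may be moved freely. -/
theorem isAddFundamentalDomain_slab {L : ℝ} (hL : 0 < L) (i : Fin 3) (c : ℝ) :
    IsAddFundamentalDomain (AddSubgroup.zmultiples (L • unitVec i))
      {p : Space | p i ∈ Ioc c (c + L)} volume := by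
  refine IsAddFundamentalDomain.mk'
    (measurable_coord i measurableSet_Ioc).nullMeasurableSet fun x => ?_
  have hmap : Function.Bijective
      (Set.rangeFactorization fun n : ℤ => n • (L • unitVec i)) := by
    refine ⟨fun m n h => ?_, Set.rangeFactorization_surjective⟩
    have h' := congrArg (fun p : range (fun n : ℤ => n • (L • unitVec i)) => (p : Space) i) h
    simp [Set.rangeFactorization, unitVec_apply] at h'
    rcases h' with h' | h'
    · exact h'
    · exact absurd h' hL.ne'
  refine (Equiv.ofBijective _ hmap).bijective.existsUnique_iff.2 ?_
  have key : ∀ n : ℤ, (Equiv.ofBijective _ hmap n : Space) i = n • L := fun n => by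
    simp [Set.rangeFactorization, unitVec_apply]
  have h := existsUnique_add_zsmul_mem_Ioc hL (x i) c
  refine (existsUnique_congr fun n => ?_).1 h
  rw [← key n, add_comm (x i)]
  exact Iff.rfl

theorem setLIntegral_slab_eq {L : ℝ} (hL : 0 < L) (i : Fin 3) (c d : ℝ) (F : Space → ℝ≥0∞)
    (hF : ∀ p, F (p + L • unitVec i) = F p) :
    ∫⁻ p in {p : Space | p i ∈ Ioc c (c + L)}, F p
      = ∫⁻ p in {p : Space | p i ∈ Ioc d (d + L)}, F p := by
  refine (isAddFundamentalDomain_slab hL i c).setLIntegral_eq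
    (isAddFundamentalDomain_slab hL i d) F ?_
  rintro ⟨g, n, rfl⟩ p
  have hn : ∀ n : ℤ, ∀ p, F (p + n • (L • unitVec i)) = F p := by
    intro n
    induction n using Int.induction_on with
    | zero => simp
    | succ k ih => intro p; rw [add_smul, one_smul, ← add_assoc, hF, ih]
    | pred k ih =>
      intro p
      rw [← hF, add_assoc, sub_smul, one_smul, sub_add_cancel, ih]
  simpa [AddSubgroup.vadd_def, vadd_eq_add, add_comm] using hn n p

/-- The half-open box `(c,c+L] × (d,d+L] × (a,b)`. -/
def cell (L c d a b : ℝ) : Set Space :=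
  {p | p 0 ∈ Ioc c (c + L) ∧ p 1 ∈ Ioc d (d + L) ∧ p 2 ∈ Ioo a b}

theorem measurableSet_cell (L c d a b : ℝ) : MeasurableSet (cell L c d a b) :=
  (measurable_coord 0 measurableSet_Ioc).inter
    ((measurable_coord 1 measurableSet_Ioc).inter (measurable_coord 2 measurableSet_Ioo))

theorem measurableSet_box (L a b : ℝ) : MeasurableSet (box L a b) :=
  (measurable_coord 0 measurableSet_Ioo).inter
    ((measurable_coord 1 measurableSet_Ioo).inter (measurable_coord 2 measurableSet_Ioo))

theorem isOpen_box (L a b : ℝ) : IsOpen (box L a b) :=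
  (isOpen_Ioo.preimage (by fun_prop : Continuous fun p : Space => p 0)).inter
    ((isOpen_Ioo.preimage (by fun_prop : Continuous fun p : Space => p 1)).inter
      (isOpen_Ioo.preimage (by fun_prop : Continuous fun p : Space => p 2)))

theorem box_ae_eq_cell (L a b : ℝ) : (box L a b : Set Space) =ᵐ[volume] cell L 0 0 a b := by
  have h0 : ∀ᵐ p : Space, p 0 ≠ L := by
    rw [ae_iff]; simpa using volume_hyperplane 0 L
  have h1 : ∀ᵐ p : Space, p 1 ≠ L := by
    rw [ae_iff]; simpa using volume_hyperplane 1 L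
  filter_upwards [h0, h1] with p h0 h1
  refine propext ?_
  change p ∈ box L a b ↔ p ∈ cell L 0 0 a b
  simp only [box, cell, mem_ofPred_eq, mem_Ioo, mem_Ioc, zero_add]
  constructor
  · rintro ⟨h, h', h''⟩
    exact ⟨⟨h.1, h.2.le⟩, ⟨h'.1, h'.2.le⟩, h''⟩
  · rintro ⟨h, h', h''⟩
    exact ⟨⟨h.1, lt_of_le_of_ne h.2 h0⟩, ⟨h'.1, lt_of_le_of_ne h'.2 h1⟩, h''⟩

theorem setLIntegral_inter_eq_indicator (A B : Set Space) (hB : MeasurableSet B)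
    (F : Space → ℝ≥0∞) :
    ∫⁻ p in A ∩ B, F p = ∫⁻ p in A, B.indicator F p := by
  rw [setLIntegral_indicator hB, inter_comm]

theorem setLIntegral_cell_eq {L : ℝ} (hL : 0 < L) (c d c' d' a b : ℝ) {F : Space → ℝ≥0∞}
    (hF : HPeriodic L F) : ∫⁻ p in cell L c d a b, F p = ∫⁻ p in cell L c' d' a b, F p := by
  have h1 : ∫⁻ p in cell L c d a b, F p = ∫⁻ p in cell L c' d a b, F p := by
    set B : Set Space := {p | p 1 ∈ Ioc d (d + L) ∧ p 2 ∈ Ioo a b}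
    have hB : MeasurableSet B :=
      (measurable_coord 1 measurableSet_Ioc).inter (measurable_coord 2 measurableSet_Ioo)
    have key : ∀ e, cell L e d a b = {p : Space | p 0 ∈ Ioc e (e + L)} ∩ B := fun e => rfl
    rw [key, key, setLIntegral_inter_eq_indicator _ _ hB, setLIntegral_inter_eq_indicator _ _ hB]
    refine setLIntegral_slab_eq hL 0 _ _ _ fun p => ?_
    simp [indicator, B, unitVec_apply, hF 0 (by decide) p]
  have h2 : ∫⁻ p in cell L c' d a b, F p = ∫⁻ p in cell L c' d' a b, F p := by
    set B : Set Space := {p | p 0 ∈ Ioc c' (c' + L) ∧ p 2 ∈ Ioo a b}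
    have hB : MeasurableSet B :=
      (measurable_coord 0 measurableSet_Ioc).inter (measurable_coord 2 measurableSet_Ioo)
    have key : ∀ e, cell L c' e a b = {p : Space | p 1 ∈ Ioc e (e + L)} ∩ B := fun e => by
      ext p; simp only [cell, B, mem_ofPred_eq, mem_inter_iff]; tauto
    rw [key, key, setLIntegral_inter_eq_indicator _ _ hB, setLIntegral_inter_eq_indicator _ _ hB]
    refine setLIntegral_slab_eq hL 1 _ _ _ fun p => ?_
    simp [indicator, B, unitVec_apply, hF 1 (by decide) p]
  exact h1.trans h2

theorem setLIntegral_box_eq_cell {L : ℝ} (hL : 0 < L) (c d a b : ℝ) {F : Space → ℝ≥0∞}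
    (hF : HPeriodic L F) : ∫⁻ p in box L a b, F p = ∫⁻ p in cell L c d a b, F p := by
  rw [setLIntegral_congr (box_ae_eq_cell L a b), setLIntegral_cell_eq hL 0 0 c d a b hF]

theorem setLIntegral_cell_add (L c d a b : ℝ) (F : Space → ℝ≥0∞) (h : Space) :
    ∫⁻ p in cell L c d a b, F (p + h)
      = ∫⁻ p in cell L (c + h 0) (d + h 1) (a + h 2) (b + h 2), F p := by
  have := (measurePreserving_add_right (volume : Measure Space) h).setLIntegral_comp_preimage_emb
    (measurableEmbedding_addRight h) F (cell L (c + h 0) (d + h 1) (a + h 2) (b + h 2))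
  rw [← this]
  congr 2
  ext p
  simp [cell, add_right_comm _ (h 0), add_right_comm _ (h 1)]

/-- Translation of the integral of a horizontally periodic function over a box. -/
theorem setLIntegral_box_add {L : ℝ} (hL : 0 < L) (a b : ℝ) {F : Space → ℝ≥0∞}
    (hF : HPeriodic L F) (h : Space) :
    ∫⁻ p in box L a b, F (p + h) = ∫⁻ p in box L (a + h 2) (b + h 2), F p := by
  have hF' : HPeriodic L fun p => F (p + h) := fun i hi p => by
    change F (p + L • unitVec i + h) = F (p + h)
    rw [add_right_comm, hF i hi]
  rw [setLIntegral_box_eq_cell hL 0 0 a b hF', setLIntegral_cell_add,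
    ← setLIntegral_box_eq_cell hL _ _ _ _ hF]

theorem box_subset_closedBall (L a b : ℝ) :
    box L a b ⊆ Metric.closedBall (0 : Space) (2 * |L| + |a| + |b|) := by
  intro p hp
  obtain ⟨h0, h1, h2⟩ := hp
  rw [mem_closedBall_zero_iff, EuclideanSpace.norm_eq, Fin.sum_univ_three]
  have e0 : ‖p 0‖ ≤ |L| := by
    rw [Real.norm_eq_abs, abs_of_pos h0.1]; exact h0.2.le.trans (le_abs_self L)
  have e1 : ‖p 1‖ ≤ |L| := by
    rw [Real.norm_eq_abs, abs_of_pos h1.1]; exact h1.2.le.trans (le_abs_self L)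
  have e2 : ‖p 2‖ ≤ |a| + |b| := by
    rw [Real.norm_eq_abs, abs_le]
    constructor
    · linarith [neg_abs_le a, abs_nonneg b, h2.1]
    · linarith [le_abs_self b, abs_nonneg a, h2.2]
  refine Real.sqrt_le_iff.2 ⟨by positivity, ?_⟩
  nlinarith [norm_nonneg (p 0), norm_nonneg (p 1), norm_nonneg (p 2), abs_nonneg L, abs_nonneg a,
    abs_nonneg b, mul_nonneg (abs_nonneg L) (add_nonneg (abs_nonneg a) (abs_nonneg b))]

instance isFiniteMeasure_boxMeasure (L a b : ℝ) : IsFiniteMeasure (boxMeasure L a b) :=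
  ⟨by
    rw [Measure.restrict_apply_univ]
    exact (measure_mono (box_subset_closedBall L a b)).trans_lt
      (isCompact_closedBall _ _).measure_lt_top⟩

theorem exists_bound_on_box {f : Space → ℝ} (hf : Continuous f) (L a b : ℝ) :
    ∃ C, ∀ p ∈ box L a b, ‖f p‖ ≤ C := by
  obtain ⟨C, hC⟩ := (isCompact_closedBall (0 : Space) (2 * |L| + |a| + |b|)).exists_bound_of_continuousOn
    hf.continuousOn
  exact ⟨C, fun p hp => hC p (box_subset_closedBall L a b hp)⟩

theorem ae_boxMeasure_mem (L a b : ℝ) : ∀ᵐ p ∂(boxMeasure L a b), p ∈ box L a b :=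
  ae_restrict_mem (measurableSet_box L a b)

theorem memLp_of_continuous {f : Space → ℝ} (hf : Continuous f) (L a b : ℝ) (q : ℝ≥0∞) :
    MemLp f q (boxMeasure L a b) := by
  obtain ⟨C, hC⟩ := exists_bound_on_box hf L a b
  refine MemLp.of_bound hf.aestronglyMeasurable C ?_
  filter_upwards [ae_boxMeasure_mem L a b] with p hp using hC p hp

theorem integrable_of_continuous {f : Space → ℝ} (hf : Continuous f) (L a b : ℝ) :
    Integrable f (boxMeasure L a b) :=
  memLp_one_iff_integrable.1 (memLp_of_continuous hf L a b 1)

/-- A horizontally periodic function that vanishes, together with its translate, outside the slab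
has the same integral as the translate. -/
theorem integral_box_add {L : ℝ} (hL : 0 < L) {a b : ℝ} {F : Space → ℝ} (hF : HPeriodic L F)
    (h : Space) (hInt : Integrable F (boxMeasure L a b))
    (hInt' : Integrable (fun p => F (p + h)) (boxMeasure L a b))
    (hs : ∀ p, F p ≠ 0 → p 2 ∈ Ioo a b ∧ p 2 - h 2 ∈ Ioo a b) :
    ∫ p in box L a b, F (p + h) = ∫ p in box L a b, F p := by
  have key : ∀ G : Space → ℝ, HPeriodic L G → (∀ p, F p = 0 → G p = 0) →
      ∫⁻ p in box L a b, ENNReal.ofReal (G (p + h)) = ∫⁻ p in box L a b, ENNReal.ofReal (G p) := by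
    intro G hG hz
    have hG' : HPeriodic L fun p => ENNReal.ofReal (G p) := fun i hi p => by
      simp only [hG i hi p]
    rw [setLIntegral_box_add hL a b hG' h]
    -- The two boxes differ only in their vertical ranges, and the support condition puts every
    -- point with `F p ≠ 0` in both.
    have hb : ∀ c d, box L c d = {p : Space | p 0 ∈ Ioo 0 L ∧ p 1 ∈ Ioo 0 L} ∩
        {p | p 2 ∈ Ioo c d} := fun c d => by
      ext p; simp only [box, mem_ofPred_eq, mem_inter_iff]; tauto
    have hm : ∀ c d, MeasurableSet {p : Space | p 2 ∈ Ioo c d} :=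
      fun c d => measurable_coord 2 measurableSet_Ioo
    rw [hb, hb, setLIntegral_inter_eq_indicator _ _ (hm _ _),
      setLIntegral_inter_eq_indicator _ _ (hm _ _)]
    congr 1
    ext p
    by_cases hp : F p = 0
    · simp [indicator, hz p hp]
    · have := hs p hp
      have h1 := this.1
      have h2 := this.2
      simp only [mem_Ioo] at h1 h2
      rw [indicator_of_mem (by simpa using ⟨by linarith, by linarith⟩),
        indicator_of_mem (by simpa using h1)]
  rw [integral_eq_lintegral_pos_part_sub_lintegral_neg_part hInt,
    integral_eq_lintegral_pos_part_sub_lintegral_neg_part hInt', key F hF fun p hp => hp,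
    key (fun p => -F p) (fun i hi p => by simp only [hF i hi p]) fun p hp => by simp [hp]]

end Layered

end

noncomputable section

namespace Layered

/-! ### Test functions -/

theorem space_eq_sum (h : Space) : h = ∑ i, h i • unitVec i := by
  ext j
  fin_cases j <;> simp [unitVec_apply, Fin.sum_univ_three]

theorem fderiv_apply_eq_sum (φ : Space → ℝ) (p h : Space) :
    fderiv ℝ φ p h = ∑ i, h i * partialDeriv i φ p := by
  conv_lhs => rw [space_eq_sum h]
  simp [partialDeriv]

theorem contDiff_partialDeriv {φ : Space → ℝ} (hφ : ContDiff ℝ ∞ φ) (i : Fin 3) :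
    ContDiff ℝ ∞ (partialDeriv i φ) :=
  (hφ.fderiv_right (m := ∞) (by simp)).clm_apply contDiff_const

theorem hasDerivAt_translate {φ : Space → ℝ} (hφ : Differentiable ℝ φ) (p h : Space) (t : ℝ) :
    HasDerivAt (fun t : ℝ => φ (p + t • h)) (fderiv ℝ φ (p + t • h) h) t := by
  have h1 : HasDerivAt (fun t : ℝ => p + t • h) h t := by
    simpa using ((hasDerivAt_id t).smul_const h).const_add p
  exact (hφ (p + t • h)).hasFDerivAt.comp_hasDerivAt t h1

theorem partialDeriv_add_right (φ : Space → ℝ) (i : Fin 3) (p h : Space) :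
    partialDeriv i (fun q => φ (q + h)) p = partialDeriv i φ (p + h) := by
  simp [partialDeriv, fderiv_comp_add_right]

theorem partialDeriv_mul {φ χ : Space → ℝ} (hφ : Differentiable ℝ φ) (hχ : Differentiable ℝ χ)
    (i : Fin 3) (p : Space) :
    partialDeriv i (fun q => φ q * χ q) p
      = φ p * partialDeriv i χ p + partialDeriv i φ p * χ p := by
  have := fderiv_fun_mul (hφ p) (hχ p)
  simp [partialDeriv, this]
  ring

theorem partialDeriv_comm {φ : Space → ℝ} (hφ : ContDiff ℝ ∞ φ) (i j : Fin 3) (p : Space) :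
    partialDeriv i (partialDeriv j φ) p = partialDeriv j (partialDeriv i φ) p := by
  have hd : DifferentiableAt ℝ (fderiv ℝ φ) p :=
    (hφ.fderiv_right (m := ∞) (by simp)).differentiable (by simp) p
  have key : ∀ i j : Fin 3, partialDeriv i (partialDeriv j φ) p
      = fderiv ℝ (fderiv ℝ φ) p (unitVec i) (unitVec j) := by
    intro i j
    have : partialDeriv j φ = fun q => fderiv ℝ φ q (unitVec j) := rfl
    rw [this]
    simp only [partialDeriv]
    rw [fderiv_clm_apply hd (by fun_prop)]
    simp
  rw [key, key]
  have h2 : (2 : WithTop ℕ∞) ≤ ((⊤ : ℕ∞) : WithTop ℕ∞) :=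
    WithTop.coe_le_coe.2 le_top
  exact (hφ.contDiffAt.isSymmSndFDerivAt (by simpa using h2)).eq _ _

theorem partialDeriv_of_coord {η : ℝ → ℝ} (i : Fin 3) (hi : i ≠ 2) (p : Space)
    (hη : DifferentiableAt ℝ η (p 2)) :
    partialDeriv i (fun q => η (q 2)) p = 0 := by
  have h1 : HasFDerivAt (fun q : Space => q 2) (EuclideanSpace.proj (𝕜 := ℝ) (2 : Fin 3)) p :=
    (EuclideanSpace.proj (𝕜 := ℝ) (2 : Fin 3) : Space →L[ℝ] ℝ).hasFDerivAt
  have h2 := hη.hasDerivAt.comp_hasFDerivAt p h1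
  have h3 : fderiv ℝ (fun q : Space => η (q 2)) p = _ := h2.fderiv
  simp [partialDeriv, h3, unitVec_apply, hi.symm]

theorem partialDeriv_of_coord_two {η : ℝ → ℝ} (p : Space) {η' : ℝ}
    (hη : HasDerivAt η η' (p 2)) :
    partialDeriv 2 (fun q => η (q 2)) p = η' := by
  have h1 : HasFDerivAt (fun q : Space => q 2) (EuclideanSpace.proj (𝕜 := ℝ) (2 : Fin 3)) p :=
    (EuclideanSpace.proj (𝕜 := ℝ) (2 : Fin 3) : Space →L[ℝ] ℝ).hasFDerivAt
  have h2 := hη.comp_hasFDerivAt p h1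
  have h3 : fderiv ℝ (fun q : Space => η (q 2)) p = _ := h2.fderiv
  simp [partialDeriv, h3, unitVec_apply]

namespace IsTest

variable {L a b : ℝ} {φ χ : Space → ℝ}

theorem hperiodic (h : IsTest L a b φ) : HPeriodic L φ := by
  intro i hi p
  fin_cases i
  · exact h.periodic_x p
  · exact h.periodic_y p
  · exact absurd rfl hi

theorem of_hperiodic (h1 : ContDiff ℝ ∞ φ) (h2 : HPeriodic L φ)
    (h3 : ∃ a' b' : ℝ, a < a' ∧ b' < b ∧ ∀ p, φ p ≠ 0 → p 2 ∈ Icc a' b') : IsTest L a b φ :=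
  ⟨h1, h2 0 (by decide), h2 1 (by decide), h3⟩

theorem continuous (h : IsTest L a b φ) : Continuous φ := h.smooth.continuous

theorem differentiable (h : IsTest L a b φ) : Differentiable ℝ φ :=
  h.smooth.differentiable (by simp)

theorem zero : IsTest L a b (fun _ => 0) :=
  ⟨contDiff_const, fun _ => rfl, fun _ => rfl, a + 1, b - 1, by simp, by simp, fun _ h => absurd rfl h⟩

theorem add (hφ : IsTest L a b φ) (hχ : IsTest L a b χ) : IsTest L a b (φ + χ) := by
  obtain ⟨a', b', ha, hb, hs⟩ := hφ.vertical_support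
  obtain ⟨a'', b'', ha', hb', hs'⟩ := hχ.vertical_support
  refine of_hperiodic (hφ.smooth.add hχ.smooth) (fun i hi p => ?_)
    ⟨min a' a'', max b' b'', lt_min ha ha', max_lt hb hb', fun p hp => ?_⟩
  · simp [hφ.hperiodic i hi p, hχ.hperiodic i hi p]
  · by_cases h : φ p = 0
    · have : χ p ≠ 0 := fun h' => hp (by simp [h, h'])
      exact ⟨(min_le_right _ _).trans (hs' p this).1, (hs' p this).2.trans (le_max_right _ _)⟩
    · exact ⟨(min_le_left _ _).trans (hs p h).1, (hs p h).2.trans (le_max_left _ _)⟩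

theorem mul_left (hφ : IsTest L a b φ) (hχ : ContDiff ℝ ∞ χ) (hp : HPeriodic L χ) :
    IsTest L a b (fun p => χ p * φ p) := by
  obtain ⟨a', b', ha, hb, hs⟩ := hφ.vertical_support
  refine of_hperiodic (hχ.mul hφ.smooth) (fun i hi p => ?_)
    ⟨a', b', ha, hb, fun p hp => hs p (right_ne_zero_of_mul hp)⟩
  simp only [hφ.hperiodic i hi p, hp i hi p]

theorem mul_coord (hφ : IsTest L a b φ) {η : ℝ → ℝ} (hη : ContDiff ℝ ∞ η) :
    IsTest L a b (fun p => η (p 2) * φ p) :=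
  hφ.mul_left (hη.comp (by fun_prop : ContDiff ℝ ∞ fun p : Space => p 2))
    fun i hi p => by simp [unitVec_apply, hi.symm]

theorem smul (hφ : IsTest L a b φ) (c : ℝ) : IsTest L a b (c • φ) :=
  hφ.mul_left (χ := fun _ => c) contDiff_const fun _ _ _ => rfl

theorem partialDeriv (hφ : IsTest L a b φ) (i : Fin 3) : IsTest L a b (partialDeriv i φ) := by
  obtain ⟨a', b', ha, hb, hs⟩ := hφ.vertical_support
  refine of_hperiodic (contDiff_partialDeriv hφ.smooth i) (fun j hj p => ?_)
    ⟨a', b', ha, hb, fun p hp => ?_⟩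
  · rw [← partialDeriv_add_right]
    congr 1
    ext q
    exact hφ.hperiodic j hj q
  · by_contra hcon
    apply hp
    have hopen : IsOpen {q : Space | q 2 ∉ Icc a' b'} :=
      (isClosed_Icc.preimage (by fun_prop : Continuous fun p : Space => p 2)).isOpen_compl
    have : φ =ᶠ[𝓝 p] fun _ => 0 := by
      filter_upwards [hopen.mem_nhds hcon] with q hq
      by_contra h
      exact hq (hs q h)
    simp [Layered.partialDeriv, this.fderiv_eq]

theorem translate (hφ : IsTest L a b φ) (h : Space) :
    IsTest L (a - h 2) (b - h 2) (fun p => φ (p + h)) := by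
  obtain ⟨a', b', ha, hb, hs⟩ := hφ.vertical_support
  refine of_hperiodic (hφ.smooth.comp (by fun_prop)) (fun i hi p => ?_)
    ⟨a' - h 2, b' - h 2, by linarith, by linarith, fun p hp => ?_⟩
  · rw [add_right_comm, hφ.hperiodic i hi]
  · have := hs _ hp
    simp only [PiLp.add_apply, mem_Icc] at this ⊢
    constructor <;> linarith [this.1, this.2]

theorem mono {a₁ b₁ : ℝ} (hφ : IsTest L a b φ) (ha : a₁ ≤ a) (hb : b ≤ b₁) :
    IsTest L a₁ b₁ φ := by
  obtain ⟨a', b', ha', hb', hs⟩ := hφ.vertical_support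
  exact of_hperiodic hφ.smooth hφ.hperiodic ⟨a', b', ha.trans_lt ha', hb'.trans_le hb, hs⟩

theorem mem_Ioo (hφ : IsTest L a b φ) {p : Space} (hp : φ p ≠ 0) : p 2 ∈ Ioo a b := by
  obtain ⟨a', b', ha', hb', hs⟩ := hφ.vertical_support
  exact ⟨ha'.trans_le (hs p hp).1, (hs p hp).2.trans_lt hb'⟩

end IsTest

/-- Differentiation of an integral with respect to a translation of one factor. -/
theorem hasDerivAt_integral_translate {L a b : ℝ} {g φ : Space → ℝ}
    (hg : Integrable g (boxMeasure L a b)) (hφ : ContDiff ℝ ∞ φ) (h : Space) (t : ℝ) :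
    HasDerivAt (fun t : ℝ => ∫ p in box L a b, g p * φ (p + t • h))
      (∫ p in box L a b, g p * fderiv ℝ φ (p + t • h) h) t := by
  have hφ' : Continuous (fun q => fderiv ℝ φ q h) :=
    ((hφ.fderiv_right (m := ∞) (by simp)).clm_apply contDiff_const).continuous
  -- The box stays in the ball of this radius under all translations with parameter within `1` of
  -- `t`, which makes the dominating constant uniform.
  set R : ℝ := 2 * |L| + |a| + |b| + (|t| + 1) * ‖h‖
  obtain ⟨C, hC⟩ := (isCompact_closedBall (0 : Space) R).exists_bound_of_continuousOn
    hφ'.continuousOn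
  have hmem : ∀ p ∈ box L a b, ∀ x ∈ Metric.ball t 1, p + x • h ∈ Metric.closedBall (0 : Space) R := by
    intro p hp x hx
    rw [mem_closedBall_zero_iff]
    have h1 := mem_closedBall_zero_iff.1 (box_subset_closedBall L a b hp)
    have h2 : |x| ≤ |t| + 1 := by
      rw [Metric.mem_ball, Real.dist_eq] at hx
      have := abs_sub_abs_le_abs_sub x t
      linarith
    calc ‖p + x • h‖ ≤ ‖p‖ + ‖x • h‖ := norm_add_le _ _
      _ ≤ R := by
        rw [norm_smul, Real.norm_eq_abs]
        exact add_le_add h1 (mul_le_mul_of_nonneg_right h2 (norm_nonneg _))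
  have hInt : ∀ ψ : Space → ℝ, Continuous ψ → Integrable (fun p => g p * ψ p) (boxMeasure L a b) := by
    intro ψ hψ
    obtain ⟨K, hK⟩ := exists_bound_on_box hψ L a b
    refine hg.mul_bdd (c := K) hψ.aestronglyMeasurable ?_
    filter_upwards [ae_boxMeasure_mem L a b] with p hp using hK p hp
  refine (hasDerivAt_integral_of_dominated_loc_of_deriv_le (μ := boxMeasure L a b)
    (F := fun t p => g p * φ (p + t • h))
    (F' := fun t p => g p * fderiv ℝ φ (p + t • h) h) (bound := fun p => ‖g p‖ * C)
    (Metric.ball_mem_nhds t one_pos) ?_ ?_ ?_ ?_ ?_ ?_).2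
  · exact Eventually.of_forall fun x =>
      (hInt _ (hφ.continuous.comp (by fun_prop))).aestronglyMeasurable
  · exact hInt _ (hφ.continuous.comp (by fun_prop))
  · exact (hInt _ (hφ'.comp (by fun_prop : Continuous fun p : Space => p + t • h))).aestronglyMeasurable
  · filter_upwards [ae_boxMeasure_mem L a b] with p hp x hx
    rw [norm_mul]
    exact mul_le_mul_of_nonneg_left (hC _ (hmem p hp x hx)) (norm_nonneg _)
  · exact hg.norm.mul_const C
  · exact Eventually.of_forall fun p x _ =>
      (hasDerivAt_translate (hφ.differentiable (by simp)) p h x).const_mul (g p)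

/-- The integral of `φ` translated along a coordinate axis is constant for small translations, by
periodicity in the horizontal directions and by the room left by the support in the vertical one.
Its derivative at `0` is the integral in question, so no divergence theorem is needed. -/
theorem integral_partialDeriv_eq_zero {L a b : ℝ} (hL : 0 < L) {φ : Space → ℝ}
    (hφ : IsTest L a b φ) (i : Fin 3) : ∫ p in box L a b, partialDeriv i φ p = 0 := by
  have h1 := hasDerivAt_integral_translate (g := fun _ => (1 : ℝ)) (L := L) (a := a) (b := b)
    (integrable_const _) hφ.smooth (unitVec i) 0
  obtain ⟨a', b', ha', hb', hs⟩ := hφ.vertical_support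
  have h2 : (fun t : ℝ => ∫ p in box L a b, (1 : ℝ) * φ (p + t • unitVec i)) =ᶠ[𝓝 0]
      fun _ => ∫ p in box L a b, φ p := by
    have hpos : 0 < min (a' - a) (b - b') := lt_min (by linarith) (by linarith)
    filter_upwards [Metric.ball_mem_nhds (0 : ℝ) hpos] with t ht
    simp only [one_mul]
    rw [Metric.mem_ball, dist_zero_right, Real.norm_eq_abs, lt_min_iff] at ht
    have ht' := abs_le.1 (le_refl |t|)
    refine integral_box_add hL hφ.hperiodic _ (integrable_of_continuous hφ.continuous _ _ _)
      (integrable_of_continuous (hφ.continuous.comp (by fun_prop)) _ _ _) fun p hp => ?_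
    refine ⟨hφ.mem_Ioo hp, ?_⟩
    have h3 := hs p hp
    simp only [mem_Icc] at h3
    by_cases hi : (2 : Fin 3) = i
    · simp only [PiLp.smul_apply, unitVec_apply, hi, if_true, smul_eq_mul, mul_one, mem_Ioo] at h3 ⊢
      constructor <;> linarith
    · simp only [PiLp.smul_apply, unitVec_apply, hi, if_false, smul_eq_mul, mul_zero, mem_Ioo]
      constructor <;> linarith
  have h3 := h1.unique (h2.hasDerivAt_iff.2 (hasDerivAt_const (0 : ℝ) (∫ p in box L a b, φ p)))
  simpa [partialDeriv] using h3

theorem integral_mul_partialDeriv {L a b : ℝ} (hL : 0 < L) {φ χ : Space → ℝ}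
    (hφ : ContDiff ℝ ∞ φ) (hp : HPeriodic L φ) (hχ : IsTest L a b χ) (i : Fin 3) :
    ∫ p in box L a b, φ p * partialDeriv i χ p = - ∫ p in box L a b, partialDeriv i φ p * χ p := by
  have h := integral_partialDeriv_eq_zero hL (hχ.mul_left hφ hp) i
  simp only [partialDeriv_mul (hφ.differentiable (by simp)) hχ.differentiable] at h
  rw [integral_add] at h
  · linarith
  · exact integrable_of_continuous (hφ.continuous.mul (hχ.partialDeriv i).continuous) _ _ _
  · exact integrable_of_continuous ((contDiff_partialDeriv hφ i).continuous.mul hχ.continuous) _ _ _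

end Layered

end

noncomputable section

namespace Layered

/-! ### Periodic extension and density of the test functions -/

/-- The horizontal lattice vector that moves `p` into the fundamental cell `[0,L)²`. -/
def latticeVec (L : ℝ) (p : Space) : Space :=
  ((⌊p 0 / L⌋ : ℝ) * L) • unitVec 0 + ((⌊p 1 / L⌋ : ℝ) * L) • unitVec 1

/-- The horizontally periodic extension of the restriction of `g` to the fundamental cell. -/
def periodize {α : Type*} (L : ℝ) (g : Space → α) (p : Space) : α := g (p - latticeVec L p)

theorem latticeVec_zero (L : ℝ) (p : Space) : latticeVec L p 0 = ⌊p 0 / L⌋ * L := by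
  simp [latticeVec, unitVec_apply]

theorem latticeVec_one (L : ℝ) (p : Space) : latticeVec L p 1 = ⌊p 1 / L⌋ * L := by
  simp [latticeVec, unitVec_apply]

theorem latticeVec_two (L : ℝ) (p : Space) : latticeVec L p 2 = 0 := by
  simp [latticeVec, unitVec_apply]

theorem latticeVec_add {L : ℝ} (hL : 0 < L) (i : Fin 3) (hi : i ≠ 2) (p : Space) :
    latticeVec L (p + L • unitVec i) = latticeVec L p + L • unitVec i := by
  have h : ∀ x : ℝ, (⌊(x + L) / L⌋ : ℝ) * L = ⌊x / L⌋ * L + L := fun x => by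
    rw [add_div, div_self hL.ne', Int.floor_add_one]; push_cast; ring
  fin_cases i
  · ext j
    fin_cases j <;> simp [latticeVec, unitVec_apply, h]
  · ext j
    fin_cases j <;> simp [latticeVec, unitVec_apply, h]
  · exact absurd rfl hi

theorem periodize_hperiodic {α : Type*} {L : ℝ} (hL : 0 < L) (g : Space → α) :
    HPeriodic L (periodize L g) := by
  intro i hi p
  simp only [periodize]
  rw [latticeVec_add hL i hi, add_sub_add_right_eq_sub]

theorem latticeVec_eq {L : ℝ} (hL : 0 < L) {p q : Space}
    (h : ∀ i : Fin 3, i ≠ 2 → |(p - latticeVec L p) i - (q - latticeVec L p) i| < L ∧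
      (q - latticeVec L p) i ∈ Ico 0 L) : latticeVec L q = latticeVec L p := by
  have key : ∀ i : Fin 3, i ≠ 2 → (q i - ⌊p i / L⌋ * L) ∈ Ico 0 L →
      ⌊q i / L⌋ = ⌊p i / L⌋ := by
    intro i hi hq
    rw [Int.floor_eq_iff, le_div_iff₀ hL, div_lt_iff₀ hL]
    constructor <;> nlinarith [hq.1, hq.2]
  have h0 := key 0 (by decide) (by simpa [latticeVec_zero] using (h 0 (by decide)).2)
  have h1 := key 1 (by decide) (by simpa [latticeVec_one] using (h 1 (by decide)).2)
  simp [latticeVec, h0, h1]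

theorem latticeVec_of_mem_box {L a b : ℝ} {p : Space} (hp : p ∈ box L a b) :
    latticeVec L p = 0 := by
  have hL : 0 < L := hp.1.1.trans hp.1.2
  have key : ∀ x ∈ Ioo 0 L, ⌊x / L⌋ = 0 := fun x hx => by
    rw [Int.floor_eq_zero_iff]
    exact ⟨div_nonneg hx.1.le hL.le, (div_lt_one hL).2 hx.2⟩
  simp [latticeVec, key _ hp.1, key _ hp.2.1]

theorem periodize_of_mem_box {α : Type*} {L a b : ℝ} (g : Space → α) {p : Space}
    (hp : p ∈ box L a b) : periodize L g p = g p := by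
  simp [periodize, latticeVec_of_mem_box hp]

theorem measurable_latticeVec (L : ℝ) : Measurable (latticeVec L) := by
  unfold latticeVec
  fun_prop

theorem measurable_periodize {α : Type*} [MeasurableSpace α] (L : ℝ) {g : Space → α}
    (hg : Measurable g) : Measurable (periodize L g) :=
  hg.comp (measurable_id.sub (measurable_latticeVec L))

/-- The support of `g` keeps a distance `δ` from the lateral faces, so the periodic copies do not
meet there and the extension stays smooth. -/
theorem periodize_isTest {L a b : ℝ} (hL : 0 < L) {g : Space → ℝ} (hg : ContDiff ℝ ∞ g)
    (hc : HasCompactSupport g) (hs : tsupport g ⊆ box L a b) : IsTest L a b (periodize L g) := by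
  obtain ⟨δ, hδ, hthick⟩ := hc.isCompact.exists_cthickening_subset_open (isOpen_box L a b) hs
  have hmem : ∀ p, g p ≠ 0 → ∀ i : Fin 3, ∀ t : ℝ, |t| ≤ δ → p + t • unitVec i ∈ box L a b := by
    intro p hp i t ht
    refine hthick (Metric.mem_cthickening_of_dist_le _ p _ _ (subset_tsupport g hp) ?_)
    simpa [unitVec, norm_smul] using ht
  have hin : ∀ p, g p ≠ 0 → ∀ i : Fin 3, i ≠ 2 → p i ∈ Icc δ (L - δ) := by
    intro p hp i hi
    have h1 := hmem p hp i δ (abs_of_pos hδ).le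
    have h2 := hmem p hp i (-δ) (by rw [abs_neg, abs_of_pos hδ])
    simp only [box, mem_Ioo, PiLp.add_apply, PiLp.smul_apply, unitVec_apply, smul_eq_mul,
      mem_ofPred_eq] at h1 h2
    fin_cases i
    · simp at h1 h2 ⊢
      constructor <;> linarith [h1.1.2, h2.1.1]
    · simp at h1 h2 ⊢
      constructor <;> linarith [h1.2.1.2, h2.2.1.1]
    · exact absurd rfl hi
  have hinz : ∀ p, g p ≠ 0 → p 2 ∈ Icc (a + δ) (b - δ) := by
    intro p hp
    have h1 := hmem p hp 2 δ (abs_of_pos hδ).le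
    have h2 := hmem p hp 2 (-δ) (by rw [abs_neg, abs_of_pos hδ])
    simp only [box, mem_Ioo, PiLp.add_apply, PiLp.smul_apply, unitVec_apply, smul_eq_mul,
      mem_ofPred_eq] at h1 h2
    simp at h1 h2 ⊢
    constructor <;> linarith [h1.2.2.2, h2.2.2.1]
  have hcoord : ∀ p : Space, ∀ i : Fin 3, i ≠ 2 → ∃ m : ℤ,
      latticeVec L p i = m * L ∧ (p - latticeVec L p) i ∈ Ico 0 L := by
    intro p i hi
    have key : ∀ x : ℝ, x - ⌊x / L⌋ * L ∈ Ico 0 L := fun x => by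
      have h1 := Int.floor_le (x / L)
      have h2 := Int.lt_floor_add_one (x / L)
      rw [le_div_iff₀ hL] at h1
      rw [div_lt_iff₀ hL] at h2
      constructor <;> nlinarith
    fin_cases i
    · exact ⟨⌊p 0 / L⌋, latticeVec_zero L p, by simpa [latticeVec_zero] using key (p 0)⟩
    · exact ⟨⌊p 1 / L⌋, latticeVec_one L p, by simpa [latticeVec_one] using key (p 1)⟩
    · exact absurd rfl hi
  refine IsTest.of_hperiodic ?_ (periodize_hperiodic hL g)
    ⟨a + δ, b - δ, by linarith, by linarith, fun p hp => ?_⟩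
  · rw [contDiff_iff_contDiffAt]
    intro p
    -- Locally one translate suffices: if either of the two values is nonzero, its argument lies at
    -- least `δ` inside the fundamental cell, and then `q` and `p` belong to the same lattice cell.
    have hev : periodize L g =ᶠ[𝓝 p] fun q => g (q - latticeVec L p) := by
      filter_upwards [Metric.ball_mem_nhds p hδ] with q hq
      have hqi : ∀ i, |q i - p i| < δ := fun i => by
        have := PiLp.norm_apply_le (q - p) i
        rw [Metric.mem_ball, dist_eq_norm] at hq
        exact this.trans_lt hq
      by_cases h1 : g (q - latticeVec L q) = 0
      · by_cases h2 : g (q - latticeVec L p) = 0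
        · simp only [periodize, h1, h2]
        · have : latticeVec L q = latticeVec L p := by
            refine latticeVec_eq hL fun i hi => ?_
            have h3 := hin _ h2 i hi
            obtain ⟨m, hm, h4⟩ := hcoord p i hi
            simp only [PiLp.sub_apply, mem_Icc, mem_Ico] at h3 h4 ⊢
            refine ⟨abs_sub_lt_iff.2 ⟨?_, ?_⟩, ?_, ?_⟩ <;> linarith
          simp only [periodize, this]
      · have : latticeVec L q = latticeVec L p := by
          refine latticeVec_eq hL fun i hi => ?_
          have h3 := hin _ h1 i hi
          obtain ⟨m, hm, h4⟩ := hcoord p i hi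
          obtain ⟨m', hm', h5⟩ := hcoord q i hi
          have h6 := abs_lt.1 (hqi i)
          have : m' = m := by
            simp only [PiLp.sub_apply, mem_Icc, mem_Ico, hm, hm'] at h3 h4
            have e1 : ((m' - m : ℤ) : ℝ) * L < 1 * L := by push_cast; nlinarith
            have e2 : (-1 : ℝ) * L < ((m' - m : ℤ) : ℝ) * L := by push_cast; nlinarith
            have e1' := lt_of_mul_lt_mul_right e1 hL.le
            have e2' := lt_of_mul_lt_mul_right e2 hL.le
            have e1'' : m' - m < 1 := by exact_mod_cast e1'
            have e2'' : -1 < m' - m := by exact_mod_cast e2'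
            omega
          rw [← this] at hm
          simp only [PiLp.sub_apply, mem_Icc, mem_Ico, hm, hm'] at h3 h4 h5 ⊢
          refine ⟨abs_sub_lt_iff.2 ⟨?_, ?_⟩, ?_, ?_⟩ <;> linarith
        simp only [periodize, this]
    exact (hg.contDiffAt.comp p (by fun_prop : ContDiffAt ℝ ∞ (fun q => q - latticeVec L p) p)).congr_of_eventuallyEq hev
  · have := hinz _ hp
    simpa [latticeVec_two] using this

/-- The fundamental lemma for compactly supported functions on the open box applies, because such a
function and its periodization agree on the box. -/
theorem ae_eq_zero_of_integral_test {L a b : ℝ} (hL : 0 < L) {u : Space → ℝ}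
    (hu : Integrable u (boxMeasure L a b))
    (h : ∀ φ, IsTest L a b φ → ∫ p in box L a b, u p * φ p = 0) :
    u =ᵐ[boxMeasure L a b] 0 := by
  have hu' : IntegrableOn u (box L a b) volume := hu
  have key := (isOpen_box L a b).ae_eq_zero_of_integral_contDiff_smul_eq_zero
    (μ := (volume : Measure Space)) hu'.locallyIntegrableOn (fun g hg hc hs => ?_)
  · exact (ae_restrict_iff' (measurableSet_box L a b)).2 key
  · rw [← h _ (periodize_isTest hL hg hc hs), ← setIntegral_eq_integral_of_forall_compl_eq_zero
      (s := box L a b)]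
    · refine setIntegral_congr_fun (measurableSet_box L a b) fun p hp => ?_
      simp only [periodize_of_mem_box g hp, smul_eq_mul, mul_comm]
    · intro p hp
      have : g p = 0 := by
        by_contra hne
        exact hp (hs (subset_tsupport g hne))
      simp [this]

/-! ### The Hilbert space `L²` of a box and weak derivatives -/

/-- The Hilbert space `L²((0,L)² × (a,b))`. -/
abbrev BoxL2 (L a b : ℝ) : Type := Lp ℝ 2 (boxMeasure L a b)

/-- The space of test functions. -/
def Test (L a b : ℝ) : Submodule ℝ (Space → ℝ) where
  carrier := {φ | IsTest L a b φ}
  add_mem' := IsTest.add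
  zero_mem' := IsTest.zero
  smul_mem' c _ h := h.smul c

variable {L a b : ℝ}

theorem memLp_test (φ : Test L a b) : MemLp (φ : Space → ℝ) 2 (boxMeasure L a b) :=
  memLp_of_continuous φ.2.continuous _ _ _ _

theorem memLp_partialDeriv_test (i : Fin 3) (φ : Test L a b) :
    MemLp (partialDeriv i φ) 2 (boxMeasure L a b) :=
  memLp_of_continuous (φ.2.partialDeriv i).continuous _ _ _ _

/-- The class of a test function in `L²`. -/
def testL2 : Test L a b →ₗ[ℝ] BoxL2 L a b where
  toFun φ := (memLp_test φ).toLp φ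
  map_add' φ χ := MemLp.toLp_add (memLp_test φ) (memLp_test χ)
  map_smul' c φ := MemLp.toLp_const_smul c (memLp_test φ)

/-- The class of a partial derivative of a test function in `L²`. -/
def testDeriv (i : Fin 3) : Test L a b →ₗ[ℝ] BoxL2 L a b where
  toFun φ := (memLp_partialDeriv_test i φ).toLp _
  map_add' φ χ := by
    rw [← MemLp.toLp_add, MemLp.toLp_eq_toLp_iff]
    refine Eventually.of_forall fun p => ?_
    simp [partialDeriv, fderiv_add φ.2.differentiable.differentiableAt χ.2.differentiable.differentiableAt]
  map_smul' c φ := by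
    rw [RingHom.id_apply, ← MemLp.toLp_const_smul, MemLp.toLp_eq_toLp_iff]
    refine Eventually.of_forall fun p => ?_
    simp [partialDeriv, fderiv_const_smul φ.2.differentiable.differentiableAt]

theorem coeFn_testL2 (φ : Test L a b) : testL2 φ =ᵐ[boxMeasure L a b] φ :=
  (memLp_test φ).coeFn_toLp

theorem coeFn_testDeriv (i : Fin 3) (φ : Test L a b) :
    testDeriv i φ =ᵐ[boxMeasure L a b] partialDeriv i φ :=
  (memLp_partialDeriv_test i φ).coeFn_toLp

theorem inner_boxL2 (u v : BoxL2 L a b) : inner ℝ u v = ∫ p in box L a b, u p * v p := by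
  rw [L2.inner_def]
  refine integral_congr_ae (Eventually.of_forall fun p => ?_)
  simp [mul_comm]

theorem inner_eq_integral {u v : BoxL2 L a b} {f g : Space → ℝ} (hf : u =ᵐ[boxMeasure L a b] f)
    (hg : v =ᵐ[boxMeasure L a b] g) : inner ℝ u v = ∫ p in box L a b, f p * g p := by
  rw [inner_boxL2]
  refine integral_congr_ae ?_
  filter_upwards [hf, hg] with p h1 h2
  rw [h1, h2]

/-- `g` is the weak `i`-th partial derivative of `u`, for elements of `L²`. -/
def HasWD (i : Fin 3) (u g : BoxL2 L a b) : Prop :=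
  ∀ φ : Test L a b, inner ℝ u (testDeriv i φ) = - inner ℝ g (testL2 φ)

theorem hasWeakPartial_iff_hasWD {i : Fin 3} {u g : BoxL2 L a b} {f k : Space → ℝ}
    (hf : u =ᵐ[boxMeasure L a b] f) (hk : g =ᵐ[boxMeasure L a b] k) :
    HasWeakPartial L a b i f k ↔ HasWD i u g := by
  constructor
  · intro h φ
    rw [inner_eq_integral hf (coeFn_testDeriv i φ), inner_eq_integral hk (coeFn_testL2 φ)]
    exact h φ φ.2
  · intro h φ hφ
    have := h ⟨φ, hφ⟩
    rwa [inner_eq_integral hf (coeFn_testDeriv i _), inner_eq_integral hk (coeFn_testL2 _)] at this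

theorem eq_zero_of_inner_test (hL : 0 < L) {u : BoxL2 L a b}
    (h : ∀ φ : Test L a b, inner ℝ u (testL2 φ) = 0) : u = 0 := by
  rw [Lp.eq_zero_iff_ae_eq_zero]
  refine ae_eq_zero_of_integral_test hL (Lp.memLp u |>.integrable (by norm_num)) fun φ hφ => ?_
  have := h ⟨φ, hφ⟩
  rwa [inner_eq_integral (ae_eq_refl _) (coeFn_testL2 _)] at this

theorem eq_of_inner_test (hL : 0 < L) {u v : BoxL2 L a b}
    (h : ∀ φ : Test L a b, inner ℝ u (testL2 φ) = inner ℝ v (testL2 φ)) : u = v := by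
  rw [← sub_eq_zero]
  exact eq_zero_of_inner_test hL fun φ => by rw [inner_sub_left, h, sub_self]

theorem dense_range_testL2 (hL : 0 < L) :
    DenseRange (testL2 : Test L a b →ₗ[ℝ] BoxL2 L a b) := by
  have : (LinearMap.range (testL2 : Test L a b →ₗ[ℝ] BoxL2 L a b)).topologicalClosure = ⊤ := by
    rw [Submodule.topologicalClosure_eq_top_iff, Submodule.eq_bot_iff]
    intro u hu
    refine eq_zero_of_inner_test hL fun φ => ?_
    rw [real_inner_comm]
    exact (Submodule.mem_orthogonal _ _).1 hu _ ⟨φ, rfl⟩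
  have h := (Submodule.dense_iff_topologicalClosure_eq_top).2 this
  rwa [DenseRange, ← LinearMap.coe_range]

theorem HasWD.unique (hL : 0 < L) {i : Fin 3} {u g g' : BoxL2 L a b} (h : HasWD i u g)
    (h' : HasWD i u g') : g = g' :=
  eq_of_inner_test hL fun φ => by linarith [h φ, h' φ]

theorem HasWD.add {i : Fin 3} {u v g k : BoxL2 L a b} (h : HasWD i u g) (h' : HasWD i v k) :
    HasWD i (u + v) (g + k) := fun φ => by
  rw [inner_add_left, inner_add_left, h, h']; ring

theorem HasWD.smul {i : Fin 3} {u g : BoxL2 L a b} (h : HasWD i u g) (c : ℝ) :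
    HasWD i (c • u) (c • g) := fun φ => by
  rw [inner_smul_left, inner_smul_left, h]; simp

theorem HasWD.neg {i : Fin 3} {u g : BoxL2 L a b} (h : HasWD i u g) : HasWD i (-u) (-g) := by
  simpa using h.smul (-1)

theorem HasWD.sub {i : Fin 3} {u v g k : BoxL2 L a b} (h : HasWD i u g) (h' : HasWD i v k) :
    HasWD i (u - v) (g - k) := by
  simpa [sub_eq_add_neg] using h.add h'.neg

theorem hasWD_test (hL : 0 < L) (i : Fin 3) (φ : Test L a b) :
    HasWD i (testL2 φ) (testDeriv i φ) := fun χ => by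
  rw [inner_eq_integral (coeFn_testL2 φ) (coeFn_testDeriv i χ),
    inner_eq_integral (coeFn_testDeriv i φ) (coeFn_testL2 χ)]
  exact integral_mul_partialDeriv hL φ.2.smooth φ.2.hperiodic χ.2 i

theorem HasWD.of_tendsto {i : Fin 3} {u g : BoxL2 L a b} {u' g' : ℕ → BoxL2 L a b}
    (h : ∀ n, HasWD i (u' n) (g' n)) (hu : Tendsto u' atTop (𝓝 u)) (hg : Tendsto g' atTop (𝓝 g)) :
    HasWD i u g := fun φ => by
  refine tendsto_nhds_unique (hu.inner (tendsto_const_nhds (x := testDeriv i φ))) ?_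
  simp only [h _ φ]
  exact (hg.inner tendsto_const_nhds).neg

/-- A functional dominated by the norm of the image of a linear map is represented by a vector. -/
theorem exists_inner_eq_of_bound {F E : Type*} [AddCommGroup F] [Module ℝ F]
    [NormedAddCommGroup E] [InnerProductSpace ℝ E] [CompleteSpace E] (ι : F →ₗ[ℝ] E)
    (ℓ : F →ₗ[ℝ] ℝ) (C : ℝ) (hC : 0 ≤ C) (h : ∀ x, |ℓ x| ≤ C * ‖ι x‖) :
    ∃ g : E, ‖g‖ ≤ C ∧ ∀ x, ℓ x = inner ℝ g (ι x) := by
  have hker : LinearMap.ker ι ≤ LinearMap.ker ℓ := fun x hx => by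
    have := h x
    rw [LinearMap.mem_ker.1 hx, norm_zero, mul_zero] at this
    exact abs_eq_zero.1 (le_antisymm this (abs_nonneg _))
  -- The functional descends to the range of `ι`, is bounded there, extends by Hahn–Banach, and is
  -- represented by Riesz.
  let m : LinearMap.range ι →ₗ[ℝ] ℝ :=
    ((LinearMap.ker ι).liftQ ℓ hker).comp ι.quotKerEquivRange.symm.toLinearMap
  have hm : ∀ x, m ⟨ι x, x, rfl⟩ = ℓ x := fun x => by
    have : ι.quotKerEquivRange.symm ⟨ι x, x, rfl⟩ = Submodule.Quotient.mk x := by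
      rw [LinearEquiv.symm_apply_eq]; rfl
    change (LinearMap.ker ι).liftQ ℓ hker (ι.quotKerEquivRange.symm ⟨ι x, x, rfl⟩) = _
    rw [this]
    simp
  let m' : StrongDual ℝ (LinearMap.range ι) := m.mkContinuous C (by
    rintro ⟨_, x, rfl⟩
    rw [hm]
    exact h x)
  obtain ⟨G, hG, hn⟩ := exists_extension_norm_eq _ m'
  refine ⟨(InnerProductSpace.toDual ℝ E).symm G, ?_, fun x => ?_⟩
  · rw [LinearIsometryEquiv.norm_map, hn]
    exact LinearMap.mkContinuous_norm_le _ hC _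
  · rw [InnerProductSpace.toDual_symm_apply, ← hm x]
    exact (hG ⟨ι x, x, rfl⟩).symm

/-- Duality characterization of weak differentiability; it converts bounds on difference quotients
into derivatives. -/
theorem exists_hasWD_of_bound (i : Fin 3) (u : BoxL2 L a b) {C : ℝ} (hC : 0 ≤ C)
    (h : ∀ φ : Test L a b, |inner ℝ u (testDeriv i φ)| ≤ C * ‖testL2 φ‖) :
    ∃ g, ‖g‖ ≤ C ∧ HasWD i u g := by
  obtain ⟨g, hg, hg'⟩ := exists_inner_eq_of_bound testL2
    (((innerₛₗ ℝ u)).comp (testDeriv i)) C hC h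
  refine ⟨-g, by rwa [norm_neg], fun φ => ?_⟩
  rw [inner_neg_left, neg_neg, ← hg' φ]
  rfl

/-! ### Weak derivatives of functions -/

theorem weakPartial_spec {i : Fin 3} {u : Space → ℝ}
    (h : ∃ g, MemLp g 2 (boxMeasure L a b) ∧ HasWeakPartial L a b i u g) :
    MemLp (weakPartial L a b i u) 2 (boxMeasure L a b) ∧
      HasWeakPartial L a b i u (weakPartial L a b i u) := by
  rw [weakPartial, dif_pos h]
  exact h.choose_spec

theorem HasWeakPartial.ae_unique (hL : 0 < L) {i : Fin 3} {u g k : Space → ℝ}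
    (hg : MemLp g 2 (boxMeasure L a b)) (hk : MemLp k 2 (boxMeasure L a b))
    (h : HasWeakPartial L a b i u g) (h' : HasWeakPartial L a b i u k) :
    g =ᵐ[boxMeasure L a b] k := by
  have hi : ∀ {f : Space → ℝ}, MemLp f 2 (boxMeasure L a b) → ∀ {φ : Space → ℝ},
      IsTest L a b φ → Integrable (fun p => f p * φ p) (boxMeasure L a b) :=
    fun hf _ hφ => hf.integrable_mul (memLp_of_continuous hφ.continuous L a b 2)
  have := ae_eq_zero_of_integral_test (u := g - k) hL
    ((hg.integrable (by norm_num)).sub (hk.integrable (by norm_num))) fun φ hφ => by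
      simp only [Pi.sub_apply, sub_mul]
      rw [integral_sub (hi hg hφ) (hi hk hφ)]
      linarith [h φ hφ, h' φ hφ]
  filter_upwards [this] with p hp
  simpa [sub_eq_zero] using hp

theorem weakPartial_ae_eq (hL : 0 < L) {i : Fin 3} {u g : Space → ℝ}
    (hg : MemLp g 2 (boxMeasure L a b)) (h : HasWeakPartial L a b i u g) :
    weakPartial L a b i u =ᵐ[boxMeasure L a b] g :=
  have hs := weakPartial_spec ⟨g, hg, h⟩
  HasWeakPartial.ae_unique hL hs.1 hg hs.2 h

theorem weakPartial_ae_eq_of_hasWD (hL : 0 < L) {i : Fin 3} {u g : BoxL2 L a b} {f : Space → ℝ}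
    (hf : u =ᵐ[boxMeasure L a b] f) (h : HasWD i u g) :
    weakPartial L a b i f =ᵐ[boxMeasure L a b] g :=
  weakPartial_ae_eq hL (Lp.memLp g) ((hasWeakPartial_iff_hasWD hf (ae_eq_refl _)).2 h)

theorem memH1_iff {f : Space → ℝ} {u : BoxL2 L a b} (hf : u =ᵐ[boxMeasure L a b] f) :
    MemH1 L a b f ↔ ∃ g : Fin 3 → BoxL2 L a b, ∀ i, HasWD i u (g i) := by
  constructor
  · rintro ⟨-, h⟩
    choose g hg hw using h
    exact ⟨fun i => (hg i).toLp _, fun i =>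
      (hasWeakPartial_iff_hasWD hf (hg i).coeFn_toLp).1 (hw i)⟩
  · rintro ⟨g, hg⟩
    exact ⟨(memLp_congr_ae hf).1 (Lp.memLp u), fun i => ⟨g i, Lp.memLp _,
      (hasWeakPartial_iff_hasWD hf (ae_eq_refl _)).2 (hg i)⟩⟩

theorem l2Sq_congr {f g : Space → ℝ} (h : f =ᵐ[boxMeasure L a b] g) :
    l2Sq L a b f = l2Sq L a b g :=
  lintegral_congr_ae (by filter_upwards [h] with p hp; rw [hp])

theorem l2Sq_eq_of_ae_eq {f : Space → ℝ} {u : BoxL2 L a b} (h : u =ᵐ[boxMeasure L a b] f) :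
    l2Sq L a b f = ENNReal.ofReal (‖u‖ ^ 2) := by
  rw [← l2Sq_congr h, l2Sq, Lp.norm_def, ← ENNReal.toReal_pow, ENNReal.ofReal_toReal (ENNReal.pow_ne_top (Lp.eLpNorm_ne_top u)),
    eLpNorm_eq_lintegral_rpow_enorm_toReal (by norm_num) (by norm_num)]
  simp only [ENNReal.toReal_ofNat, ENNReal.rpow_ofNat]
  rw [← ENNReal.rpow_natCast, ← ENNReal.rpow_mul]
  norm_num

theorem h1Sq_eq (hL : 0 < L) {f : Space → ℝ} {u : BoxL2 L a b} {g : Fin 3 → BoxL2 L a b}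
    (hf : u =ᵐ[boxMeasure L a b] f) (hg : ∀ i, HasWD i u (g i)) :
    h1Sq L a b f = ENNReal.ofReal (‖u‖ ^ 2 + ∑ i, ‖g i‖ ^ 2) := by
  rw [h1Sq, l2Sq_eq_of_ae_eq hf, ENNReal.ofReal_add (by positivity) (by positivity),
    ENNReal.ofReal_sum_of_nonneg (fun i _ => by positivity)]
  congr 1
  refine Finset.sum_congr rfl fun i _ => ?_
  exact l2Sq_eq_of_ae_eq (weakPartial_ae_eq_of_hasWD hL hf (hg i)).symm

end Layered

end

noncomputable section

namespace Layered

/-! ### Approximation of piecewise smooth functions by test functions -/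

theorem exists_bound_deriv_smoothTransition : ∃ K, 0 ≤ K ∧ ∀ t, |deriv Real.smoothTransition t| ≤ K := by
  have hc : Continuous (deriv Real.smoothTransition) :=
    Real.smoothTransition.contDiff.continuous_deriv (n := 1) le_rfl
  obtain ⟨K, hK⟩ := (isCompact_Icc (a := (-1 : ℝ)) (b := 2)).exists_bound_of_continuousOn
    hc.continuousOn
  refine ⟨max K 0, le_max_right _ _, fun t => ?_⟩
  by_cases ht : t ∈ Icc (-1 : ℝ) 2
  · exact (hK t ht).trans (le_max_left _ _)
  · have : deriv Real.smoothTransition t = 0 := by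
      rw [mem_Icc, not_and_or, not_le, not_le] at ht
      rcases ht with ht | ht
      · have : Real.smoothTransition =ᶠ[𝓝 t] fun _ => 0 := by
          filter_upwards [eventually_lt_nhds ht] with s hs
          exact Real.smoothTransition.zero_of_nonpos (by linarith)
        rw [this.deriv_eq]; simp
      · have : Real.smoothTransition =ᶠ[𝓝 t] fun _ => 1 := by
          filter_upwards [eventually_gt_nhds ht] with s hs
          exact Real.smoothTransition.one_of_one_le (by linarith)
        rw [this.deriv_eq]; simp
    simp [this]

/-- A smooth approximation of the identity of `[0,1]` that is constant near the end points. -/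
def flatStep (n : ℕ) (t : ℝ) : ℝ :=
  (1 - Real.smoothTransition ((n + 4) * (1 - t) - 1)) +
    t * Real.smoothTransition ((n + 4) * t - 1) * Real.smoothTransition ((n + 4) * (1 - t) - 1)

theorem contDiff_flatStep (n : ℕ) : ContDiff ℝ ∞ (flatStep n) := by
  have h : ContDiff ℝ ∞ Real.smoothTransition := Real.smoothTransition.contDiff
  unfold flatStep
  fun_prop

theorem flatStep_zero {n : ℕ} {t : ℝ} (ht : t ≤ 1 / (n + 4)) : flatStep n t = 0 := by
  have hn : (0 : ℝ) < n + 4 := by positivity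
  have h1 : t * (n + 4) ≤ 1 := (le_div_iff₀ hn).1 ht
  have hn' : (0 : ℝ) ≤ n := Nat.cast_nonneg n
  rw [flatStep, Real.smoothTransition.zero_of_nonpos (x := (n + 4) * t - 1) (by linarith),
    Real.smoothTransition.one_of_one_le (x := (n + 4) * (1 - t) - 1) (by nlinarith)]
  simp

theorem flatStep_one {n : ℕ} {t : ℝ} (ht : 1 - 1 / (n + 4) ≤ t) : flatStep n t = 1 := by
  have hn : (0 : ℝ) < n + 4 := by positivity
  have h1 : (1 - t) * (n + 4) ≤ 1 := (le_div_iff₀ hn).1 (by linarith)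
  rw [flatStep, Real.smoothTransition.zero_of_nonpos (x := (n + 4) * (1 - t) - 1) (by linarith)]
  simp

theorem flatStep_mem_Icc {n : ℕ} {t : ℝ} (ht : t ∈ Icc (0 : ℝ) 1) :
    flatStep n t ∈ Icc (0 : ℝ) 1 := by
  set A := Real.smoothTransition ((n + 4) * t - 1)
  set B := Real.smoothTransition ((n + 4) * (1 - t) - 1)
  have hA := Real.smoothTransition.nonneg ((n + 4) * t - 1)
  have hA' := Real.smoothTransition.le_one ((n + 4) * t - 1)
  have hB := Real.smoothTransition.nonneg ((n + 4) * (1 - t) - 1)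
  have hB' := Real.smoothTransition.le_one ((n + 4) * (1 - t) - 1)
  have h1 : 0 ≤ t * A := mul_nonneg ht.1 hA
  have h2 : t * A ≤ 1 := mul_le_one₀ ht.2 hA hA'
  change (1 - B) + t * A * B ∈ Icc (0 : ℝ) 1
  constructor <;> nlinarith [mul_nonneg h1 hB]

theorem flatStep_eventually_eq {t : ℝ} (ht : t ∈ Ioo (0 : ℝ) 1) :
    ∀ᶠ n : ℕ in atTop, flatStep n =ᶠ[𝓝 t] id := by
  have hlim : Tendsto (fun n : ℕ => (n : ℝ)) atTop atTop := tendsto_natCast_atTop_atTop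
  filter_upwards [hlim.eventually_gt_atTop (2 / t), hlim.eventually_gt_atTop (2 / (1 - t))]
    with n h1 h2
  rw [div_lt_iff₀ ht.1] at h1
  rw [div_lt_iff₀ (by linarith [ht.2])] at h2
  have e1 : ∀ᶠ s : ℝ in 𝓝 t, 2 < n * s :=
    (continuous_const.mul continuous_id).continuousAt.eventually_const_lt h1
  have e2 : ∀ᶠ s : ℝ in 𝓝 t, 2 < n * (1 - s) :=
    (continuous_const.mul (continuous_const.sub continuous_id)).continuousAt.eventually_const_lt h2
  filter_upwards [e1, e2, isOpen_Ioo.mem_nhds ht] with s h1 h2 hs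
  rw [flatStep, Real.smoothTransition.one_of_one_le (x := (n + 4) * s - 1) (by nlinarith [hs.1]),
    Real.smoothTransition.one_of_one_le (x := (n + 4) * (1 - s) - 1) (by nlinarith [hs.2])]
  simp

/-- The cutoffs have slopes of order `N = n + 4`, but they vary only within distance `2/N` of the
end points, where the factor `t` or `1 - t` compensates. Uniformity in `n` is what later permits
dominated convergence of gradients. -/
theorem exists_bound_deriv_flatStep : ∃ C, ∀ n t, |deriv (flatStep n) t| ≤ C := by
  obtain ⟨K, hK0, hK⟩ := exists_bound_deriv_smoothTransition
  have hd : Differentiable ℝ Real.smoothTransition :=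
    (Real.smoothTransition.contDiff (n := 1)).differentiable (by simp)
  refine ⟨2 * K + 1 + 2 * K, fun n t => ?_⟩
  set N : ℝ := n + 4 with hN
  have hn : (0 : ℝ) ≤ n := Nat.cast_nonneg n
  have hNpos : 0 < N := by positivity
  by_cases h0 : t < 1 / N
  · have : flatStep n =ᶠ[𝓝 t] fun _ => 0 := by
      filter_upwards [eventually_lt_nhds h0] with s hs using flatStep_zero hs.le
    rw [this.deriv_eq]; simp; positivity
  by_cases h1 : 1 - 1 / N < t
  · have : flatStep n =ᶠ[𝓝 t] fun _ => 1 := by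
      filter_upwards [eventually_gt_nhds h1] with s hs using flatStep_one hs.le
    rw [this.deriv_eq]; simp; positivity
  have hN1 : 0 < 1 / N := by positivity
  have ht0 : 0 ≤ t := by linarith
  have ht1 : t ≤ 1 := by linarith
  set A := Real.smoothTransition (N * t - 1) with hAdef
  set B := Real.smoothTransition (N * (1 - t) - 1) with hBdef
  set A' := deriv Real.smoothTransition (N * t - 1) with hA'def
  set B' := deriv Real.smoothTransition (N * (1 - t) - 1) with hB'def
  have hA : HasDerivAt (fun s => Real.smoothTransition (N * s - 1)) (A' * N) t := by
    have h : HasDerivAt (fun s => N * s - 1) N t := by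
      simpa using ((hasDerivAt_id t).const_mul N).sub_const 1
    exact (hd (N * t - 1)).hasDerivAt.comp t h
  have hB : HasDerivAt (fun s => Real.smoothTransition (N * (1 - s) - 1)) (B' * (-N)) t := by
    have h : HasDerivAt (fun s => N * (1 - s) - 1) (-N) t := by
      simpa using (((hasDerivAt_id t).const_sub 1).const_mul N).sub_const 1
    exact (hd (N * (1 - t) - 1)).hasDerivAt.comp t h
  have hS : HasDerivAt (flatStep n) (-(B' * (-N)) + ((1 * A + t * (A' * N)) * B + t * A * (B' * (-N)))) t := by
    have h := (hB.const_sub 1).add (((hasDerivAt_id t).mul hA).mul hB)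
    exact h
  rw [hS.deriv]
  have kA : |t * (A' * N)| ≤ 2 * K := by
    by_cases hc : N * t ≤ 2
    · rw [show t * (A' * N) = (N * t) * A' by ring, abs_mul, abs_of_nonneg (by positivity : 0 ≤ N * t)]
      exact mul_le_mul hc (hK _) (abs_nonneg _) (by norm_num)
    · have : A' = 0 := by
        have : Real.smoothTransition =ᶠ[𝓝 (N * t - 1)] fun _ => 1 := by
          filter_upwards [eventually_gt_nhds (show 1 < N * t - 1 by linarith)] with s hs
          exact Real.smoothTransition.one_of_one_le hs.le
        rw [hA'def, this.deriv_eq]; simp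
      simp [this, hK0]
  -- Where `B'` does not vanish, `t` is near `1` and `A = 1`, so the bracket is the small number `1
  -- - t`. This needs `N ≥ 4`.
  have kB : |(B' * N) * (1 - t * A)| ≤ 2 * K := by
    by_cases hc : N * (1 - t) ≤ 2
    · have hA1 : A = 1 := Real.smoothTransition.one_of_one_le (by nlinarith)
      have h1t : 0 ≤ 1 - t := by linarith
      rw [hA1, show B' * N * (1 - t * 1) = (N * (1 - t)) * B' by ring, abs_mul,
        abs_of_nonneg (by positivity : 0 ≤ N * (1 - t))]
      exact mul_le_mul hc (hK _) (abs_nonneg _) (by norm_num)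
    · have : B' = 0 := by
        have : Real.smoothTransition =ᶠ[𝓝 (N * (1 - t) - 1)] fun _ => 1 := by
          filter_upwards [eventually_gt_nhds (show 1 < N * (1 - t) - 1 by linarith)] with s hs
          exact Real.smoothTransition.one_of_one_le hs.le
        rw [hB'def, this.deriv_eq]; simp
      simp [this, hK0]
  have hA0 : 0 ≤ A := Real.smoothTransition.nonneg _
  have hA1 : A ≤ 1 := Real.smoothTransition.le_one _
  have hB0 : 0 ≤ B := Real.smoothTransition.nonneg _
  have hB1 : B ≤ 1 := Real.smoothTransition.le_one _
  have kAB : |A * B| ≤ 1 := by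
    rw [abs_of_nonneg (mul_nonneg hA0 hB0)]; exact mul_le_one₀ hA1 hB0 hB1
  have kAB' : |t * (A' * N) * B| ≤ 2 * K := by
    rw [abs_mul, abs_of_nonneg hB0]
    nlinarith [abs_nonneg (t * (A' * N))]
  calc _ = |(B' * N) * (1 - t * A) + A * B + t * (A' * N) * B| := by congr 1; ring
    _ ≤ |(B' * N) * (1 - t * A)| + |A * B| + |t * (A' * N) * B| := abs_add_three _ _ _
    _ ≤ _ := by linarith

/-! ### Layers, and a height map that is constant near the interfaces -/

namespace Medium

variable {l : ℕ} (M : Medium l)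

theorem z_succ_lt (j : Fin l) : M.z j.succ < M.z j.castSucc := M.z_anti Fin.castSucc_lt_succ

theorem z_nonpos (k : Fin (l + 1)) : M.z k ≤ 0 := by
  rw [← M.z_zero]; exact M.z_anti.antitone (Fin.zero_le k)

theorem neg_H_le_z (k : Fin (l + 1)) : -M.H ≤ M.z k := by
  rw [← M.z_last]; exact M.z_anti.antitone (Fin.le_last k)

theorem exists_layer {z : ℝ} (h1 : -M.H < z) (h2 : z ≤ 0) :
    ∃ j : Fin l, z ∈ Ioc (M.z j.succ) (M.z j.castSucc) := by
  have key : ∀ k : Fin (l + 1), M.z k < z → ∃ j : Fin l, z ∈ Ioc (M.z j.succ) (M.z j.castSucc) := by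
    intro k
    induction k using Fin.induction with
    | zero => intro h; rw [M.z_zero] at h; linarith
    | succ j ih =>
      intro h
      by_cases hz : z ≤ M.z j.castSucc
      · exact ⟨j, h, hz⟩
      · exact ih (not_le.1 hz)
  exact key (Fin.last l) (by rwa [M.z_last])

theorem layer_order (j j' : Fin l) (h : j' ≠ j) :
    M.z j.castSucc ≤ M.z j'.succ ∨ M.z j'.castSucc ≤ M.z j.succ := by
  rcases lt_or_gt_of_ne h with h | h
  · left
    exact M.z_anti.antitone (Fin.succ_le_castSucc_iff.2 h)
  · right
    exact M.z_anti.antitone (Fin.succ_le_castSucc_iff.2 h)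

theorem sum_layer_telescope (F : Fin (l + 1) → ℝ) :
    ∑ j : Fin l, (F j.castSucc - F j.succ) = F 0 - F (Fin.last l) := by
  rw [Finset.sum_sub_distrib]
  have h1 := Fin.sum_univ_succ F
  have h2 := Fin.sum_univ_castSucc F
  linarith

/-- Smooth reparametrization of the height that is constant near every interface. -/
def flatten (n : ℕ) (z : ℝ) : ℝ :=
  -M.H + ∑ j : Fin l, (M.z j.castSucc - M.z j.succ) *
    flatStep n ((z - M.z j.succ) / (M.z j.castSucc - M.z j.succ))

theorem contDiff_flatten (n : ℕ) : ContDiff ℝ ∞ (M.flatten n) := by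
  unfold flatten
  refine contDiff_const.add (ContDiff.sum fun j _ => contDiff_const.mul
    ((contDiff_flatStep n).comp ?_))
  exact (contDiff_id.sub contDiff_const).div_const _

/-- The right-hand side of `h` is the length of the part of a layer below `y`. These lengths
telescope to `y + H`. -/
theorem flatten_eq_of_terms (n : ℕ) {z y : ℝ} (hy : y ∈ Icc (-M.H) 0)
    (h : ∀ j : Fin l, (M.z j.castSucc - M.z j.succ) *
      flatStep n ((z - M.z j.succ) / (M.z j.castSucc - M.z j.succ))
        = min (M.z j.castSucc) y - min (M.z j.succ) y) : M.flatten n z = y := by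
  rw [flatten, Finset.sum_congr rfl fun j _ => h j,
    sum_layer_telescope fun k => min (M.z k) y, M.z_zero, M.z_last, min_eq_right hy.2,
    min_eq_left hy.1]
  ring

/-- The margin beyond the interface matters: it makes the contribution of a layer constant on a
whole neighbourhood of its boundary heights. -/
theorem flatStep_layer_above (n : ℕ) (j : Fin l) {z : ℝ}
    (hz : z ≤ M.z j.succ + (M.z j.castSucc - M.z j.succ) / (n + 4)) :
    flatStep n ((z - M.z j.succ) / (M.z j.castSucc - M.z j.succ)) = 0 := by
  have hd : 0 < M.z j.castSucc - M.z j.succ := sub_pos.2 (M.z_succ_lt j)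
  refine flatStep_zero ?_
  rw [div_le_iff₀ hd]
  calc z - M.z j.succ ≤ (M.z j.castSucc - M.z j.succ) / (n + 4) := by linarith
    _ = _ := by ring

theorem flatStep_layer_below (n : ℕ) (j : Fin l) {z : ℝ}
    (hz : M.z j.castSucc - (M.z j.castSucc - M.z j.succ) / (n + 4) ≤ z) :
    flatStep n ((z - M.z j.succ) / (M.z j.castSucc - M.z j.succ)) = 1 := by
  have hd : 0 < M.z j.castSucc - M.z j.succ := sub_pos.2 (M.z_succ_lt j)
  refine flatStep_one ?_
  rw [le_div_iff₀ hd]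
  calc _ = M.z j.castSucc - (M.z j.castSucc - M.z j.succ) / (n + 4) - M.z j.succ := by ring
    _ ≤ _ := by linarith

theorem layer_div_pos (n : ℕ) (j : Fin l) : 0 < (M.z j.castSucc - M.z j.succ) / ((n : ℝ) + 4) :=
  div_pos (sub_pos.2 (M.z_succ_lt j)) (by positivity)

theorem flatten_of_mem_layer (n : ℕ) (j : Fin l) {z : ℝ}
    (hz : z ∈ Icc (M.z j.succ) (M.z j.castSucc)) :
    M.flatten n z = M.z j.succ + (M.z j.castSucc - M.z j.succ) *
      flatStep n ((z - M.z j.succ) / (M.z j.castSucc - M.z j.succ)) := by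
  have hd : 0 < M.z j.castSucc - M.z j.succ := sub_pos.2 (M.z_succ_lt j)
  have hS := flatStep_mem_Icc (n := n) (t := (z - M.z j.succ) / (M.z j.castSucc - M.z j.succ))
    ⟨div_nonneg (by linarith [hz.1]) hd.le, (div_le_one hd).2 (by linarith [hz.2])⟩
  set σ := flatStep n ((z - M.z j.succ) / (M.z j.castSucc - M.z j.succ))
  set y := M.z j.succ + (M.z j.castSucc - M.z j.succ) * σ with hy
  have hy1 : M.z j.succ ≤ y := by nlinarith [hS.1]
  have hy2 : y ≤ M.z j.castSucc := by nlinarith [hS.2]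
  refine M.flatten_eq_of_terms n ⟨(M.neg_H_le_z _).trans hy1, hy2.trans (M.z_nonpos _)⟩
    fun j' => ?_
  by_cases hj : j' = j
  · subst hj
    rw [min_eq_right hy2, min_eq_left hy1, hy]
    ring
  have hp := M.layer_div_pos n j'
  have hlt := M.z_succ_lt j'
  rcases M.layer_order j j' hj with h | h
  · rw [M.flatStep_layer_above n j' (by linarith [hz.2]), min_eq_right (by linarith),
      min_eq_right (by linarith)]
    ring
  · rw [M.flatStep_layer_below n j' (by linarith [hz.1]), min_eq_left (by linarith),
      min_eq_left (by linarith)]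
    ring

theorem flatten_mem_layer (n : ℕ) (j : Fin l) {z : ℝ}
    (hz : z ∈ Icc (M.z j.succ) (M.z j.castSucc)) :
    M.flatten n z ∈ Icc (M.z j.succ) (M.z j.castSucc) := by
  rw [M.flatten_of_mem_layer n j hz]
  have hd : 0 < M.z j.castSucc - M.z j.succ := sub_pos.2 (M.z_succ_lt j)
  have hS := flatStep_mem_Icc (n := n) (t := (z - M.z j.succ) / (M.z j.castSucc - M.z j.succ))
    ⟨div_nonneg (by linarith [hz.1]) hd.le, (div_le_one hd).2 (by linarith [hz.2])⟩
  constructor <;> nlinarith [hS.1, hS.2]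

/-- The hypothesis says that each layer lies above both `z` and the interface, or below both, so
every layer contributes either nothing or its full thickness. -/
theorem flatten_eventually_const (n : ℕ) (k : Fin (l + 1)) {z : ℝ}
    (h : ∀ j : Fin l, (z ≤ M.z j.succ ∧ M.z k ≤ M.z j.succ) ∨
      (M.z j.castSucc ≤ z ∧ M.z j.castSucc ≤ M.z k)) :
    ∀ᶠ z' in 𝓝 z, M.flatten n z' = M.z k := by
  have hev : ∀ j : Fin l, ∀ᶠ z' in 𝓝 z, (M.z j.castSucc - M.z j.succ) *
      flatStep n ((z' - M.z j.succ) / (M.z j.castSucc - M.z j.succ))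
        = min (M.z j.castSucc) (M.z k) - min (M.z j.succ) (M.z k) := by
    intro j
    have hp := M.layer_div_pos n j
    have hlt := M.z_succ_lt j
    rcases h j with h | h
    · filter_upwards [eventually_lt_nhds (show z < M.z j.succ +
        (M.z j.castSucc - M.z j.succ) / (n + 4) by linarith [h.1])] with z' hz'
      rw [M.flatStep_layer_above n j hz'.le, min_eq_right (by linarith), min_eq_right (by linarith)]
      ring
    · filter_upwards [eventually_gt_nhds (show M.z j.castSucc -
        (M.z j.castSucc - M.z j.succ) / (n + 4) < z by linarith [h.1])] with z' hz'
      rw [M.flatStep_layer_below n j hz'.le, min_eq_left (by linarith), min_eq_left (by linarith)]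
      ring
  filter_upwards [eventually_all.2 hev] with z' hz'
  exact M.flatten_eq_of_terms n ⟨M.neg_H_le_z k, M.z_nonpos k⟩ hz'

theorem interface_order (k : Fin (l + 1)) (j : Fin l) :
    M.z k ≤ M.z j.succ ∨ M.z j.castSucc ≤ M.z k := by
  rcases le_or_gt j.succ k with h | h
  · exact Or.inl (M.z_anti.antitone h)
  · exact Or.inr (M.z_anti.antitone (Fin.le_castSucc_iff.2 h))

theorem flatten_near_interface (n : ℕ) (k : Fin (l + 1)) :
    ∀ᶠ z in 𝓝 (M.z k), M.flatten n z = M.z k :=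
  M.flatten_eventually_const n k fun j => by
    rcases M.interface_order k j with h | h
    · exact Or.inl ⟨h, h⟩
    · exact Or.inr ⟨h, h⟩

theorem flatten_of_nonneg (n : ℕ) {z : ℝ} (hz : 0 ≤ z) : ∀ᶠ z' in 𝓝 z, M.flatten n z' = 0 := by
  have := M.flatten_eventually_const n 0 (z := z) fun j =>
    Or.inr ⟨(M.z_nonpos _).trans hz, by rw [M.z_zero]; exact M.z_nonpos _⟩
  rwa [M.z_zero] at this

theorem flatten_of_le (n : ℕ) {z : ℝ} (hz : z ≤ -M.H) : ∀ᶠ z' in 𝓝 z, M.flatten n z' = -M.H := by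
  have := M.flatten_eventually_const n (Fin.last l) (z := z) fun j =>
    Or.inl ⟨hz.trans (M.neg_H_le_z _), by rw [M.z_last]; exact M.neg_H_le_z _⟩
  rwa [M.z_last] at this

theorem exists_layer_of_interface (k : Fin (l + 1)) :
    ∃ j : Fin l, M.z k ∈ Icc (M.z j.succ) (M.z j.castSucc) := by
  induction k using Fin.cases with
  | zero =>
    obtain ⟨j, hj⟩ := M.exists_layer (z := 0) (by linarith [M.H_pos]) le_rfl
    rw [M.z_zero]
    exact ⟨j, hj.1.le, hj.2⟩
  | succ j => exact ⟨j, le_rfl, (M.z_succ_lt j).le⟩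

/-- Composition with `flatten` locally sees a single closed layer, on which a piecewise smooth
function coincides with a smooth one. This is the source of smoothness across the interfaces. -/
theorem flatten_locally_in_layer (n : ℕ) (z : ℝ) :
    ∃ j : Fin l, ∀ᶠ z' in 𝓝 z, M.flatten n z' ∈ Icc (M.z j.succ) (M.z j.castSucc) := by
  have hk : ∀ k : Fin (l + 1), (∀ᶠ z' in 𝓝 z, M.flatten n z' = M.z k) →
      ∃ j : Fin l, ∀ᶠ z' in 𝓝 z, M.flatten n z' ∈ Icc (M.z j.succ) (M.z j.castSucc) := by
    intro k h
    obtain ⟨j, hj⟩ := M.exists_layer_of_interface k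
    exact ⟨j, by filter_upwards [h] with z' hz'; rwa [hz']⟩
  rcases le_or_gt 0 z with h0 | h0
  · exact hk 0 (by rw [M.z_zero]; exact M.flatten_of_nonneg n h0)
  rcases le_or_gt z (-M.H) with h1 | h1
  · exact hk (Fin.last l) (by rw [M.z_last]; exact M.flatten_of_le n h1)
  obtain ⟨j, hj⟩ := M.exists_layer h1 h0.le
  rcases hj.2.eq_or_lt with h2 | h2
  · exact hk j.castSucc (by rw [h2]; exact M.flatten_near_interface n _)
  · refine ⟨j, ?_⟩
    filter_upwards [isOpen_Ioo.mem_nhds ⟨hj.1, h2⟩] with z' hz'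
    exact M.flatten_mem_layer n j ⟨hz'.1.le, hz'.2.le⟩

end Medium

end Layered

end

/-! ### The form domain as a closure of test functions -/

noncomputable section

namespace Layered

/-- Bounded pointwise convergence implies convergence in `L²` of a box. -/
theorem tendsto_toLp_of_bounded {L a b : ℝ} {f : ℕ → Space → ℝ} {g : Space → ℝ} {C : ℝ}
    (hf : ∀ n, MemLp (f n) 2 (boxMeasure L a b)) (hg : MemLp g 2 (boxMeasure L a b))
    (hb : ∀ n, ∀ᵐ p ∂boxMeasure L a b, ‖f n p‖ ≤ C)
    (hlim : ∀ᵐ p ∂boxMeasure L a b, Tendsto (fun n => f n p) atTop (𝓝 (g p))) :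
    Tendsto (fun n => (hf n).toLp (f n)) atTop (𝓝 (hg.toLp g)) := by
  rw [tendsto_iff_norm_sub_tendsto_zero]
  have hsq : ∀ n, ‖(hf n).toLp (f n) - hg.toLp g‖ ^ 2 = ∫ p in box L a b, (f n p - g p) ^ 2 := by
    intro n
    rw [← MemLp.toLp_sub, ← real_inner_self_eq_norm_sq,
      inner_eq_integral (MemLp.coeFn_toLp _) (MemLp.coeFn_toLp _)]
    simp [sq]
  have hgb : ∀ᵐ p ∂boxMeasure L a b, ‖g p‖ ≤ C := by
    filter_upwards [ae_all_iff.2 hb, hlim] with p h1 h2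
    exact le_of_tendsto h2.norm (Eventually.of_forall h1)
  have h0 : Tendsto (fun n => ∫ p in box L a b, (f n p - g p) ^ 2) atTop
      (𝓝 (∫ p in box L a b, (0 : ℝ))) := by
    refine tendsto_integral_of_dominated_convergence (fun _ => (C + C) ^ 2) ?_
      (integrable_const _) ?_ ?_
    · exact fun n => ((hf n).1.sub hg.1).pow 2
    · intro n
      filter_upwards [hb n, hgb] with p h1 h2
      rw [norm_pow]
      exact pow_le_pow_left₀ (norm_nonneg _) ((norm_sub_le _ _).trans (add_le_add h1 h2)) 2
    · filter_upwards [hlim] with p hp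
      have := (hp.sub_const (g p)).pow 2
      simpa using this
  simp only [integral_zero, ← hsq] at h0
  have := (Real.continuous_sqrt.tendsto 0).comp h0
  simpa [Function.comp_def, Real.sqrt_sq] using this

/-- `u` is the limit in `H¹` of test functions, and `g` is its gradient. -/
def InH10 {L a b : ℝ} (u : BoxL2 L a b) (g : Fin 3 → BoxL2 L a b) : Prop :=
  ∃ φ : ℕ → Test L a b, Tendsto (fun n => testL2 (φ n)) atTop (𝓝 u) ∧
    ∀ i, Tendsto (fun n => testDeriv i (φ n)) atTop (𝓝 (g i))

theorem InH10.hasWD {L a b : ℝ} (hL : 0 < L) {u : BoxL2 L a b} {g : Fin 3 → BoxL2 L a b}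
    (h : InH10 u g) (i : Fin 3) : HasWD i u (g i) := by
  obtain ⟨φ, h1, h2⟩ := h
  exact HasWD.of_tendsto (fun n => hasWD_test hL i (φ n)) h1 (h2 i)

namespace Medium

variable {l : ℕ} {M : Medium l}

/-- The point with its height moved by `flatten`. -/
def flattenPt (M : Medium l) (n : ℕ) (p : Space) : Space :=
  p + (M.flatten n (p 2) - p 2) • unitVec 2

theorem flattenPt_two (n : ℕ) (p : Space) : M.flattenPt n p 2 = M.flatten n (p 2) := by
  simp [flattenPt, unitVec_apply]

theorem contDiff_flattenPt (n : ℕ) : ContDiff ℝ ∞ (M.flattenPt n) := by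
  have h2 : ContDiff ℝ ∞ fun p : Space => p 2 := by fun_prop
  exact contDiff_id.add ((((M.contDiff_flatten n).comp h2).sub h2).smul contDiff_const)

theorem flatten_mem_slab (n : ℕ) (z : ℝ) : M.flatten n z ∈ Icc (-M.H) 0 := by
  obtain ⟨j, hj⟩ := M.flatten_locally_in_layer n z
  have := hj.self_of_nhds
  exact ⟨(M.neg_H_le_z _).trans this.1, this.2.trans (M.z_nonpos _)⟩

/-- Near and beyond the top and bottom of the slab `flatten` takes the boundary heights, where `f`
vanishes. This gives the vertical support and makes the behaviour of `f` outside the slab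
irrelevant. -/
theorem IsPiecewiseSmooth.flatten_isTest {f : Space → ℝ} (hf : M.IsPiecewiseSmooth f) (n : ℕ) :
    IsTest M.L (-M.H) 0 (fun p => f (M.flattenPt n p)) := by
  have c2 : Continuous fun p : Space => p 2 := by fun_prop
  refine IsTest.of_hperiodic ?_ ?_ ?_
  · rw [contDiff_iff_contDiffAt]
    intro p
    obtain ⟨j, hj⟩ := M.flatten_locally_in_layer n (p 2)
    obtain ⟨g, hg, hfg⟩ := hf.smooth j
    refine ((hg.comp (M.contDiff_flattenPt n)).contDiffAt (x := p)).congr_of_eventuallyEq ?_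
    filter_upwards [c2.continuousAt.eventually hj] with q hq
    refine hfg ?_
    change M.flattenPt n q 2 ∈ Icc (M.z j.succ) (M.z j.castSucc)
    rwa [flattenPt_two]
  · intro i hi p
    have hmem : M.flattenPt n p 2 ∈ Icc (-M.H) 0 := by
      rw [flattenPt_two]; exact flatten_mem_slab n _
    have : M.flattenPt n (p + M.L • unitVec i) = M.flattenPt n p + M.L • unitVec i := by
      simp only [flattenPt, PiLp.add_apply, PiLp.smul_apply, unitVec_apply, hi.symm, if_false,
        smul_zero, add_zero]
      abel
    simp only [this]
    fin_cases i
    · exact hf.periodic_x _ hmem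
    · exact hf.periodic_y _ hmem
    · exact absurd rfl hi
  · obtain ⟨δ, hδ, h0⟩ := Metric.eventually_nhds_iff.1 (M.flatten_of_nonneg n le_rfl)
    obtain ⟨δ', hδ', h1⟩ := Metric.eventually_nhds_iff.1 (M.flatten_of_le n le_rfl)
    refine ⟨-M.H + δ', -δ, by linarith, by linarith, fun p hp => ?_⟩
    constructor
    · by_contra hcon
      apply hp
      refine hf.zero_bottom _ ?_
      rw [flattenPt_two]
      rcases le_or_gt (p 2) (-M.H) with h | h
      · exact (M.flatten_of_le n h).self_of_nhds
      · refine h1 ?_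
        rw [Real.dist_eq, abs_lt]
        constructor <;> linarith
    · by_contra hcon
      apply hp
      refine hf.zero_top _ ?_
      rw [flattenPt_two]
      rcases le_or_gt 0 (p 2) with h | h
      · exact (M.flatten_of_nonneg n h).self_of_nhds
      · refine h0 ?_
        rw [Real.dist_eq, abs_lt]
        constructor <;> linarith

theorem ae_mem_open_layer (M : Medium l) : ∀ᵐ p ∂boxMeasure M.L (-M.H) 0, p ∈ box M.L (-M.H) 0 ∧
    ∃ j : Fin l, p 2 ∈ Ioo (M.z j.succ) (M.z j.castSucc) := by
  have h0 : ∀ᵐ p : Space, ∀ k : Fin (l + 1), p 2 ≠ M.z k := by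
    rw [ae_all_iff]
    intro k
    rw [ae_iff]
    simpa using volume_hyperplane 2 (M.z k)
  filter_upwards [ae_restrict_of_ae h0, ae_boxMeasure_mem M.L (-M.H) 0] with p hp hb
  obtain ⟨j, hj⟩ := M.exists_layer hb.2.2.1 hb.2.2.2.le
  exact ⟨hb, j, hj.1, lt_of_le_of_ne hj.2 (hp _)⟩

/-- Within a layer `flatten` is `flatStep` conjugated by an affine map, which leaves the slope
unchanged. The bound is therefore independent of `n` and of the thickness of the layer. -/
theorem flatten_deriv_bound (M : Medium l) : ∃ C, ∀ n, ∀ j : Fin l,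
    ∀ z ∈ Ioo (M.z j.succ) (M.z j.castSucc), |deriv (M.flatten n) z| ≤ C := by
  obtain ⟨C, hC⟩ := exists_bound_deriv_flatStep
  refine ⟨C, fun n j z hz => ?_⟩
  have hd : 0 < M.z j.castSucc - M.z j.succ := sub_pos.2 (M.z_succ_lt j)
  have hev : M.flatten n =ᶠ[𝓝 z] fun z => M.z j.succ + (M.z j.castSucc - M.z j.succ) *
      flatStep n ((z - M.z j.succ) / (M.z j.castSucc - M.z j.succ)) := by
    filter_upwards [isOpen_Ioo.mem_nhds hz] with z' hz'
    exact M.flatten_of_mem_layer n j ⟨hz'.1.le, hz'.2.le⟩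
  have h1 : HasDerivAt (fun z => (z - M.z j.succ) / (M.z j.castSucc - M.z j.succ))
      (1 / (M.z j.castSucc - M.z j.succ)) z := ((hasDerivAt_id z).sub_const _).div_const _
  have h2 := (((contDiff_flatStep n).differentiable (by simp) _).hasDerivAt.comp z h1)
  have h3 := (h2.const_mul (M.z j.castSucc - M.z j.succ)).const_add (M.z j.succ)
  rw [hev.deriv_eq, show deriv (fun z => M.z j.succ + (M.z j.castSucc - M.z j.succ) *
      flatStep n ((z - M.z j.succ) / (M.z j.castSucc - M.z j.succ))) z = _ from h3.deriv]
  have : (M.z j.castSucc - M.z j.succ) * (deriv (flatStep n)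
      ((z - M.z j.succ) / (M.z j.castSucc - M.z j.succ)) * (1 / (M.z j.castSucc - M.z j.succ)))
      = deriv (flatStep n) ((z - M.z j.succ) / (M.z j.castSucc - M.z j.succ)) := by
    field_simp
  rw [this]
  exact hC _ _

theorem flatten_eventually_eq (M : Medium l) (j : Fin l) {z : ℝ}
    (hz : z ∈ Ioo (M.z j.succ) (M.z j.castSucc)) :
    ∀ᶠ n in atTop, M.flatten n =ᶠ[𝓝 z] id := by
  have hd : 0 < M.z j.castSucc - M.z j.succ := sub_pos.2 (M.z_succ_lt j)
  have hmem : (z - M.z j.succ) / (M.z j.castSucc - M.z j.succ) ∈ Ioo (0 : ℝ) 1 :=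
    ⟨div_pos (by linarith [hz.1]) hd, (div_lt_one hd).2 (by linarith [hz.2])⟩
  have hc : ContinuousAt (fun z => (z - M.z j.succ) / (M.z j.castSucc - M.z j.succ)) z := by
    fun_prop
  filter_upwards [flatStep_eventually_eq hmem] with n hn
  filter_upwards [isOpen_Ioo.mem_nhds hz, hc.eventually hn] with z' hz' h
  rw [M.flatten_of_mem_layer n j ⟨hz'.1.le, hz'.2.le⟩, h]
  simp only [id]
  field_simp
  ring

theorem partialDeriv_comp_flattenPt {g : Space → ℝ} (hg : ContDiff ℝ ∞ g) (n : ℕ) (i : Fin 3)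
    (p : Space) : partialDeriv i (fun q => g (M.flattenPt n q)) p
      = (if i = 2 then deriv (M.flatten n) (p 2) else 1) * partialDeriv i g (M.flattenPt n p) := by
  have h1 : HasFDerivAt (fun q : Space => q 2) (EuclideanSpace.proj (𝕜 := ℝ) (2 : Fin 3)) p :=
    (EuclideanSpace.proj (𝕜 := ℝ) (2 : Fin 3) : Space →L[ℝ] ℝ).hasFDerivAt
  have h2 := (((M.contDiff_flatten n).differentiable (by simp) (p 2)).hasDerivAt).comp_hasFDerivAt p h1
  have h3 := (hasFDerivAt_id p).add ((h2.sub h1).smul_const (unitVec 2))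
  have h4 : HasFDerivAt (M.flattenPt n) _ p := h3
  have h5 := ((hg.differentiable (by simp)) (M.flattenPt n p)).hasFDerivAt.comp p h4
  have h6 : fderiv ℝ (fun q => g (M.flattenPt n q)) p = _ := h5.fderiv
  simp only [partialDeriv, h6]
  by_cases hi : i = 2
  · subst hi
    simp [unitVec_apply]
    ring
  · simp [unitVec_apply, Ne.symm hi, hi]

/-- At every point off the interfaces, the flattened functions and their gradients are eventually
equal to those of `f`. With the uniform slope bound, dominated convergence gives convergence in
`H¹`. -/
theorem IsPiecewiseSmooth.exists_inH10 {f : Space → ℝ} (hf : M.IsPiecewiseSmooth f) :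
    ∃ (u : M.L2) (g : Fin 3 → M.L2), u =ᵐ[boxMeasure M.L (-M.H) 0] f ∧ InH10 u g := by
  choose G hG hfG using hf.smooth
  obtain ⟨C₀, hC₀⟩ := M.flatten_deriv_bound
  set R := 2 * |M.L| + |-M.H| + |(0 : ℝ)| with hR
  have hball : ∀ n, ∀ p ∈ box M.L (-M.H) 0, M.flattenPt n p ∈ Metric.closedBall (0 : Space) (R + M.H) := by
    intro n p hp
    rw [mem_closedBall_zero_iff]
    have h1 := mem_closedBall_zero_iff.1 (box_subset_closedBall M.L (-M.H) 0 hp)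
    have h2 := flatten_mem_slab (M := M) n (p 2)
    have h3 : ‖unitVec 2‖ = 1 := by simp [unitVec]
    refine (norm_add_le _ _).trans (add_le_add h1 ?_)
    rw [norm_smul, h3, mul_one, Real.norm_eq_abs, abs_le]
    have hp2 := hp.2.2
    simp only [mem_Ioo, mem_Icc] at hp2 h2
    constructor <;> linarith
  have hbd : ∀ ψ : Fin l → Space → ℝ, (∀ j, Continuous (ψ j)) →
      ∃ C, ∀ j, ∀ p ∈ Metric.closedBall (0 : Space) (R + M.H), ‖ψ j p‖ ≤ C := by
    intro ψ hψ
    choose c hc using fun j => (isCompact_closedBall (0 : Space) (R + M.H)).exists_bound_of_continuousOn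
      (hψ j).continuousOn
    refine ⟨∑ j, |c j|, fun j p hp => (hc j p hp).trans ((le_abs_self _).trans ?_)⟩
    exact Finset.single_le_sum (f := fun j => |c j|) (fun _ _ => abs_nonneg _) (Finset.mem_univ j)
  have hflat : ∀ j : Fin l, ∀ p : Space, p 2 ∈ Ioo (M.z j.succ) (M.z j.castSucc) →
      ∀ᶠ n in atTop, M.flattenPt n p = p := by
    intro j p hp
    filter_upwards [M.flatten_eventually_eq j hp] with n hn
    simp [flattenPt, hn.self_of_nhds]
  have hopen : ∀ j : Fin l, IsOpen {q : Space | q 2 ∈ Ioo (M.z j.succ) (M.z j.castSucc)} :=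
    fun j => isOpen_Ioo.preimage (by fun_prop : Continuous fun p : Space => p 2)
  have hval : ∀ (n : ℕ) (j : Fin l) (p : Space), p 2 ∈ Ioo (M.z j.succ) (M.z j.castSucc) →
      (fun q => f (M.flattenPt n q)) =ᶠ[𝓝 p] fun q => G j (M.flattenPt n q) := by
    intro n j p hp
    filter_upwards [(hopen j).mem_nhds hp] with q hq
    refine hfG j ?_
    change M.flattenPt n q 2 ∈ Icc (M.z j.succ) (M.z j.castSucc)
    rw [flattenPt_two]
    exact M.flatten_mem_layer n j ⟨hq.1.le, hq.2.le⟩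
  have hpd : ∀ (n : ℕ) (j : Fin l) (p : Space), p 2 ∈ Ioo (M.z j.succ) (M.z j.castSucc) → ∀ i,
      partialDeriv i (fun q => f (M.flattenPt n q)) p
        = (if i = 2 then deriv (M.flatten n) (p 2) else 1) * partialDeriv i (G j) (M.flattenPt n p) := by
    intro n j p hp i
    rw [← partialDeriv_comp_flattenPt (hG j)]
    simp only [partialDeriv]
    rw [(hval n j p hp).fderiv_eq]
  let φ : ℕ → Test M.L (-M.H) 0 := fun n => ⟨fun p => f (M.flattenPt n p), hf.flatten_isTest n⟩
  -- the function itself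
  obtain ⟨C₁, hC₁⟩ := hbd G fun j => (hG j).continuous
  have hb₁ : ∀ n, ∀ᵐ p ∂boxMeasure M.L (-M.H) 0, ‖(φ n : Space → ℝ) p‖ ≤ C₁ := by
    intro n
    filter_upwards [M.ae_mem_open_layer] with p ⟨hp, j, hj⟩
    change ‖f (M.flattenPt n p)‖ ≤ C₁
    rw [show f (M.flattenPt n p) = G j (M.flattenPt n p) from (hval n j p hj).self_of_nhds]
    exact hC₁ j _ (hball n p hp)
  have hl₁ : ∀ᵐ p ∂boxMeasure M.L (-M.H) 0,
      Tendsto (fun n => (φ n : Space → ℝ) p) atTop (𝓝 (f p)) := by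
    filter_upwards [M.ae_mem_open_layer] with p ⟨hp, j, hj⟩
    refine tendsto_const_nhds.congr' ?_
    filter_upwards [hflat j p hj] with n hn
    change f p = f (M.flattenPt n p)
    rw [hn]
  have hm₁ : MemLp f 2 (boxMeasure M.L (-M.H) 0) := by
    refine MemLp.of_bound (aestronglyMeasurable_of_tendsto_ae atTop
      (fun n => (φ n).2.continuous.aestronglyMeasurable) hl₁) C₁ ?_
    filter_upwards [ae_all_iff.2 hb₁, hl₁] with p h1 h2
    exact le_of_tendsto h2.norm (Eventually.of_forall h1)
  -- its derivatives
  have hder : ∀ i, ∃ g : M.L2, Tendsto (fun n => testDeriv i (φ n)) atTop (𝓝 g) := by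
    intro i
    obtain ⟨C₂, hC₂⟩ := hbd (fun j => partialDeriv i (G j)) fun j =>
      (contDiff_partialDeriv (hG j) i).continuous
    -- The limit is the layerwise classical derivative; its value on the interfaces is irrelevant,
    -- as they are null sets.
    let k : Space → ℝ := fun p => ∑ j : Fin l,
      {q : Space | q 2 ∈ Ioo (M.z j.succ) (M.z j.castSucc)}.indicator (partialDeriv i (G j)) p
    have hk : ∀ (j : Fin l) (p : Space), p 2 ∈ Ioo (M.z j.succ) (M.z j.castSucc) →
        k p = partialDeriv i (G j) p := by
      intro j p hp
      have := Finset.sum_eq_single (s := Finset.univ) (f := fun j : Fin l =>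
        {q : Space | q 2 ∈ Ioo (M.z j.succ) (M.z j.castSucc)}.indicator (partialDeriv i (G j)) p) j
        (fun j' _ hj' => ?_) (by simp)
      · simp only [k]
        rw [this]
        exact indicator_of_mem (s := {q : Space | q 2 ∈ Ioo (M.z j.succ) (M.z j.castSucc)}) hp _
      · refine indicator_of_notMem (fun h => ?_) _
        have h' : p 2 ∈ Ioo (M.z j'.succ) (M.z j'.castSucc) := h
        rcases M.layer_order j j' hj' with h1 | h1
        · linarith [h'.1, hp.2]
        · linarith [h'.2, hp.1]
    have hb₂ : ∀ n, ∀ᵐ p ∂boxMeasure M.L (-M.H) 0, ‖partialDeriv i (φ n) p‖ ≤ (|C₀| + 1) * |C₂| := by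
      intro n
      filter_upwards [M.ae_mem_open_layer] with p ⟨hp, j, hj⟩
      rw [hpd n j p hj i, norm_mul]
      refine mul_le_mul ?_ ((hC₂ j _ (hball n p hp)).trans (le_abs_self _)) (norm_nonneg _)
        (by positivity)
      split_ifs
      · rw [Real.norm_eq_abs]
        linarith [hC₀ n j _ hj, le_abs_self C₀]
      · simp
    have hl₂ : ∀ᵐ p ∂boxMeasure M.L (-M.H) 0,
        Tendsto (fun n => partialDeriv i (φ n) p) atTop (𝓝 (k p)) := by
      filter_upwards [M.ae_mem_open_layer] with p ⟨hp, j, hj⟩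
      refine tendsto_const_nhds.congr' ?_
      filter_upwards [hflat j p hj, M.flatten_eventually_eq j hj] with n hn hn'
      rw [hpd n j p hj i, hn, hk j p hj, hn'.deriv_eq]
      simp
    have hm₂ : MemLp k 2 (boxMeasure M.L (-M.H) 0) := by
      refine MemLp.of_bound (aestronglyMeasurable_of_tendsto_ae atTop
        (fun n => ((φ n).2.partialDeriv i).continuous.aestronglyMeasurable) hl₂)
        ((|C₀| + 1) * |C₂|) ?_
      filter_upwards [ae_all_iff.2 hb₂, hl₂] with p h1 h2
      exact le_of_tendsto h2.norm (Eventually.of_forall h1)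
    exact ⟨hm₂.toLp k, tendsto_toLp_of_bounded (fun n => memLp_partialDeriv_test i (φ n)) hm₂ hb₂ hl₂⟩
  choose g hg using hder
  exact ⟨hm₁.toLp f, g, hm₁.coeFn_toLp, φ,
    tendsto_toLp_of_bounded (fun n => memLp_test (φ n)) hm₁ hb₁ hl₁, hg⟩

theorem test_isPiecewiseSmooth (φ : Test M.L (-M.H) 0) : M.IsPiecewiseSmooth φ := by
  refine ⟨φ.2.continuous.continuousOn, fun j => ⟨φ, φ.2.smooth, fun _ _ => rfl⟩,
    fun p _ => φ.2.periodic_x p, fun p _ => φ.2.periodic_y p, fun p hp => ?_, fun p hp => ?_⟩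
  · by_contra h
    have := φ.2.mem_Ioo h
    simp [hp] at this
  · by_contra h
    have := φ.2.mem_Ioo h
    simp [hp] at this

/-- The space `𝓥` is the closure of the test functions. -/
theorem mem_V_iff {u : M.L2} : u ∈ M.V ↔ ∃ g, InH10 u g := by
  have hL := M.L_pos
  constructor
  · rintro ⟨h1, h2⟩
    obtain ⟨g, hg⟩ := (memH1_iff (ae_eq_refl _)).1 h1
    -- Two approximations are combined: `u` by a piecewise smooth function, and that function by
    -- test functions, each within `ε / 2`.
    have key : ∀ ε : ℝ, 0 < ε → ∃ φ : Test M.L (-M.H) 0, ‖testL2 φ - u‖ < ε ∧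
        ∀ i, ‖testDeriv i φ - g i‖ < ε := by
      intro ε hε
      obtain ⟨f, hf, hlt⟩ := h2 (ENNReal.ofReal ((ε / 2) ^ 2)) (by simpa using by positivity)
      obtain ⟨v, k, hv, φ, hφ, hφ'⟩ := hf.exists_inH10
      have hk : ∀ i, HasWD i v (k i) := InH10.hasWD hL ⟨φ, hφ, hφ'⟩
      have hae : (u - v : M.L2) =ᵐ[boxMeasure M.L (-M.H) 0] fun p => u p - f p := by
        filter_upwards [Lp.coeFn_sub u v, hv] with p h1 h2
        rw [h1, Pi.sub_apply, h2]
      rw [h1Sq_eq hL hae fun i => (hg i).sub (hk i),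
        ENNReal.ofReal_lt_ofReal_iff (by positivity)] at hlt
      have hsum : 0 ≤ ∑ i, ‖g i - k i‖ ^ 2 := by positivity
      have e0 : ‖u - v‖ < ε / 2 := lt_of_pow_lt_pow_left₀ 2 (by positivity) (by linarith)
      have e1 : ∀ i, ‖g i - k i‖ < ε / 2 := fun i => by
        refine lt_of_pow_lt_pow_left₀ 2 (by positivity) ?_
        have := Finset.single_le_sum (f := fun i => ‖g i - k i‖ ^ 2) (fun _ _ => by positivity)
          (Finset.mem_univ i)
        have hn : 0 ≤ ‖u - v‖ ^ 2 := by positivity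
        linarith
      have hε2 : 0 < ε / 2 := by positivity
      have f0 := (Metric.tendsto_nhds.1 hφ) (ε / 2) hε2
      have f1 := eventually_all.2 fun i => (Metric.tendsto_nhds.1 (hφ' i)) (ε / 2) hε2
      obtain ⟨n, hn0, hn1⟩ := (f0.and f1).exists
      refine ⟨φ n, ?_, fun i => ?_⟩
      · rw [dist_eq_norm] at hn0
        have := norm_sub_le_norm_sub_add_norm_sub (testL2 (φ n)) v u
        rw [norm_sub_rev v u] at this
        linarith
      · have h3 := hn1 i
        rw [dist_eq_norm] at h3
        have := norm_sub_le_norm_sub_add_norm_sub (testDeriv i (φ n)) (k i) (g i)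
        rw [norm_sub_rev (k i)] at this
        linarith [e1 i]
    choose φ hφ hφ' using fun n : ℕ => key (1 / (n + 1)) Nat.one_div_pos_of_nat
    refine ⟨g, φ, ?_, fun i => ?_⟩
    · rw [tendsto_iff_norm_sub_tendsto_zero]
      exact squeeze_zero (fun _ => norm_nonneg _) (fun n => (hφ n).le)
        tendsto_one_div_add_atTop_nhds_zero_nat
    · rw [tendsto_iff_norm_sub_tendsto_zero]
      exact squeeze_zero (fun _ => norm_nonneg _) (fun n => (hφ' n i).le)
        tendsto_one_div_add_atTop_nhds_zero_nat
  · rintro ⟨g, hug⟩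
    have hg := hug.hasWD hL
    refine ⟨(memH1_iff (ae_eq_refl _)).2 ⟨g, hg⟩, fun ε hε => ?_⟩
    obtain ⟨φ, hφ, hφ'⟩ := hug
    have hlim : Tendsto (fun n => ENNReal.ofReal (‖u - testL2 (φ n)‖ ^ 2 +
        ∑ i, ‖g i - testDeriv i (φ n)‖ ^ 2)) atTop (𝓝 0) := by
      have h0 : Tendsto (fun n => ‖u - testL2 (φ n)‖ ^ 2 + ∑ i, ‖g i - testDeriv i (φ n)‖ ^ 2)
          atTop (𝓝 (‖u - u‖ ^ 2 + ∑ i, ‖g i - g i‖ ^ 2)) :=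
        ((hφ.const_sub u).norm.pow 2).add
          (tendsto_finsetSum _ fun i _ => ((hφ' i).const_sub (g i)).norm.pow 2)
      have := (ENNReal.continuous_ofReal.tendsto _).comp h0
      simpa [Function.comp_def] using this
    obtain ⟨n, hn⟩ := (hlim.eventually (gt_mem_nhds hε)).exists
    refine ⟨φ n, test_isPiecewiseSmooth _, ?_⟩
    have hae : (u - testL2 (φ n) : M.L2) =ᵐ[boxMeasure M.L (-M.H) 0]
        fun p => u p - (φ n : Space → ℝ) p := by
      filter_upwards [Lp.coeFn_sub u (testL2 (φ n)), coeFn_testL2 (φ n)] with p h1 h2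
      rw [h1, Pi.sub_apply, h2]
    rwa [h1Sq_eq hL hae fun i => (hg i).sub (hasWD_test hL i (φ n))]

end Medium

end Layered

end

noncomputable section

namespace Layered

/-! ### Translation estimates for functions with weak derivatives in `L²` -/

theorem box_mono {L a b a' b' : ℝ} (ha : a ≤ a') (hb : b' ≤ b) : box L a' b' ⊆ box L a b :=
  fun _ hp => ⟨hp.1, hp.2.1, ha.trans_lt hp.2.2.1, hp.2.2.2.trans_le hb⟩

theorem memLp_two_iff_l2Sq_lt_top {L a b : ℝ} {f : Space → ℝ}
    (hf : AEStronglyMeasurable f (boxMeasure L a b)) :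
    MemLp f 2 (boxMeasure L a b) ↔ l2Sq L a b f < ⊤ := by
  rw [MemLp, and_iff_right hf, eLpNorm_lt_top_iff_lintegral_rpow_enorm_lt_top (by norm_num)
    (by norm_num)]
  simp [l2Sq]

theorem l2Sq_le_of_support {L a b c d : ℝ} {f : Space → ℝ}
    (hs : ∀ p, f p ≠ 0 → p 2 ∈ Ioo a b) : l2Sq L c d f ≤ l2Sq L a b f := by
  rw [l2Sq, l2Sq, ← lintegral_indicator (measurableSet_box L c d),
    ← lintegral_indicator (measurableSet_box L a b)]
  refine lintegral_mono fun p => ?_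
  by_cases hp : f p = 0
  · simp [indicator, hp]
  · by_cases hc : p ∈ box L c d
    · rw [indicator_of_mem hc, indicator_of_mem (s := box L a b) ⟨hc.1, hc.2.1, hs p hp⟩]
    · simp [hc]

theorem l2Sq_translate {L : ℝ} (hL : 0 < L) (a b : ℝ) {f : Space → ℝ} (hf : HPeriodic L f)
    (h : Space) : l2Sq L a b (fun p => f (p + h)) = l2Sq L (a + h 2) (b + h 2) f :=
  setLIntegral_box_add hL a b (F := fun p => ‖f p‖ₑ ^ 2) (fun i hi p => by simp only [hf i hi p]) h

theorem integral_box_translate {L : ℝ} (hL : 0 < L) {a b : ℝ} {F : Space → ℝ} (hF : HPeriodic L F)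
    (h : Space) (hInt : Integrable F (boxMeasure L (a + h 2) (b + h 2)))
    (hInt' : Integrable (fun p => F (p + h)) (boxMeasure L a b)) :
    ∫ p in box L a b, F (p + h) = ∫ p in box L (a + h 2) (b + h 2), F p := by
  have key : ∀ G : Space → ℝ, HPeriodic L G →
      ∫⁻ p in box L a b, ENNReal.ofReal (G (p + h))
        = ∫⁻ p in box L (a + h 2) (b + h 2), ENNReal.ofReal (G p) := fun G hG =>
    setLIntegral_box_add hL a b (F := fun p => ENNReal.ofReal (G p))
      (fun i hi p => by simp only [hG i hi p]) h
  rw [integral_eq_lintegral_pos_part_sub_lintegral_neg_part hInt,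
    integral_eq_lintegral_pos_part_sub_lintegral_neg_part hInt', key F hF,
    key (fun p => -F p) (fun i hi p => by simp only [hF i hi p])]

/-- The square of the `L²` norm of the increment `g(· + h) - g` over the part of the box that
stays in the slab under the translation. -/
def shiftSq (L a b : ℝ) (g : Space → ℝ) (h : Space) : ℝ≥0∞ :=
  l2Sq L (max a (a - h 2)) (min b (b - h 2)) fun p => g (p + h) - g p

theorem norm_le_of_inner_test_le {L a b : ℝ} (hL : 0 < L) {u : BoxL2 L a b} {C : ℝ} (hC : 0 ≤ C)
    (h : ∀ φ : Test L a b, |inner ℝ u (testL2 φ)| ≤ C * ‖testL2 φ‖) : ‖u‖ ≤ C := by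
  obtain ⟨g, hg, hg'⟩ := exists_inner_eq_of_bound testL2 ((innerₛₗ ℝ u).comp testL2) C hC h
  rwa [eq_of_inner_test hL hg']

/-- By duality it suffices to pair the increment with a test function `ψ` on the overlap. The
translation is moved onto `ψ`, and `t ↦ ∫ g ψ(· - t h)` has derivative `⟨h·∇g, ψ(· - t h)⟩`, so the
mean value inequality concludes. All these translates of `ψ` stay in the slab, hence `g` needs no
boundary condition. -/
theorem shiftSq_le {L a b : ℝ} (hL : 0 < L) {g : Space → ℝ} (hg : Measurable g)
    (hp : HPeriodic L g) {u : BoxL2 L a b} (hu : u =ᵐ[boxMeasure L a b] g)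
    {k : Fin 3 → BoxL2 L a b} (hk : ∀ i, HasWD i u (k i)) (h : Space) :
    shiftSq L a b g h ≤ ENNReal.ofReal (‖∑ i, h i • k i‖ ^ 2) := by
  set a' := max a (a - h 2) with ha'
  set b' := min b (b - h 2) with hb'
  set K : BoxL2 L a b := ∑ i, h i • k i with hK
  have hgm : MemLp g 2 (boxMeasure L a b) := (memLp_congr_ae hu).1 (Lp.memLp u)
  -- The overlap stays inside the slab during the whole motion, not only at its two ends.
  have haa : ∀ t ∈ Icc (0 : ℝ) 1, a ≤ a' + t * h 2 := by
    intro t ht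
    have h1 := le_max_left a (a - h 2)
    have h2 := le_max_right a (a - h 2)
    rcases le_or_gt 0 (h 2) with h0 | h0
    · nlinarith [ht.1, mul_nonneg ht.1 h0]
    · nlinarith [ht.2]
  have hbb : ∀ t ∈ Icc (0 : ℝ) 1, b' + t * h 2 ≤ b := by
    intro t ht
    have h1 := min_le_left b (b - h 2)
    have h2 := min_le_right b (b - h 2)
    rcases le_or_gt 0 (h 2) with h0 | h0
    · nlinarith [ht.2]
    · nlinarith [ht.1, mul_nonneg ht.1 (neg_pos.2 h0).le]
  have ha0 : a ≤ a' := le_max_left _ _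
  have hb0 : b' ≤ b := min_le_left _ _
  have ha1 : a ≤ a' + h 2 := by simpa using haa 1 (by simp)
  have hb1 : b' + h 2 ≤ b := by simpa using hbb 1 (by simp)
  have hg1 : MemLp g 2 (boxMeasure L a' b') :=
    hgm.mono_measure (Measure.restrict_mono (box_mono ha0 hb0) le_rfl)
  have hg2' : MemLp g 2 (boxMeasure L (a' + h 2) (b' + h 2)) :=
    hgm.mono_measure (Measure.restrict_mono (box_mono ha1 hb1) le_rfl)
  have hgh : Measurable fun p => g (p + h) := hg.comp (measurable_id.add_const h)
  have hg2 : MemLp (fun p => g (p + h)) 2 (boxMeasure L a' b') := by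
    rw [memLp_two_iff_l2Sq_lt_top hgh.aestronglyMeasurable, l2Sq_translate hL _ _ hp]
    exact (memLp_two_iff_l2Sq_lt_top hg.aestronglyMeasurable).1 hg2'
  have hd : MemLp (fun p => g (p + h) - g p) 2 (boxMeasure L a' b') := hg2.sub hg1
  change l2Sq L a' b' (fun p => g (p + h) - g p) ≤ _
  rw [l2Sq_eq_of_ae_eq hd.coeFn_toLp]
  refine ENNReal.ofReal_le_ofReal (pow_le_pow_left₀ (norm_nonneg _) ?_ 2)
  refine norm_le_of_inner_test_le hL (norm_nonneg _) fun φ => ?_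
  have hφ := φ.2
  set ψ : Space → ℝ := φ.1 with hψ
  -- translated test functions
  have htr : ∀ t ∈ Icc (0 : ℝ) 1, IsTest L a b fun p => ψ (p + t • (-h)) := by
    intro t ht
    refine (hφ.translate (t • (-h))).mono ?_ ?_
    · have := haa t ht
      simp only [PiLp.smul_apply, PiLp.neg_apply, smul_eq_mul]; linarith
    · have := hbb t ht
      simp only [PiLp.smul_apply, PiLp.neg_apply, smul_eq_mul]; linarith
  have hnorm : ∀ t, ∀ ht : t ∈ Icc (0 : ℝ) 1,
      ‖testL2 (⟨_, htr t ht⟩ : Test L a b)‖ ≤ ‖testL2 φ‖ := by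
    intro t ht
    have h1 : l2Sq L a b (fun p => ψ (p + t • (-h))) ≤ l2Sq L a' b' ψ := by
      rw [l2Sq_translate hL _ _ hφ.hperiodic]
      exact l2Sq_le_of_support fun p hp => hφ.mem_Ioo hp
    rw [l2Sq_eq_of_ae_eq (coeFn_testL2 (⟨_, htr t ht⟩ : Test L a b)),
      l2Sq_eq_of_ae_eq (coeFn_testL2 φ), ENNReal.ofReal_le_ofReal_iff (by positivity)] at h1
    exact le_of_sq_le_sq h1 (norm_nonneg _)
  have hgi : Integrable g (boxMeasure L a b) := hgm.integrable (by norm_num)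
  set Ψ : ℝ → ℝ := fun t => ∫ p in box L a b, g p * ψ (p + t • (-h)) with hΨ
  have hder : ∀ t ∈ Icc (0 : ℝ) 1, HasDerivAt Ψ
      (∫ p in box L a b, g p * fderiv ℝ ψ (p + t • (-h)) (-h)) t := fun t _ =>
    hasDerivAt_integral_translate hgi hφ.smooth (-h) t
  have hval : ∀ t, ∀ ht : t ∈ Icc (0 : ℝ) 1,
      ∫ p in box L a b, g p * fderiv ℝ ψ (p + t • (-h)) (-h)
        = inner ℝ K (testL2 (⟨_, htr t ht⟩ : Test L a b)) := by
    intro t ht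
    rw [hK, sum_inner]
    have e : ∀ p, g p * fderiv ℝ ψ (p + t • (-h)) (-h)
        = ∑ i, -h i * (g p * partialDeriv i (fun q => ψ (q + t • (-h))) p) := by
      intro p
      rw [fderiv_apply_eq_sum, Finset.mul_sum]
      refine Finset.sum_congr rfl fun i _ => ?_
      rw [partialDeriv_add_right, PiLp.neg_apply]
      ring
    simp only [e]
    rw [integral_finsetSum]
    · refine Finset.sum_congr rfl fun i _ => ?_
      rw [integral_const_mul, inner_smul_left]
      have := hk i ⟨_, htr t ht⟩
      rw [inner_eq_integral hu (coeFn_testDeriv i _)] at this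
      rw [this]
      simp
    · intro i _
      exact (hgm.integrable_mul (memLp_of_continuous ((htr t ht).partialDeriv i).continuous
        L a b 2)).const_mul _
  have hbound : ‖Ψ 1 - Ψ 0‖ ≤ ‖K‖ * ‖testL2 φ‖ * ‖(1 : ℝ) - 0‖ := by
    refine (convex_Icc (0 : ℝ) 1).norm_image_sub_le_of_norm_hasDerivWithin_le
      (fun t ht => (hder t ht).hasDerivWithinAt) (fun t ht => ?_) (by simp) (by simp)
    rw [hval t ht]
    exact (norm_inner_le_norm _ _).trans
      (mul_le_mul_of_nonneg_left (hnorm t ht) (norm_nonneg _))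
  have hfin : inner ℝ (hd.toLp _) (testL2 φ) = Ψ 1 - Ψ 0 := by
    rw [inner_eq_integral hd.coeFn_toLp (coeFn_testL2 φ)]
    have hm := memLp_test φ
    have hi1 : Integrable (fun p => g (p + h) * ψ p) (boxMeasure L a' b') := hg2.integrable_mul hm
    have hi2 : Integrable (fun p => g p * ψ p) (boxMeasure L a' b') := hg1.integrable_mul hm
    simp only [sub_mul]
    rw [integral_sub hi1 hi2]
    congr 1
    · have hs := integral_box_translate hL (a := a') (b := b') (F := fun p => g p * ψ (p - h))
        (fun i hi p => ?_) h ?_ ?_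
      · simp only [add_sub_cancel_right] at hs
        rw [hs, hΨ]
        simp only [one_smul, ← sub_eq_add_neg]
        symm
        refine setIntegral_eq_of_subset_of_forall_sdiff_eq_zero (measurableSet_box L a b)
          (box_mono ha1 hb1) fun p hp => ?_
        have : ψ (p - h) = 0 := by
          by_contra hne
          have h3 := hφ.mem_Ioo hne
          apply hp.2
          refine ⟨hp.1.1, hp.1.2.1, ?_⟩
          simp only [PiLp.sub_apply, mem_Ioo] at h3 ⊢
          constructor <;> linarith [h3.1, h3.2]
        rw [this, mul_zero]
      · simp only
        rw [hp i hi, add_sub_right_comm, hφ.hperiodic i hi]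
      · exact hg2'.integrable_mul (memLp_of_continuous (hφ.continuous.comp
          (continuous_id.sub continuous_const)) _ _ _ 2)
      · simpa using hi1
    · rw [hΨ]
      simp only [zero_smul, add_zero]
      symm
      refine setIntegral_eq_of_subset_of_forall_sdiff_eq_zero (measurableSet_box L a b)
        (box_mono ha0 hb0) fun p hp => ?_
      have : ψ p = 0 := by
        by_contra hne
        exact hp.2 ⟨hp.1.1, hp.1.2.1, hφ.mem_Ioo hne⟩
      rw [this, mul_zero]
  rw [hfin]
  simpa using hbound

end Layered

end

noncomputable section

namespace Layered

/-! ### Multiplication by bounded functions -/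

section mulL2

variable {L a b : ℝ} {m : Space → ℝ} {C : ℝ}

theorem memLp_bdd_mul (hm : Measurable m) (hC : ∀ p, ‖m p‖ ≤ C) (u : BoxL2 L a b) :
    MemLp (fun p => m p * u p) 2 (boxMeasure L a b) :=
  MemLp.of_le_mul (c := C) (Lp.memLp u) (hm.aestronglyMeasurable.mul (Lp.aestronglyMeasurable u))
    (Eventually.of_forall fun p => by
      rw [norm_mul]; exact mul_le_mul_of_nonneg_right (hC p) (norm_nonneg _))

/-- Multiplication by a bounded measurable function on `L²`. -/
def mulL2 (hm : Measurable m) (hC : ∀ p, ‖m p‖ ≤ C) : BoxL2 L a b →L[ℝ] BoxL2 L a b :=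
  LinearMap.mkContinuous
    { toFun := fun u => (memLp_bdd_mul hm hC u).toLp _
      map_add' := fun u v => by
        rw [← MemLp.toLp_add, MemLp.toLp_eq_toLp_iff]
        filter_upwards [Lp.coeFn_add u v] with p hp
        simp only [hp, Pi.add_apply]
        ring
      map_smul' := fun c u => by
        rw [RingHom.id_apply, ← MemLp.toLp_const_smul, MemLp.toLp_eq_toLp_iff]
        filter_upwards [Lp.coeFn_smul c u] with p hp
        simp only [hp, Pi.smul_apply, smul_eq_mul]
        ring } C fun u => by
    refine Lp.norm_le_mul_norm_of_ae_le_mul ?_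
    filter_upwards [(memLp_bdd_mul hm hC u).coeFn_toLp] with p hp
    simp only [LinearMap.coe_mk, AddHom.coe_mk]
    rw [hp, norm_mul]
    exact mul_le_mul_of_nonneg_right (hC p) (norm_nonneg _)

theorem coeFn_mulL2 (hm : Measurable m) (hC : ∀ p, ‖m p‖ ≤ C) (u : BoxL2 L a b) :
    mulL2 hm hC u =ᵐ[boxMeasure L a b] fun p => m p * u p :=
  (memLp_bdd_mul hm hC u).coeFn_toLp

theorem inner_mulL2 (hm : Measurable m) (hC : ∀ p, ‖m p‖ ≤ C) (u v : BoxL2 L a b) :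
    inner ℝ (mulL2 hm hC u) v = inner ℝ u (mulL2 hm hC v) := by
  rw [inner_eq_integral (coeFn_mulL2 hm hC u) (ae_eq_refl _),
    inner_eq_integral (ae_eq_refl _) (coeFn_mulL2 hm hC v)]
  congr 1
  ext p
  ring

end mulL2

namespace Medium

variable {l : ℕ} (M : Medium l)

/-! ### The diffusivity -/

/-- An upper bound of the diffusivity. -/
def dMax : ℝ := ∑ j, M.diff j

/-- A lower bound of the diffusivity. -/
def dMin : ℝ := (∑ j, (M.diff j)⁻¹ + 1)⁻¹

/-- The extra summand `1` in `dMin` keeps the inverted quantity positive without a case distinction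
on the number of layers. -/
theorem dMin_pos : 0 < M.dMin := by
  have : 0 ≤ ∑ j, (M.diff j)⁻¹ := Finset.sum_nonneg fun j _ => (inv_pos.2 (M.diff_pos j)).le
  exact inv_pos.2 (by linarith)

theorem dMin_le (j : Fin l) : M.dMin ≤ M.diff j := by
  have h1 : (M.diff j)⁻¹ ≤ ∑ j, (M.diff j)⁻¹ :=
    Finset.single_le_sum (f := fun j => (M.diff j)⁻¹)
      (fun j _ => (inv_pos.2 (M.diff_pos j)).le) (Finset.mem_univ j)
  rw [dMin, inv_le_comm₀ (by have := inv_pos.2 (M.diff_pos j); linarith) (M.diff_pos j)]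
  linarith

theorem D_eq {j : Fin l} {p : Space} (hp : p 2 ∈ Ioc (M.z j.succ) (M.z j.castSucc)) :
    M.D p = M.diff j := by
  rw [D, Finset.sum_eq_single j (fun j' _ hj' => ?_) (by simp), indicator_of_mem hp]
  refine indicator_of_notMem (fun h => ?_) _
  rcases M.layer_order j j' hj' with h1 | h1
  · linarith [h.1, hp.2]
  · linarith [h.2, hp.1]

theorem D_nonneg (p : Space) : 0 ≤ M.D p :=
  Finset.sum_nonneg fun j _ => indicator_nonneg (fun _ _ => (M.diff_pos j).le) _

theorem D_le (p : Space) : M.D p ≤ M.dMax :=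
  Finset.sum_le_sum fun j _ => indicator_le_self' (fun _ _ => (M.diff_pos j).le) _

theorem dMin_le_D {p : Space} (hp : p ∈ box M.L (-M.H) 0) : M.dMin ≤ M.D p := by
  obtain ⟨j, hj⟩ := M.exists_layer hp.2.2.1 hp.2.2.2.le
  rw [M.D_eq hj]
  exact M.dMin_le j

theorem measurable_D : Measurable M.D :=
  Finset.measurable_fun_sum _ fun _ _ =>
    (measurable_const.indicator measurableSet_Ioc).comp (measurable_coord 2)

theorem D_congr {p q : Space} (h : p 2 = q 2) : M.D p = M.D q := by
  simp only [D, h]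

theorem norm_D_le (p : Space) : ‖M.D p‖ ≤ M.dMax := by
  rw [Real.norm_eq_abs, abs_of_nonneg (M.D_nonneg p)]
  exact M.D_le p

theorem norm_sqrt_D_le (p : Space) : ‖Real.sqrt (M.D p)‖ ≤ Real.sqrt M.dMax := by
  rw [Real.norm_eq_abs, abs_of_nonneg (Real.sqrt_nonneg _)]
  exact Real.sqrt_le_sqrt (M.D_le p)

/-- Multiplication by `D`. -/
def mulD : M.L2 →L[ℝ] M.L2 := mulL2 M.measurable_D M.norm_D_le

/-- Multiplication by `√D`. -/
def mulSqrtD : M.L2 →L[ℝ] M.L2 := mulL2 M.measurable_D.sqrt M.norm_sqrt_D_le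

theorem coeFn_mulD (u : M.L2) :
    M.mulD u =ᵐ[boxMeasure M.L (-M.H) 0] fun p => M.D p * u p := coeFn_mulL2 _ _ u

theorem coeFn_mulSqrtD (u : M.L2) :
    M.mulSqrtD u =ᵐ[boxMeasure M.L (-M.H) 0] fun p => Real.sqrt (M.D p) * u p :=
  coeFn_mulL2 _ _ u

theorem inner_mulD (u v : M.L2) : inner ℝ (M.mulD u) v = inner ℝ u (M.mulD v) :=
  inner_mulL2 _ _ u v

theorem inner_mulSqrtD (u v : M.L2) :
    inner ℝ (M.mulSqrtD u) (M.mulSqrtD v) = inner ℝ (M.mulD u) v := by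
  rw [inner_eq_integral (M.coeFn_mulSqrtD u) (M.coeFn_mulSqrtD v),
    inner_eq_integral (M.coeFn_mulD u) (ae_eq_refl _)]
  congr 1
  ext p
  have := Real.mul_self_sqrt (M.D_nonneg p)
  linear_combination (u p * v p) * this

theorem norm_mulD_le (u : M.L2) : ‖M.mulD u‖ ≤ M.dMax * ‖u‖ := by
  refine Lp.norm_le_mul_norm_of_ae_le_mul ?_
  filter_upwards [M.coeFn_mulD u] with p hp
  rw [hp, norm_mul]
  exact mul_le_mul_of_nonneg_right (M.norm_D_le p) (norm_nonneg _)

theorem dMin_mul_norm_sq_le (u : M.L2) : M.dMin * ‖u‖ ^ 2 ≤ inner ℝ (M.mulD u) u := by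
  rw [← real_inner_self_eq_norm_sq, ← real_inner_smul_left, ← sub_nonneg, ← inner_sub_left]
  have h : (M.mulD u - M.dMin • u : M.L2) =ᵐ[boxMeasure M.L (-M.H) 0]
      fun p => (M.D p - M.dMin) * u p := by
    filter_upwards [Lp.coeFn_sub (M.mulD u) (M.dMin • u), M.coeFn_mulD u,
      Lp.coeFn_smul M.dMin u] with p h1 h2 h3
    rw [h1, Pi.sub_apply, h2, h3, Pi.smul_apply, smul_eq_mul]
    ring
  rw [inner_eq_integral h (ae_eq_refl _)]
  refine integral_nonneg_of_ae ?_
  filter_upwards [ae_boxMeasure_mem M.L (-M.H) 0] with p hp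
  have := M.dMin_le_D hp
  have h2 : 0 ≤ u p * u p := mul_self_nonneg _
  have h3 : 0 ≤ (M.D p - M.dMin) * (u p * u p) := mul_nonneg (by linarith) h2
  simpa [mul_assoc] using h3

/-! ### Poincaré inequality -/

/-- Writing `1 = ∂_z z` and integrating by parts gives `‖φ‖² = -2 ∫ z φ ∂_zφ`, and `|z| ≤ H` on the
slab. -/
theorem norm_testL2_le (φ : Test M.L (-M.H) 0) : ‖testL2 φ‖ ≤ 2 * M.H * ‖testDeriv 2 φ‖ := by
  have hχ : IsTest M.L (-M.H) 0 (fun p => id (p 2) * (φ : Space → ℝ) p) :=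
    φ.2.mul_coord contDiff_id
  set χ : Test M.L (-M.H) 0 := ⟨_, hχ⟩ with hχdef
  have h1 := hasWD_test M.L_pos 2 φ χ
  have h2 : testDeriv 2 χ =ᵐ[boxMeasure M.L (-M.H) 0]
      fun p => p 2 * partialDeriv 2 φ p + (φ : Space → ℝ) p := by
    filter_upwards [coeFn_testDeriv 2 χ] with p hp
    rw [hp]
    change partialDeriv 2 (fun p => id (p 2) * (φ : Space → ℝ) p) p = _
    rw [partialDeriv_mul (by fun_prop) φ.2.differentiable,
      partialDeriv_of_coord_two p (hasDerivAt_id (p 2))]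
    simp
  have h3 : testL2 χ =ᵐ[boxMeasure M.L (-M.H) 0] fun p => p 2 * (φ : Space → ℝ) p :=
    coeFn_testL2 χ
  have hc2 : Continuous fun p : Space => p 2 := by fun_prop
  have e1 : inner ℝ (testL2 φ) (testDeriv 2 χ)
      = inner ℝ (testL2 χ) (testDeriv 2 φ) + ‖testL2 φ‖ ^ 2 := by
    rw [← real_inner_self_eq_norm_sq, inner_eq_integral (coeFn_testL2 φ) h2,
      inner_eq_integral h3 (coeFn_testDeriv 2 φ), inner_eq_integral (coeFn_testL2 φ) (coeFn_testL2 φ),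
      ← integral_add]
    · congr 1
      ext p
      ring
    · exact integrable_of_continuous ((hc2.mul φ.2.continuous).mul
        (φ.2.partialDeriv 2).continuous) _ _ _
    · exact integrable_of_continuous (φ.2.continuous.mul φ.2.continuous) _ _ _
  have e2 : ‖testL2 φ‖ ^ 2 = - 2 * inner ℝ (testL2 χ) (testDeriv 2 φ) := by
    rw [real_inner_comm (testL2 χ)] at h1
    linarith
  have e3 : ‖testL2 χ‖ ≤ M.H * ‖testL2 φ‖ := by
    refine Lp.norm_le_mul_norm_of_ae_le_mul ?_
    filter_upwards [h3, coeFn_testL2 φ, ae_boxMeasure_mem M.L (-M.H) 0] with p hp hp' hb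
    rw [hp, hp', norm_mul]
    refine mul_le_mul_of_nonneg_right ?_ (norm_nonneg _)
    have := hb.2.2
    rw [Real.norm_eq_abs, abs_le]
    constructor <;> linarith [this.1, this.2, M.H_pos]
  have e4 : ‖testL2 φ‖ ^ 2 ≤ 2 * (M.H * ‖testL2 φ‖) * ‖testDeriv 2 φ‖ := by
    have h5 := abs_real_inner_le_norm (testL2 χ) (testDeriv 2 φ)
    have h6 := neg_abs_le (inner ℝ (testL2 χ) (testDeriv 2 φ) : ℝ)
    have h7 := mul_le_mul_of_nonneg_right e3 (norm_nonneg (testDeriv 2 φ))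
    nlinarith
  rcases (norm_nonneg (testL2 φ)).eq_or_lt with h0 | h0
  · rw [← h0]
    have := M.H_pos
    positivity
  · refine le_of_mul_le_mul_left ?_ h0
    nlinarith

variable {M}

theorem _root_.Layered.InH10.norm_le {u : M.L2} {g : Fin 3 → M.L2} (h : InH10 u g) :
    ‖u‖ ≤ 2 * M.H * ‖g 2‖ := by
  obtain ⟨φ, h1, h2⟩ := h
  exact le_of_tendsto_of_tendsto' h1.norm ((h2 2).norm.const_mul _) fun n => M.norm_testL2_le (φ n)

/-! ### Horizontal derivatives commute with multiplication by `D` -/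

/-- A smooth approximation of the diffusivity, as a function of the height. -/
def smoothD (M : Medium l) (n : ℕ) (z : ℝ) : ℝ :=
  ∑ j : Fin l, M.diff j * (Real.smoothTransition (n * (z - M.z j.succ)) -
    Real.smoothTransition (n * (z - M.z j.castSucc)))

theorem contDiff_smoothD (n : ℕ) : ContDiff ℝ ∞ (M.smoothD n) := by
  have h : ContDiff ℝ ∞ Real.smoothTransition := Real.smoothTransition.contDiff
  unfold smoothD
  fun_prop

theorem abs_smoothD_le (n : ℕ) (z : ℝ) : |M.smoothD n z| ≤ M.dMax := by
  refine (Finset.abs_sum_le_sum_abs _ _).trans (Finset.sum_le_sum fun j _ => ?_)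
  rw [abs_mul, abs_of_pos (M.diff_pos j)]
  refine mul_le_of_le_one_right (M.diff_pos j).le (abs_le.2 ⟨?_, ?_⟩)
  · linarith [Real.smoothTransition.nonneg (n * (z - M.z j.succ)),
      Real.smoothTransition.le_one (n * (z - M.z j.castSucc))]
  · linarith [Real.smoothTransition.nonneg (n * (z - M.z j.castSucc)),
      Real.smoothTransition.le_one (n * (z - M.z j.succ))]

/-- The limit vanishes at `0`, which matches the half-open layers in the definition of `D`; the
convergence to `D` is then everywhere and not just almost everywhere. -/
theorem tendsto_smoothTransition_nat (w : ℝ) :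
    Tendsto (fun n : ℕ => Real.smoothTransition (n * w)) atTop (𝓝 ((Ioi 0).indicator 1 w)) := by
  rcases le_or_gt w 0 with h | h
  · rw [indicator_of_notMem (by simpa using h)]
    refine tendsto_const_nhds.congr fun n => ?_
    exact (Real.smoothTransition.zero_of_nonpos
      (mul_nonpos_of_nonneg_of_nonpos (Nat.cast_nonneg n) h)).symm
  · rw [indicator_of_mem (by simpa using h)]
    refine tendsto_const_nhds.congr' ?_
    have := (tendsto_natCast_atTop_atTop (R := ℝ)).atTop_mul_const h
    filter_upwards [this.eventually_ge_atTop 1] with n hn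
    exact (Real.smoothTransition.one_of_one_le hn).symm

theorem tendsto_smoothD (p : Space) : Tendsto (fun n => M.smoothD n (p 2)) atTop (𝓝 (M.D p)) := by
  refine tendsto_finsetSum _ fun j _ => ?_
  have h := (tendsto_smoothTransition_nat (p 2 - M.z j.succ)).sub
    (tendsto_smoothTransition_nat (p 2 - M.z j.castSucc))
  have h' := h.const_mul (M.diff j)
  convert h' using 2
  have hlt := M.z_succ_lt j
  simp only [indicator, mem_Ioc, mem_Ioi, sub_pos, Pi.one_apply]
  by_cases h1 : M.z j.succ < p 2
  · by_cases h2 : M.z j.castSucc < p 2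
    · simp [h1, h2]
    · simp [h1, h2, not_lt.1 h2]
  · have h2 : ¬ M.z j.castSucc < p 2 := fun h => h1 (hlt.trans h)
    simp [h1, h2]

/-- The product of `D` and a test function is not a test function, but with the smoothed diffusivity
it is. A horizontal derivative does not act on that factor, and the products converge in `L²`. -/
theorem _root_.Layered.HasWD.mulD {i : Fin 3} (hi : i ≠ 2) {u g : M.L2} (h : HasWD i u g) :
    HasWD i (M.mulD u) (M.mulD g) := by
  intro φ
  have key : ∀ ψ : Test M.L (-M.H) 0, Tendsto (fun n => testL2
      (⟨_, ψ.2.mul_coord (contDiff_smoothD (M := M) n)⟩ : Test M.L (-M.H) 0)) atTop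
      (𝓝 (M.mulD (testL2 ψ))) := by
    intro ψ
    have hg : MemLp (fun p => M.D p * (ψ : Space → ℝ) p) 2 (boxMeasure M.L (-M.H) 0) := by
      refine (memLp_congr_ae ?_).1 (Lp.memLp (M.mulD (testL2 ψ)))
      filter_upwards [M.coeFn_mulD (testL2 ψ), coeFn_testL2 ψ] with p h1 h2
      rw [h1, h2]
    have e : M.mulD (testL2 ψ) = hg.toLp _ := by
      refine Lp.ext ?_
      filter_upwards [M.coeFn_mulD (testL2 ψ), coeFn_testL2 ψ, hg.coeFn_toLp] with p h1 h2 h3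
      rw [h1, h2, h3]
    rw [e]
    obtain ⟨C, hC⟩ := exists_bound_on_box ψ.2.continuous M.L (-M.H) 0
    refine tendsto_toLp_of_bounded (C := M.dMax * |C|) (fun n => memLp_test _) hg ?_ ?_
    · intro n
      filter_upwards [ae_boxMeasure_mem M.L (-M.H) 0] with p hp
      rw [norm_mul]
      exact mul_le_mul (abs_smoothD_le n _) ((hC p hp).trans (le_abs_self _)) (norm_nonneg _)
        ((norm_nonneg _).trans (M.norm_D_le p))
    · exact Eventually.of_forall fun p => (tendsto_smoothD p).mul_const _
  set ψ : Test M.L (-M.H) 0 := ⟨_, φ.2.partialDeriv i⟩ with hψ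
  have e1 : testL2 ψ = testDeriv i φ := rfl
  have h1 := Filter.Tendsto.inner (𝕜 := ℝ) (tendsto_const_nhds (x := u)) (key ψ)
  have h2 := (Filter.Tendsto.inner (𝕜 := ℝ) (tendsto_const_nhds (x := g)) (key φ)).neg
  rw [inner_mulD, inner_mulD, ← e1]
  refine tendsto_nhds_unique h1 (h2.congr fun n => ?_)
  rw [← h]
  congr 1
  refine Lp.ext ?_
  filter_upwards [coeFn_testDeriv i (⟨_, φ.2.mul_coord (contDiff_smoothD (M := M) n)⟩ :
    Test M.L (-M.H) 0), coeFn_testL2 (⟨_, ψ.2.mul_coord (contDiff_smoothD (M := M) n)⟩ :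
    Test M.L (-M.H) 0)] with p h1 h2
  rw [h1, h2]
  have hd : Differentiable ℝ (fun q : Space => M.smoothD n (q 2)) :=
    ((contDiff_smoothD (M := M) n).differentiable (by simp)).comp (by fun_prop)
  change partialDeriv i (fun q => M.smoothD n (q 2) * (φ : Space → ℝ) q) p
    = M.smoothD n (p 2) * partialDeriv i φ p
  rw [partialDeriv_mul hd φ.2.differentiable, partialDeriv_of_coord i hi p
    ((contDiff_smoothD (M := M) n).differentiable (by simp) _)]
  simp

end Medium

end Layered

end

noncomputable section

namespace Layered

/-! ### Horizontal difference quotients -/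

section diffQuot

variable {L a b : ℝ} {j : Fin 3}

/-- Translation of a test function in a horizontal direction. -/
def hTranslate (hj : j ≠ 2) (t : ℝ) (φ : Test L a b) : Test L a b :=
  ⟨fun p => (φ : Space → ℝ) (p + t • unitVec j), by
    have := φ.2.translate (t • unitVec j)
    rw [show (t • unitVec j : Space) 2 = 0 by simp [unitVec_apply, hj.symm], sub_zero,
      sub_zero] at this
    exact this⟩

/-- The horizontal difference quotient of a test function. -/
def diffQuot (hj : j ≠ 2) (t : ℝ) (φ : Test L a b) : Test L a b :=
  t⁻¹ • (hTranslate hj t φ - φ)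

theorem coe_hTranslate (hj : j ≠ 2) (t : ℝ) (φ : Test L a b) :
    (hTranslate hj t φ : Space → ℝ) = fun p => (φ : Space → ℝ) (p + t • unitVec j) := rfl

/-- Invariance of weighted `L²` products of periodic functions under horizontal translations. -/
theorem integral_weighted_hTranslate (hL : 0 < L) (hj : j ≠ 2) (t : ℝ) {m : Space → ℝ} {C : ℝ}
    (hm : Measurable m) (hC : ∀ p, ‖m p‖ ≤ C) (hm2 : ∀ p q : Space, p 2 = q 2 → m p = m q)
    (φ χ : Test L a b) :
    ∫ p in box L a b, m p * ((φ : Space → ℝ) (p + t • unitVec j) * (χ : Space → ℝ) p)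
      = ∫ p in box L a b, m p * ((φ : Space → ℝ) p * (χ : Space → ℝ) (p + (-t) • unitVec j)) := by
  have hz : ∀ s : ℝ, (s • unitVec j : Space) 2 = 0 := fun s => by
    simp [unitVec_apply, hj.symm]
  have hmp : ∀ (s : ℝ) (p : Space), m (p + s • unitVec j) = m p := fun s p =>
    hm2 _ _ (by rw [PiLp.add_apply, hz, add_zero])
  have hInt : ∀ ψ : Space → ℝ, Continuous ψ → Integrable (fun p => m p * ψ p) (boxMeasure L a b) :=
    fun ψ hψ => (integrable_of_continuous hψ L a b).bdd_mul (c := C) hm.aestronglyMeasurable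
      (Eventually.of_forall hC)
  have hc : ∀ s : ℝ, Continuous fun p : Space => p + s • unitVec j := fun s => by fun_prop
  set F : Space → ℝ := fun p =>
    m p * ((φ : Space → ℝ) p * (χ : Space → ℝ) (p + (-t) • unitVec j)) with hF
  have hFp : HPeriodic L F := by
    intro i hi p
    have h1 : m (p + L • unitVec i) = m p := hm2 _ _ (by simp [unitVec_apply, hi.symm])
    have h2 : (χ : Space → ℝ) (p + L • unitVec i + (-t) • unitVec j)
        = (χ : Space → ℝ) (p + (-t) • unitVec j) := by
      rw [add_right_comm, χ.2.hperiodic i hi]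
    simp only [hF, h1, φ.2.hperiodic i hi, h2]
  have hFt : (fun p => F (p + t • unitVec j))
      = fun p => m p * ((φ : Space → ℝ) (p + t • unitVec j) * (χ : Space → ℝ) p) := by
    ext p
    simp only [hF, hmp, neg_smul, add_neg_cancel_right]
  have := integral_box_add hL (a := a) (b := b) hFp (t • unitVec j) (hInt _ ?_) ?_ ?_
  · rw [← this, hFt]
  · exact φ.2.continuous.mul (χ.2.continuous.comp (hc _))
  · rw [hFt]
    exact hInt _ ((φ.2.continuous.comp (hc _)).mul χ.2.continuous)
  · intro p hp
    have := φ.2.mem_Ioo (left_ne_zero_of_mul (right_ne_zero_of_mul hp))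
    rw [hz, sub_zero]
    exact ⟨this, this⟩

theorem testDeriv_hTranslate_ae (hj : j ≠ 2) (t : ℝ) (φ : Test L a b) (i : Fin 3) :
    testDeriv i (hTranslate hj t φ) =ᵐ[boxMeasure L a b]
      fun p => partialDeriv i φ (p + t • unitVec j) := by
  filter_upwards [coeFn_testDeriv i (hTranslate hj t φ)] with p hp
  rw [hp, coe_hTranslate, partialDeriv_add_right]

theorem testDeriv_eq_testL2 (i : Fin 3) (φ : Test L a b) :
    testDeriv i φ = testL2 (⟨_, φ.2.partialDeriv i⟩ : Test L a b) := rfl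

theorem inner_testDeriv_hTranslate (hL : 0 < L) (hj : j ≠ 2) (t : ℝ) (φ χ : Test L a b)
    (i : Fin 3) : inner ℝ (testDeriv i (hTranslate hj t φ)) (testL2 χ)
      = inner ℝ (testDeriv i φ) (testL2 (hTranslate hj (-t) χ)) := by
  rw [inner_eq_integral (testDeriv_hTranslate_ae hj t φ i) (coeFn_testL2 χ),
    inner_eq_integral (coeFn_testDeriv i φ) (coeFn_testL2 _)]
  simpa [coe_hTranslate] using integral_weighted_hTranslate hL hj t (m := fun _ => 1) (C := 1) measurable_const
    (by simp) (fun _ _ _ => rfl) ⟨_, φ.2.partialDeriv i⟩ χ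

theorem inner_testDeriv_diffQuot (hL : 0 < L) (hj : j ≠ 2) (t : ℝ) (φ χ : Test L a b)
    (i : Fin 3) : inner ℝ (testDeriv i (diffQuot hj t φ)) (testL2 χ)
      = - inner ℝ (testDeriv i φ) (testL2 (diffQuot hj (-t) χ)) := by
  simp only [diffQuot, map_smul, map_sub, inner_smul_left, inner_smul_right, inner_sub_left,
    inner_sub_right, inner_testDeriv_hTranslate hL hj t φ χ i]
  rw [inv_neg]
  simp

theorem norm_testDeriv_hTranslate (hL : 0 < L) (hj : j ≠ 2) (t : ℝ) (φ : Test L a b) (i : Fin 3) :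
    ‖testDeriv i (hTranslate hj t φ)‖ = ‖testDeriv i φ‖ := by
  have h1 : ‖testDeriv i (hTranslate hj t φ)‖ ^ 2 = ‖testDeriv i φ‖ ^ 2 := by
    have h := l2Sq_translate hL a b (φ.2.partialDeriv i).hperiodic (t • unitVec j)
    have hz : (t • unitVec j : Space) 2 = 0 := by simp [unitVec_apply, hj.symm]
    rw [hz, add_zero, add_zero, l2Sq_eq_of_ae_eq (testDeriv_hTranslate_ae hj t φ i),
      l2Sq_eq_of_ae_eq (coeFn_testDeriv i φ),
      ENNReal.ofReal_eq_ofReal_iff (by positivity) (by positivity)] at h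
    exact h
  exact (sq_eq_sq₀ (norm_nonneg _) (norm_nonneg _)).1 h1

theorem norm_testDeriv_diffQuot_le (hL : 0 < L) (hj : j ≠ 2) (t : ℝ) (φ : Test L a b)
    (i : Fin 3) : ‖testDeriv i (diffQuot hj t φ)‖ ≤ |t⁻¹| * (2 * ‖testDeriv i φ‖) := by
  rw [diffQuot, map_smul, map_sub, norm_smul, Real.norm_eq_abs]
  refine mul_le_mul_of_nonneg_left ((norm_sub_le _ _).trans ?_) (abs_nonneg _)
  rw [norm_testDeriv_hTranslate hL]
  linarith

/-- A horizontal translation keeps the whole box in the slab, so this is the translation estimate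
divided by `|t|`. -/
theorem norm_testL2_diffQuot_le (hL : 0 < L) (hj : j ≠ 2) {t : ℝ} (ht : t ≠ 0) (φ : Test L a b) :
    ‖testL2 (diffQuot hj t φ)‖ ≤ ‖testDeriv j φ‖ := by
  have h := shiftSq_le hL φ.2.continuous.measurable φ.2.hperiodic (coeFn_testL2 φ)
    (fun i => hasWD_test hL i φ) (t • unitVec j)
  have hz : (t • unitVec j : Space) 2 = 0 := by simp [unitVec_apply, hj.symm]
  have hae : testL2 (hTranslate hj t φ - φ) =ᵐ[boxMeasure L a b]
      fun p => (φ : Space → ℝ) (p + t • unitVec j) - (φ : Space → ℝ) p := coeFn_testL2 _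
  have hsum : ∑ i, (t • unitVec j : Space) i • testDeriv i φ = t • testDeriv j φ := by
    rw [Finset.sum_eq_single j (fun i _ hij => by simp [unitVec_apply, hij]) (by simp)]
    simp [unitVec_apply]
  rw [shiftSq, hz, sub_zero, sub_zero, max_self, min_self, l2Sq_eq_of_ae_eq hae, hsum,
    ENNReal.ofReal_le_ofReal_iff (by positivity)] at h
  have h' := le_of_sq_le_sq h (norm_nonneg _)
  rw [norm_smul, Real.norm_eq_abs] at h'
  rw [diffQuot, map_smul, norm_smul, Real.norm_eq_abs, abs_inv]
  rw [inv_mul_le_iff₀ (abs_pos.2 ht)]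
  exact h'

theorem tendsto_inner_diffQuot (hj : j ≠ 2) (u : BoxL2 L a b) (φ : Test L a b) :
    Tendsto (fun t => inner ℝ u (testL2 (diffQuot hj t φ))) (𝓝[≠] 0)
      (𝓝 (inner ℝ u (testDeriv j φ))) := by
  have hu : Integrable u (boxMeasure L a b) := (Lp.memLp u).integrable (by norm_num)
  have h := hasDerivAt_integral_translate hu φ.2.smooth (unitVec j) 0
  have h2 := hasDerivAt_iff_tendsto_slope_zero.1 h
  rw [inner_eq_integral (ae_eq_refl _) (coeFn_testDeriv j φ)]
  simp only [zero_smul, add_zero, zero_add] at h2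
  refine h2.congr fun t => ?_
  have hi : ∀ ψ : Test L a b, ∫ p in box L a b, u p * (ψ : Space → ℝ) p = inner ℝ u (testL2 ψ) :=
    fun ψ => (inner_eq_integral (ae_eq_refl _) (coeFn_testL2 ψ)).symm
  have e := hi (hTranslate hj t φ)
  rw [coe_hTranslate] at e
  rw [e, hi φ, diffQuot, map_smul, map_sub, inner_smul_right, inner_sub_right, smul_eq_mul]

end diffQuot

namespace Medium

variable {l : ℕ} {M : Medium l}

/-- Since `D` depends only on the height, horizontal translation by `t` and by `-t` are adjoint for
the weighted product. -/
theorem inner_mulD_testDeriv_hTranslate {j : Fin 3} (hj : j ≠ 2) (t : ℝ)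
    (φ χ : Test M.L (-M.H) 0) (i : Fin 3) :
    inner ℝ (M.mulD (testDeriv i (hTranslate hj t φ))) (testDeriv i χ)
      = inner ℝ (M.mulD (testDeriv i φ)) (testDeriv i (hTranslate hj (-t) χ)) := by
  have h1 : ∀ ψ : Test M.L (-M.H) 0, ∀ f : Space → ℝ,
      testDeriv i ψ =ᵐ[boxMeasure M.L (-M.H) 0] f →
      M.mulD (testDeriv i ψ) =ᵐ[boxMeasure M.L (-M.H) 0] fun p => M.D p * f p := by
    intro ψ f hf
    filter_upwards [M.coeFn_mulD (testDeriv i ψ), hf] with p h1 h2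
    rw [h1, h2]
  rw [inner_eq_integral (h1 _ _ (testDeriv_hTranslate_ae hj t φ i)) (coeFn_testDeriv i χ),
    inner_eq_integral (h1 _ _ (coeFn_testDeriv i φ)) (testDeriv_hTranslate_ae hj (-t) χ i)]
  simpa [mul_assoc] using integral_weighted_hTranslate M.L_pos hj t M.measurable_D M.norm_D_le
    (fun _ _ h => M.D_congr h) ⟨_, φ.2.partialDeriv i⟩ ⟨_, χ.2.partialDeriv i⟩

theorem inner_mulD_testDeriv_diffQuot {j : Fin 3} (hj : j ≠ 2) (t : ℝ)
    (φ χ : Test M.L (-M.H) 0) (i : Fin 3) :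
    inner ℝ (M.mulD (testDeriv i (diffQuot hj t φ))) (testDeriv i χ)
      = - inner ℝ (M.mulD (testDeriv i φ)) (testDeriv i (diffQuot hj (-t) χ)) := by
  simp only [diffQuot, map_smul, map_sub, inner_smul_left, inner_smul_right, inner_sub_left,
    inner_sub_right, inner_mulD_testDeriv_hTranslate hj t φ χ i]
  rw [inv_neg]
  simp

/-! ### Regularity -/

/-- `u` solves `-∇·(D∇u) = f` weakly, with gradient `g`. -/
structure IsWeakSolution (M : Medium l) (u : M.L2) (g : Fin 3 → M.L2) (f : M.L2) : Prop where
  inH10 : InH10 u g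
  eq : ∀ χ : Test M.L (-M.H) 0, ∑ i, inner ℝ (M.mulD (g i)) (testDeriv i χ) = inner ℝ f (testL2 χ)

/-- Nirenberg's method, carried out on test functions `φ n` approximating `u`. Testing the equation
with a second difference quotient `η n` produces the energy `A n` of the first quotient `δ n`, while
`‖η n‖` is controlled by `‖∂_j δ n‖`, hence by `A n` itself. The resulting bound does not depend on
`t`. -/
theorem IsWeakSolution.abs_inner_diffQuot_le {u f : M.L2} {g : Fin 3 → M.L2}
    (h : M.IsWeakSolution u g f) {j : Fin 3} (hj : j ≠ 2) {t : ℝ} (ht : t ≠ 0) (i : Fin 3)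
    (χ : Test M.L (-M.H) 0) :
    |inner ℝ (g i) (testL2 (diffQuot hj (-t) χ))| ≤ ‖f‖ / M.dMin * ‖testL2 χ‖ := by
  have hL := M.L_pos
  have hd := M.dMin_pos
  obtain ⟨φ, hφ, hφ'⟩ := h.inH10
  set δ : ℕ → Test M.L (-M.H) 0 := fun n => diffQuot hj t (φ n) with hδ
  set η : ℕ → Test M.L (-M.H) 0 := fun n => diffQuot hj (-t) (δ n) with hη
  set A : ℕ → ℝ := fun n => ∑ i, inner ℝ (M.mulD (testDeriv i (δ n))) (testDeriv i (δ n)) with hA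
  -- The defect caused by `φ n` not being the solution.
  set err : ℕ → ℝ := fun n => ∑ i, inner ℝ (M.mulD (testDeriv i (φ n) - g i)) (testDeriv i (η n))
    with herr
  have hder : ∀ n i, M.dMin * ‖testDeriv i (δ n)‖ ^ 2 ≤ A n := fun n i =>
    (M.dMin_mul_norm_sq_le _).trans (Finset.single_le_sum
      (f := fun i => (inner ℝ (M.mulD (testDeriv i (δ n))) (testDeriv i (δ n)) : ℝ))
      (fun i _ => (by positivity : 0 ≤ M.dMin * ‖testDeriv i (δ n)‖ ^ 2).trans
        (M.dMin_mul_norm_sq_le _)) (Finset.mem_univ i))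
  have hAerr : ∀ n, A n = - inner ℝ f (testL2 (η n)) - err n := by
    intro n
    rw [← h.eq (η n)]
    simp only [hA, herr, map_sub, inner_sub_left, Finset.sum_sub_distrib]
    have : ∀ i, inner ℝ (M.mulD (testDeriv i (δ n))) (testDeriv i (δ n))
        = - inner ℝ (M.mulD (testDeriv i (φ n))) (testDeriv i (η n)) := fun i =>
      inner_mulD_testDeriv_diffQuot hj t (φ n) (δ n) i
    simp only [this, Finset.sum_neg_distrib]
    ring
  have hηn : ∀ n, ‖testL2 (η n)‖ ^ 2 * M.dMin ≤ A n := by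
    intro n
    have h1 := norm_testL2_diffQuot_le hL hj (neg_ne_zero.2 ht) (δ n)
    have h2 := pow_le_pow_left₀ (norm_nonneg _) h1 2
    nlinarith [hder n j]
  have hAbound : ∀ n, A n ≤ ‖f‖ ^ 2 / M.dMin + 2 * |err n| := by
    intro n
    have h1 : A n ≤ ‖f‖ * ‖testL2 (η n)‖ + |err n| := by
      rw [hAerr n]
      linarith [neg_abs_le (inner ℝ f (testL2 (η n)) : ℝ), abs_real_inner_le_norm f (testL2 (η n)),
        neg_abs_le (err n)]
    have h2 := hηn n
    set y := ‖testL2 (η n)‖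
    -- Young's inequality, weighted so that the last term is at most half of `A n` and can be
    -- absorbed.
    have h3 : ‖f‖ * y ≤ ‖f‖ ^ 2 / (2 * M.dMin) + M.dMin * y ^ 2 / 2 := by
      rw [div_add_div _ _ (by positivity) two_ne_zero, le_div_iff₀ (by positivity)]
      nlinarith [sq_nonneg (‖f‖ - M.dMin * y)]
    have h4 : ‖f‖ ^ 2 / M.dMin = 2 * (‖f‖ ^ 2 / (2 * M.dMin)) := by field_simp
    rw [h4]
    nlinarith
  have herr0 : Tendsto err atTop (𝓝 0) := by
    rw [← Finset.sum_const_zero (s := (Finset.univ : Finset (Fin 3)))]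
    refine tendsto_finsetSum _ fun i _ => ?_
    -- This bound degenerates as `t → 0`, which is harmless: `t` is fixed while `n` tends to
    -- infinity.
    have hb : ∀ n, |inner ℝ (M.mulD (testDeriv i (φ n) - g i)) (testDeriv i (η n))|
        ≤ M.dMax * ‖testDeriv i (φ n) - g i‖ *
          (|(-t)⁻¹| * (2 * (|t⁻¹| * (2 * ‖testDeriv i (φ n)‖)))) := by
      intro n
      refine (abs_real_inner_le_norm _ _).trans (mul_le_mul (M.norm_mulD_le _) ?_ (norm_nonneg _) ?_)
      · refine (norm_testDeriv_diffQuot_le hL hj (-t) (δ n) i).trans ?_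
        have := norm_testDeriv_diffQuot_le hL hj t (φ n) i
        gcongr
      · exact (norm_nonneg _).trans (M.norm_mulD_le _)
    refine squeeze_zero_norm hb ?_
    have h1 : Tendsto (fun n => ‖testDeriv i (φ n) - g i‖) atTop (𝓝 0) :=
      tendsto_iff_norm_sub_tendsto_zero.1 (hφ' i)
    have h2 := ((h1.const_mul M.dMax).mul (((((hφ' i).norm).const_mul 2).const_mul
      |t⁻¹|).const_mul 2 |>.const_mul |(-t)⁻¹|))
    simpa using h2
  have hlim : Tendsto (fun n => |inner ℝ (testDeriv i (φ n)) (testL2 (diffQuot hj (-t) χ))|) atTop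
      (𝓝 |inner ℝ (g i) (testL2 (diffQuot hj (-t) χ))|) :=
    (Filter.Tendsto.inner (𝕜 := ℝ) (hφ' i) tendsto_const_nhds).abs
  have hlim2 : Tendsto (fun n => Real.sqrt ((‖f‖ ^ 2 / M.dMin + 2 * |err n|) / M.dMin) * ‖testL2 χ‖)
      atTop (𝓝 (Real.sqrt ((‖f‖ ^ 2 / M.dMin + 2 * |(0 : ℝ)|) / M.dMin) * ‖testL2 χ‖)) :=
    ((Real.continuous_sqrt.tendsto _).comp
      (((herr0.abs.const_mul 2).const_add _).div_const _)).mul_const _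
  have hfin := le_of_tendsto_of_tendsto' hlim hlim2 fun n => by
    have h1 := inner_testDeriv_diffQuot hL hj t (φ n) χ i
    rw [← abs_neg, ← h1]
    refine (abs_real_inner_le_norm _ _).trans (mul_le_mul_of_nonneg_right ?_ (norm_nonneg _))
    refine Real.le_sqrt_of_sq_le ?_
    rw [le_div_iff₀ hd]
    linarith [hder n i, hAbound n]
  have e : Real.sqrt ((‖f‖ ^ 2 / M.dMin + 2 * |(0 : ℝ)|) / M.dMin) = ‖f‖ / M.dMin := by
    rw [abs_zero, mul_zero, add_zero, div_div, ← sq, ← div_pow, Real.sqrt_sq (by positivity)]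
  rwa [e] at hfin

/-- The previous bound is uniform in `t`, so it survives the limit `t → 0`, and duality yields the
derivative. -/
theorem IsWeakSolution.exists_horizontal {u f : M.L2} {g : Fin 3 → M.L2}
    (h : M.IsWeakSolution u g f) {j : Fin 3} (hj : j ≠ 2) (i : Fin 3) :
    ∃ k : M.L2, ‖k‖ ≤ ‖f‖ / M.dMin ∧ HasWD j (g i) k := by
  refine exists_hasWD_of_bound j (g i) (div_nonneg (norm_nonneg _) M.dMin_pos.le) fun χ => ?_
  refine le_of_tendsto (tendsto_inner_diffQuot hj (g i) χ).abs ?_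
  filter_upwards [self_mem_nhdsWithin] with t ht
  have := h.abs_inner_diffQuot_le hj (neg_ne_zero.2 ht) i χ
  rwa [neg_neg] at this

/-- Both mixed derivatives, tested against `φ`, give `⟨u, ∂ᵢ∂ⱼφ⟩`. Regularity provides horizontal
derivatives of every gradient component, whereas `𝓦` asks for every derivative of the horizontal
components; this exchanges the two. -/
theorem _root_.Layered.InH10.hasWD_comm {L a b : ℝ} (hL : 0 < L) {u : BoxL2 L a b}
    {g : Fin 3 → BoxL2 L a b} (h : InH10 u g) {i j : Fin 3} {k : BoxL2 L a b}
    (hk : HasWD j (g i) k) : HasWD i (g j) k := by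
  intro φ
  rw [← hk φ]
  have hc : testDeriv i (⟨_, φ.2.partialDeriv j⟩ : Test L a b)
      = testDeriv j (⟨_, φ.2.partialDeriv i⟩ : Test L a b) := by
    refine Lp.ext ?_
    filter_upwards [coeFn_testDeriv i (⟨_, φ.2.partialDeriv j⟩ : Test L a b),
      coeFn_testDeriv j (⟨_, φ.2.partialDeriv i⟩ : Test L a b)] with p h1 h2
    rw [h1, h2]
    exact partialDeriv_comm φ.2.smooth i j p
  have h1 := h.hasWD hL i ⟨_, φ.2.partialDeriv j⟩
  have h2 := h.hasWD hL j ⟨_, φ.2.partialDeriv i⟩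
  rw [hc] at h1
  rw [← testDeriv_eq_testL2] at h1 h2
  linarith

theorem IsWeakSolution.energy {u f : M.L2} {g : Fin 3 → M.L2} (h : M.IsWeakSolution u g f) :
    ∑ i, inner ℝ (M.mulD (g i)) (g i) = inner ℝ f u := by
  obtain ⟨φ, hφ, hφ'⟩ := h.inH10
  have h1 : Tendsto (fun n => ∑ i, inner ℝ (M.mulD (g i)) (testDeriv i (φ n))) atTop
      (𝓝 (∑ i, inner ℝ (M.mulD (g i)) (g i))) :=
    tendsto_finsetSum _ fun i _ => Filter.Tendsto.inner (𝕜 := ℝ) tendsto_const_nhds (hφ' i)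
  have h2 : Tendsto (fun n => inner ℝ f (testL2 (φ n))) atTop (𝓝 (inner ℝ f u)) :=
    Filter.Tendsto.inner (𝕜 := ℝ) tendsto_const_nhds hφ
  exact tendsto_nhds_unique h1 (h2.congr fun n => (h.eq _).symm)

/-- Coercivity and the Poincaré inequality in the energy identity: `dMin ‖g 2‖² ≤ 2H ‖f‖ ‖g 2‖`, and
the resulting bound on `g 2` is fed back for the other components. -/
theorem IsWeakSolution.norm_grad_le {u f : M.L2} {g : Fin 3 → M.L2} (h : M.IsWeakSolution u g f)
    (i : Fin 3) : ‖g i‖ ≤ 2 * M.H / M.dMin * ‖f‖ := by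
  have hd := M.dMin_pos
  have hH := M.H_pos
  have h1 : ∀ i, M.dMin * ‖g i‖ ^ 2 ≤ inner ℝ f u := fun i => by
    rw [← h.energy]
    exact (M.dMin_mul_norm_sq_le _).trans (Finset.single_le_sum
      (f := fun i => (inner ℝ (M.mulD (g i)) (g i) : ℝ))
      (fun i _ => (by positivity : 0 ≤ M.dMin * ‖g i‖ ^ 2).trans (M.dMin_mul_norm_sq_le _))
      (Finset.mem_univ i))
  have h2 : inner ℝ f u ≤ ‖f‖ * (2 * M.H * ‖g 2‖) :=
    (real_inner_le_norm f u).trans (mul_le_mul_of_nonneg_left h.inH10.norm_le (norm_nonneg _))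
  have h3 : ‖g 2‖ ≤ 2 * M.H / M.dMin * ‖f‖ := by
    rw [div_mul_eq_mul_div, le_div_iff₀ hd]
    rcases (norm_nonneg (g 2)).eq_or_lt with h0 | h0
    · rw [← h0, zero_mul]; positivity
    · refine le_of_mul_le_mul_left ?_ h0
      nlinarith [h1 2]
  refine le_of_sq_le_sq ?_ (by positivity)
  have h4 : M.dMin * ‖g i‖ ^ 2 ≤ ‖f‖ * (2 * M.H * (2 * M.H / M.dMin * ‖f‖)) :=
    ((h1 i).trans h2).trans (by gcongr)
  have e : ‖f‖ * (2 * M.H * (2 * M.H / M.dMin * ‖f‖)) = M.dMin * (2 * M.H / M.dMin * ‖f‖) ^ 2 := by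
    field_simp
  rw [e] at h4
  exact le_of_mul_le_mul_left h4 hd

end Medium

end Layered

end

noncomputable section

namespace Layered

namespace Medium

variable {l : ℕ} {M : Medium l}

/-! ### The spaces `𝓥` and `𝓦` in terms of weak derivatives -/

theorem wd_ae_eq {u : M.L2} {g : Fin 3 → M.L2} (h : InH10 u g) (i : Fin 3) :
    M.wd i u =ᵐ[boxMeasure M.L (-M.H) 0] g i :=
  weakPartial_ae_eq_of_hasWD M.L_pos (ae_eq_refl _) (h.hasWD M.L_pos i)

theorem mulD_ae_eq_wd {u : M.L2} {g : Fin 3 → M.L2} (h : InH10 u g) (i : Fin 3) :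
    M.mulD (g i) =ᵐ[boxMeasure M.L (-M.H) 0] fun p => M.D p * M.wd i u p := by
  filter_upwards [M.coeFn_mulD (g i), wd_ae_eq h i] with p h1 h2
  rw [h1, h2]

theorem vSq_eq {u : M.L2} {g : Fin 3 → M.L2} (h : InH10 u g) :
    M.vSq u = ENNReal.ofReal (∑ i, inner ℝ (M.mulD (g i)) (g i)) := by
  have hn : ∀ i, ‖M.mulSqrtD (g i)‖ ^ 2 = inner ℝ (M.mulD (g i)) (g i) := fun i => by
    rw [← real_inner_self_eq_norm_sq, inner_mulSqrtD]
  rw [vSq, ENNReal.ofReal_sum_of_nonneg fun i _ => by rw [← hn]; positivity]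
  refine Finset.sum_congr rfl fun i _ => ?_
  rw [← hn]
  refine l2Sq_eq_of_ae_eq ?_
  filter_upwards [M.coeFn_mulSqrtD (g i), wd_ae_eq h i] with p h1 h2
  rw [h1, h2]

/-- The weak derivatives that enter the norm of `𝓦`. -/
structure IsWData (M : Medium l) (u : M.L2) (g k₀ k₁ m : Fin 3 → M.L2) : Prop where
  inH10 : InH10 u g
  hasWD_zero : ∀ i, HasWD i (g 0) (k₀ i)
  hasWD_one : ∀ i, HasWD i (g 1) (k₁ i)
  hasWD_two : ∀ i, HasWD i (M.mulD (g 2)) (m i)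

theorem mem_W_iff {u : M.L2} : u ∈ M.W ↔ ∃ g k₀ k₁ m, M.IsWData u g k₀ k₁ m := by
  constructor
  · rintro ⟨hV, h0, h1, h2⟩
    obtain ⟨g, hg⟩ := mem_V_iff.1 hV
    obtain ⟨k₀, hk₀⟩ := (memH1_iff (wd_ae_eq hg 0).symm).1 h0
    obtain ⟨k₁, hk₁⟩ := (memH1_iff (wd_ae_eq hg 1).symm).1 h1
    obtain ⟨m, hm⟩ := (memH1_iff (mulD_ae_eq_wd hg 2)).1 h2
    exact ⟨g, k₀, k₁, m, hg, hk₀, hk₁, hm⟩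
  · rintro ⟨g, k₀, k₁, m, hg, hk₀, hk₁, hm⟩
    exact ⟨mem_V_iff.2 ⟨g, hg⟩, (memH1_iff (wd_ae_eq hg 0).symm).2 ⟨k₀, hk₀⟩,
      (memH1_iff (wd_ae_eq hg 1).symm).2 ⟨k₁, hk₁⟩, (memH1_iff (mulD_ae_eq_wd hg 2)).2 ⟨m, hm⟩⟩

theorem IsWData.wSq_eq {u : M.L2} {g k₀ k₁ m : Fin 3 → M.L2} (h : M.IsWData u g k₀ k₁ m) :
    M.wSq u = ENNReal.ofReal ((‖u‖ ^ 2 + ∑ i, ‖g i‖ ^ 2) + (‖g 0‖ ^ 2 + ∑ i, ‖k₀ i‖ ^ 2)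
      + (‖g 1‖ ^ 2 + ∑ i, ‖k₁ i‖ ^ 2) + (‖M.mulD (g 2)‖ ^ 2 + ∑ i, ‖m i‖ ^ 2)) := by
  have hL := M.L_pos
  rw [wSq, h1Sq_eq hL (ae_eq_refl _) (h.inH10.hasWD hL),
    h1Sq_eq hL (wd_ae_eq h.inH10 0).symm h.hasWD_zero,
    h1Sq_eq hL (wd_ae_eq h.inH10 1).symm h.hasWD_one,
    h1Sq_eq hL (mulD_ae_eq_wd h.inH10 2) h.hasWD_two,
    ← ENNReal.ofReal_add (by positivity) (by positivity),
    ← ENNReal.ofReal_add (by positivity) (by positivity),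
    ← ENNReal.ofReal_add (by positivity) (by positivity)]

theorem op_ae_eq {u : M.L2} {g n : Fin 3 → M.L2} (h : InH10 u g)
    (hn : ∀ i, HasWD i (M.mulD (g i)) (n i)) :
    M.op u =ᵐ[boxMeasure M.L (-M.H) 0] (-∑ i, n i : M.L2) := by
  have h1 : ∀ i, M.wd i (fun q => M.D q * M.wd i u q) =ᵐ[boxMeasure M.L (-M.H) 0] n i := fun i =>
    weakPartial_ae_eq_of_hasWD M.L_pos (mulD_ae_eq_wd h i) (hn i)
  simp only [Fin.sum_univ_three]
  filter_upwards [h1 0, h1 1, h1 2, Lp.coeFn_neg (n 0 + n 1 + n 2), Lp.coeFn_add (n 0 + n 1) (n 2),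
    Lp.coeFn_add (n 0) (n 1)] with p e0 e1 e2 e3 e4 e5
  simp only [op, Fin.sum_univ_three]
  rw [e0, e1, e2, e3, Pi.neg_apply, e4, Pi.add_apply, e5, Pi.add_apply]

theorem isWeakSolution_of_hasWD {u : M.L2} {g n : Fin 3 → M.L2} (h : InH10 u g)
    (hn : ∀ i, HasWD i (M.mulD (g i)) (n i)) : M.IsWeakSolution u g (-∑ i, n i) :=
  ⟨h, fun χ => by simp [hn _ χ, inner_neg_left, sum_inner]⟩

theorem IsWData.hasWD_mulD {u : M.L2} {g k₀ k₁ m : Fin 3 → M.L2} (h : M.IsWData u g k₀ k₁ m)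
    (i : Fin 3) : HasWD i (M.mulD (g i)) (![M.mulD (k₀ 0), M.mulD (k₁ 1), m 2] i) := by
  fin_cases i
  · exact (h.hasWD_zero 0).mulD (by decide)
  · exact (h.hasWD_one 1).mulD (by decide)
  · exact h.hasWD_two 2

/-- Elements of `𝓦` are weak solutions with a right-hand side controlled by the norm of `𝓦`. -/
theorem exists_isWeakSolution_of_mem_W {u : M.L2} (hu : u ∈ M.W) :
    ∃ g f, M.IsWeakSolution u g f ∧ M.op u =ᵐ[boxMeasure M.L (-M.H) 0] f ∧
      ENNReal.ofReal (‖f‖ ^ 2) ≤ ENNReal.ofReal (3 * (M.dMax ^ 2 + 1)) * M.wSq u := by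
  obtain ⟨g, k₀, k₁, m, h⟩ := mem_W_iff.1 hu
  refine ⟨g, _, isWeakSolution_of_hasWD h.inH10 h.hasWD_mulD, op_ae_eq h.inH10 h.hasWD_mulD, ?_⟩
  rw [h.wSq_eq, ← ENNReal.ofReal_mul (by positivity)]
  refine ENNReal.ofReal_le_ofReal ?_
  rw [norm_neg]
  simp only [Fin.sum_univ_three, Matrix.cons_val_zero, Matrix.cons_val_one, Matrix.cons_val]
  have h1 : ‖M.mulD (k₀ 0) + M.mulD (k₁ 1) + m 2‖ ≤ ‖M.mulD (k₀ 0)‖ + ‖M.mulD (k₁ 1)‖ + ‖m 2‖ :=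
    norm_add₃_le
  have h2 := M.norm_mulD_le (k₀ 0)
  have h3 := M.norm_mulD_le (k₁ 1)
  have h4 : ‖M.mulD (k₀ 0) + M.mulD (k₁ 1) + m 2‖ ^ 2
      ≤ 3 * (‖M.mulD (k₀ 0)‖ ^ 2 + ‖M.mulD (k₁ 1)‖ ^ 2 + ‖m 2‖ ^ 2) := by
    refine (pow_le_pow_left₀ (norm_nonneg _) h1 2).trans ?_
    nlinarith [sq_nonneg (‖M.mulD (k₀ 0)‖ - ‖M.mulD (k₁ 1)‖), sq_nonneg (‖M.mulD (k₀ 0)‖ - ‖m 2‖),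
      sq_nonneg (‖M.mulD (k₁ 1)‖ - ‖m 2‖)]
  have h5 := pow_le_pow_left₀ (norm_nonneg _) h2 2
  have h6 := pow_le_pow_left₀ (norm_nonneg _) h3 2
  rw [mul_pow] at h5 h6
  have h7 : ∀ S T U : ℝ, 0 ≤ T → 0 ≤ U → S ≤ T → M.dMax ^ 2 * S + U ≤ (M.dMax ^ 2 + 1) * (T + U) := by
    intro S T U hT hU hS
    nlinarith [sq_nonneg M.dMax, mul_nonneg (sq_nonneg M.dMax) hU,
      mul_le_mul_of_nonneg_left hS (sq_nonneg M.dMax)]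
  -- The summands of the squared norm of `𝓦` that do not enter `𝓛u`; they are only discarded.
  set rest : ℝ := (‖u‖ ^ 2 + (‖g 0‖ ^ 2 + ‖g 1‖ ^ 2 + ‖g 2‖ ^ 2)) + (‖g 0‖ ^ 2 + (‖k₀ 1‖ ^ 2 + ‖k₀ 2‖ ^ 2))
      + (‖g 1‖ ^ 2 + (‖k₁ 0‖ ^ 2 + ‖k₁ 2‖ ^ 2)) + (‖M.mulD (g 2)‖ ^ 2 + (‖m 0‖ ^ 2 + ‖m 1‖ ^ 2)) with hrest
  have hrest0 : 0 ≤ rest := by positivity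
  have h8 := h7 (‖k₀ 0‖ ^ 2 + ‖k₁ 1‖ ^ 2) (‖k₀ 0‖ ^ 2 + ‖k₁ 1‖ ^ 2 + rest) (‖m 2‖ ^ 2)
    (by positivity) (by positivity) (by linarith)
  calc ‖M.mulD (k₀ 0) + M.mulD (k₁ 1) + m 2‖ ^ 2
      ≤ 3 * ((M.dMax ^ 2 + 1) * (‖k₀ 0‖ ^ 2 + ‖k₁ 1‖ ^ 2 + rest + ‖m 2‖ ^ 2)) := by linarith
    _ = _ := by rw [hrest]; ring

/-- Weak solutions with a right-hand side in `L²` belong to `𝓦`. -/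
theorem exists_regularity_const (M : Medium l) : ∃ C : ℝ, 0 < C ∧
    ∀ (u : M.L2) (g : Fin 3 → M.L2) (f : M.L2), M.IsWeakSolution u g f →
      u ∈ M.W ∧ M.op u =ᵐ[boxMeasure M.L (-M.H) 0] f ∧ M.wSq u ≤ ENNReal.ofReal (C * ‖f‖ ^ 2) := by
  have hd := M.dMin_pos
  have hH := M.H_pos
  set A : ℝ := 2 * M.H / M.dMin with hA
  set B : ℝ := 1 / M.dMin with hB
  set X : ℝ := M.dMax with hX
  have hA0 : 0 < A := by positivity
  have hB0 : 0 < B := by positivity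
  -- The summands bound, in this order, `‖u‖²`, the five occurrences of gradient components, the six
  -- derivatives `k₀` and `k₁`, `‖D g 2‖²`, `m 0` with `m 1`, and `m 2`.
  refine ⟨(2 * M.H * A) ^ 2 + 5 * A ^ 2 + 6 * B ^ 2 + (X * A) ^ 2 + 2 * (X * B) ^ 2
    + (1 + 2 * (X * B)) ^ 2, by positivity, fun u g f h => ?_⟩
  have hgA : ∀ i, ‖g i‖ ≤ A * ‖f‖ := h.norm_grad_le
  choose k₀ hk₀n hk₀ using fun i => h.exists_horizontal (j := 0) (by decide) i
  choose k₁ hk₁n hk₁ using fun i => h.exists_horizontal (j := 1) (by decide) i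
  have hB' : ‖f‖ / M.dMin = B * ‖f‖ := by rw [hB]; ring
  simp only [hB'] at hk₀n hk₁n
  -- The gradient of the flux `D∂_z u`: horizontal derivatives pass through `D`, and the vertical
  -- one is read off from the equation.
  set m : Fin 3 → M.L2 := ![M.mulD (k₀ 2), M.mulD (k₁ 2), -f - M.mulD (k₀ 0) - M.mulD (k₁ 1)]
    with hm
  have hm2 : HasWD 2 (M.mulD (g 2)) (m 2) := by
    intro χ
    have e := h.eq χ
    rw [Fin.sum_univ_three, (hk₀ 0).mulD (by decide) χ, (hk₁ 1).mulD (by decide) χ] at e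
    have : m 2 = -f - M.mulD (k₀ 0) - M.mulD (k₁ 1) := rfl
    rw [this, inner_sub_left, inner_sub_left, inner_neg_left]
    linarith
  have hW : M.IsWData u g k₀ k₁ m :=
    ⟨h.inH10, fun i => h.inH10.hasWD_comm M.L_pos (hk₀ i),
      fun i => h.inH10.hasWD_comm M.L_pos (hk₁ i), fun i => by
        fin_cases i
        · exact (hk₀ 2).mulD (by decide)
        · exact (hk₁ 2).mulD (by decide)
        · exact hm2⟩
  refine ⟨mem_W_iff.2 ⟨g, k₀, k₁, m, hW⟩, ?_, ?_⟩
  · have := op_ae_eq h.inH10 hW.hasWD_mulD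
    convert this using 2
    simp only [Fin.sum_univ_three, Matrix.cons_val_zero, Matrix.cons_val_one, Matrix.cons_val, hm]
    abel_nf
  · rw [hW.wSq_eq]
    refine ENNReal.ofReal_le_ofReal ?_
    have hf0 := norm_nonneg f
    have hX0 : 0 ≤ X := Finset.sum_nonneg fun j _ => (M.diff_pos j).le
    have bu : ‖u‖ ≤ 2 * M.H * A * ‖f‖ := by
      refine h.inH10.norm_le.trans ?_
      have := hgA 2
      calc 2 * M.H * ‖g 2‖ ≤ 2 * M.H * (A * ‖f‖) := by gcongr
        _ = _ := by ring
    have bD : ∀ (v : M.L2) (c : ℝ), ‖v‖ ≤ c * ‖f‖ → ‖M.mulD v‖ ≤ X * c * ‖f‖ := by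
      intro v c hv
      refine (M.norm_mulD_le v).trans ?_
      rw [mul_assoc]
      exact mul_le_mul_of_nonneg_left hv hX0
    have bm2 : ‖m 2‖ ≤ (1 + 2 * (X * B)) * ‖f‖ := by
      have h1 : ‖m 2‖ ≤ ‖f‖ + ‖M.mulD (k₀ 0)‖ + ‖M.mulD (k₁ 1)‖ := by
        refine (norm_sub_le _ _).trans (add_le_add_left ((norm_sub_le _ _).trans ?_) _)
        rw [norm_neg]
      linarith [bD _ _ (hk₀n 0), bD _ _ (hk₁n 1)]
    have sqb : ∀ (v : M.L2) (c : ℝ), ‖v‖ ≤ c * ‖f‖ → ‖v‖ ^ 2 ≤ c ^ 2 * ‖f‖ ^ 2 := by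
      intro v c hv
      rw [← mul_pow]
      exact pow_le_pow_left₀ (norm_nonneg _) hv 2
    simp only [Fin.sum_univ_three]
    have e0 : m 0 = M.mulD (k₀ 2) := rfl
    have e1 : m 1 = M.mulD (k₁ 2) := rfl
    rw [e0, e1]
    linarith [sqb _ _ bu, sqb _ _ (hgA 0), sqb _ _ (hgA 1), sqb _ _ (hgA 2), sqb _ _ (hk₀n 0),
      sqb _ _ (hk₀n 1), sqb _ _ (hk₀n 2), sqb _ _ (hk₁n 0), sqb _ _ (hk₁n 1), sqb _ _ (hk₁n 2),
      sqb _ _ (bD _ _ (hgA 2)), sqb _ _ (bD _ _ (hk₀n 2)), sqb _ _ (bD _ _ (hk₁n 2)), sqb _ _ bm2]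

end Medium

end Layered

end

noncomputable section

namespace Layered

/-! ### Expansions with respect to an eigenbasis, abstractly -/

section abstractSpectral

variable {E Y : Type*} [NormedAddCommGroup E] [InnerProductSpace ℝ E]
  [NormedAddCommGroup Y] [InnerProductSpace ℝ Y]

theorem _root_.HilbertBasis.hasSum_inner_sq (w : HilbertBasis ℕ ℝ E) (x : E) :
    HasSum (fun k => inner ℝ x (w k) ^ 2) (‖x‖ ^ 2) := by
  have := w.hasSum_inner_mul_inner x x
  rw [real_inner_self_eq_norm_sq] at this
  refine this.congr_fun ?_ |> fun h => h
  intro k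
  rw [sq, real_inner_comm (w k) x]

theorem _root_.HilbertBasis.exists_of_summable_sq (w : HilbertBasis ℕ ℝ E) {c : ℕ → ℝ}
    (hc : Summable fun k => c k ^ 2) : ∃ x : E, ∀ k, inner ℝ x (w k) = c k := by
  have hm : Memℓp c 2 := by
    refine memℓp_gen ?_
    simpa using hc
  refine ⟨w.repr.symm ⟨c, hm⟩, fun k => ?_⟩
  rw [real_inner_comm, ← w.repr_apply_apply]
  simp

/-- The relation `hin` makes the vectors `y k` orthogonal with squared norms `κ k`. A vector
orthogonal to all of them has an image under `J` without coefficients, so completeness follows from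
injectivity of `J`. -/
theorem exists_hilbertBasis_of_eigen [CompleteSpace Y] (J : Y →L[ℝ] E) (hJ : Function.Injective J)
    (w : HilbertBasis ℕ ℝ E) (y : ℕ → Y) (κ : ℕ → ℝ) (hκ : ∀ k, 0 < κ k)
    (hy : ∀ k, J (y k) = w k) (hin : ∀ k v, inner ℝ (y k) v = κ k * inner ℝ (w k) (J v)) :
    ∃ e : HilbertBasis ℕ ℝ Y, ∀ k v, inner ℝ (e k) v = Real.sqrt (κ k) * inner ℝ (w k) (J v) := by
  have hs : ∀ k, Real.sqrt (κ k) ≠ 0 := fun k => (Real.sqrt_pos.2 (hκ k)).ne'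
  have hss : ∀ k, Real.sqrt (κ k) * Real.sqrt (κ k) = κ k := fun k => Real.mul_self_sqrt (hκ k).le
  set x : ℕ → Y := fun k => (Real.sqrt (κ k))⁻¹ • y k with hx
  have hxin : ∀ k v, inner ℝ (x k) v = Real.sqrt (κ k) * inner ℝ (w k) (J v) := by
    intro k v
    rw [hx, real_inner_smul_left, hin, ← mul_assoc]
    congr 1
    rw [inv_mul_eq_iff_eq_mul₀ (hs k), hss]
  have horth : Orthonormal ℝ x := by
    rw [orthonormal_iff_ite]
    intro i j
    rw [hxin, hx, map_smul, real_inner_smul_right, hy]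
    have := orthonormal_iff_ite.1 w.orthonormal i j
    rw [this]
    split_ifs with h
    · rw [h, mul_one, mul_inv_cancel₀ (hs j)]
    · simp
  have hbot : (Submodule.span ℝ (range x))ᗮ = ⊥ := by
    rw [Submodule.eq_bot_iff]
    intro v hv
    have h0 : ∀ k, inner ℝ (w k) (J v) = 0 := by
      intro k
      have := (Submodule.mem_orthogonal _ _).1 hv (x k) (Submodule.subset_span ⟨k, rfl⟩)
      rw [hxin] at this
      exact (mul_eq_zero.1 this).resolve_left (hs k)
    have hJv : J v = 0 := by
      have := w.hasSum_repr (J v)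
      simp only [HilbertBasis.repr_apply_apply, h0, zero_smul] at this
      exact this.unique hasSum_zero
    exact hJ (hJv.trans (map_zero J).symm)
  exact ⟨HilbertBasis.mkOfOrthogonalEqBot horth hbot, fun k v => by
    rw [HilbertBasis.coe_mkOfOrthogonalEqBot]; exact hxin k v⟩

end abstractSpectral

namespace Medium

variable {l : ℕ} {M : Medium l}

/-! ### The energy space -/

theorem norm_inv_sqrt_D_le (M : Medium l) (p : Space) :
    ‖(Real.sqrt (M.D p))⁻¹‖ ≤ (Real.sqrt M.dMin)⁻¹ := by
  rw [Real.norm_eq_abs, abs_of_nonneg (inv_nonneg.2 (Real.sqrt_nonneg _))]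
  by_cases h : p 2 ∈ Ioc (-M.H) 0
  · obtain ⟨j, hj⟩ := M.exists_layer h.1 h.2
    rw [M.D_eq hj]
    exact inv_anti₀ (Real.sqrt_pos.2 M.dMin_pos) (Real.sqrt_le_sqrt (M.dMin_le j))
  -- Outside the layers `D` vanishes, and the inverse of `0` is `0`, so the bound holds at every
  -- point.
  · have : M.D p = 0 := by
      rw [D]
      refine Finset.sum_eq_zero fun j _ => indicator_of_notMem (fun hj => h ?_) _
      exact ⟨(M.neg_H_le_z _).trans_lt hj.1, hj.2.trans (M.z_nonpos _)⟩
    rw [this, Real.sqrt_zero, inv_zero]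
    exact inv_nonneg.2 (Real.sqrt_nonneg _)

/-- Multiplication by `1/√D`. -/
def mulInvSqrtD (M : Medium l) : M.L2 →L[ℝ] M.L2 :=
  mulL2 M.measurable_D.sqrt.inv M.norm_inv_sqrt_D_le

theorem mulInvSqrtD_mulSqrtD (u : M.L2) : M.mulInvSqrtD (M.mulSqrtD u) = u := by
  refine Lp.ext ?_
  filter_upwards [coeFn_mulL2 M.measurable_D.sqrt.inv M.norm_inv_sqrt_D_le (M.mulSqrtD u),
    M.coeFn_mulSqrtD u, ae_boxMeasure_mem M.L (-M.H) 0] with p h1 h2 hp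
  have h3 : Real.sqrt (M.D p) ≠ 0 := (Real.sqrt_pos.2 (M.dMin_pos.trans_le (M.dMin_le_D hp))).ne'
  rw [mulInvSqrtD, h1, h2]
  simp only [Pi.inv_apply]
  field_simp

theorem mulSqrtD_mulInvSqrtD (u : M.L2) : M.mulSqrtD (M.mulInvSqrtD u) = u := by
  refine Lp.ext ?_
  filter_upwards [coeFn_mulL2 M.measurable_D.sqrt.inv M.norm_inv_sqrt_D_le u,
    M.coeFn_mulSqrtD (M.mulInvSqrtD u), ae_boxMeasure_mem M.L (-M.H) 0] with p h1 h2 hp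
  have h3 : Real.sqrt (M.D p) ≠ 0 := (Real.sqrt_pos.2 (M.dMin_pos.trans_le (M.dMin_le_D hp))).ne'
  rw [h2, mulInvSqrtD, h1]
  simp only [Pi.inv_apply]
  field_simp

/-- Four copies of `L²(Ω)`, for a function and its weighted gradient. -/
abbrev L2Four (M : Medium l) : Type := PiLp 2 fun _ : Fin 4 => M.L2

/-- A function together with its gradient weighted by `√D`. -/
def pack (u : M.L2) (g : Fin 3 → M.L2) : M.L2Four :=
  WithLp.toLp 2 (Fin.cons u fun i => M.mulSqrtD (g i))

theorem inner_pack (u v : M.L2) (g k : Fin 3 → M.L2) :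
    inner ℝ (pack u g) (pack v k) = inner ℝ u v + ∑ i, inner ℝ (M.mulD (g i)) (k i) := by
  rw [PiLp.inner_apply, Fin.sum_univ_succ]
  simp [pack, inner_mulSqrtD]

/-- The test functions in the energy space. -/
def packTest (M : Medium l) : Test M.L (-M.H) 0 →ₗ[ℝ] M.L2Four where
  toFun φ := pack (testL2 φ) fun i => testDeriv i φ
  map_add' φ χ := by
    ext1 i
    refine Fin.cases ?_ (fun i => ?_) i <;> simp [pack]
  map_smul' c φ := by
    ext1 i
    refine Fin.cases ?_ (fun i => ?_) i <;> simp [pack]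

/-- The Hilbert space of the pairs of a function in `𝓥` and its weighted gradient. -/
def energySpace (M : Medium l) : Submodule ℝ M.L2Four :=
  (LinearMap.range M.packTest).topologicalClosure

instance (M : Medium l) : CompleteSpace M.energySpace :=
  (Submodule.isClosed_topologicalClosure _).completeSpace_coe

theorem tendsto_pack {u : M.L2} {g : Fin 3 → M.L2} {u' : ℕ → M.L2} {g' : ℕ → Fin 3 → M.L2}
    (hu : Tendsto u' atTop (𝓝 u)) (hg : ∀ i, Tendsto (fun n => g' n i) atTop (𝓝 (g i))) :
    Tendsto (fun n => pack (u' n) (g' n)) atTop (𝓝 (pack u g)) := by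
  refine (PiLp.continuous_toLp 2 _).continuousAt.tendsto.comp ?_
  rw [tendsto_pi_nhds]
  intro i
  refine Fin.cases ?_ (fun i => ?_) i
  · simpa using hu
  · simpa [Function.comp_def] using (M.mulSqrtD.continuous.tendsto _).comp (hg i)

theorem pack_mem_energySpace {u : M.L2} {g : Fin 3 → M.L2} (h : InH10 u g) :
    pack u g ∈ M.energySpace := by
  obtain ⟨φ, hφ, hφ'⟩ := h
  exact mem_closure_of_tendsto (tendsto_pack hφ hφ') (Eventually.of_forall fun n => ⟨φ n, rfl⟩)

/-- Dividing by `√D` is continuous on `L²`, so convergence of the weighted gradients is convergence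
of the gradients. Hence the closure adds nothing beyond pairs of a function and its weighted
gradient. -/
theorem exists_eq_pack {y : M.L2Four} (hy : y ∈ M.energySpace) :
    ∃ u g, InH10 u g ∧ y = pack u g := by
  obtain ⟨x, hx, hlim⟩ := mem_closure_iff_seq_limit.1 hy
  choose φ hφ using hx
  have hc : ∀ i, Tendsto (fun n => x n i) atTop (𝓝 (y i)) := fun i =>
    ((PiLp.continuous_apply 2 (fun _ : Fin 4 => M.L2) i).tendsto y).comp hlim
  have hinv : ∀ i : Fin 3, ∀ n, M.mulInvSqrtD (x n i.succ) = testDeriv i (φ n) := fun i n => by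
    rw [← hφ n]
    exact mulInvSqrtD_mulSqrtD _
  refine ⟨y 0, fun i => M.mulInvSqrtD (y i.succ), ⟨φ, ?_, fun i => ?_⟩, ?_⟩
  · refine (hc 0).congr fun n => ?_
    rw [← hφ n]
    rfl
  · exact ((M.mulInvSqrtD.continuous.tendsto _).comp (hc i.succ)).congr fun n => hinv i n
  · ext1 i
    refine Fin.cases ?_ (fun i => ?_) i <;> simp [pack, mulSqrtD_mulInvSqrtD]

/-- The embedding of the energy space into `L²(Ω)`. -/
def embed (M : Medium l) : M.energySpace →L[ℝ] M.L2 :=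
  (PiLp.proj 2 (fun _ : Fin 4 => M.L2) (0 : Fin 4) : M.L2Four →L[ℝ] M.L2).comp
    M.energySpace.subtypeL

theorem embed_pack {u : M.L2} {g : Fin 3 → M.L2} (h : InH10 u g) :
    M.embed ⟨pack u g, pack_mem_energySpace h⟩ = u := rfl

/-- The second component is determined by the first, by uniqueness of weak derivatives. -/
theorem embed_injective (M : Medium l) : Function.Injective M.embed := by
  rw [injective_iff_map_eq_zero]
  rintro ⟨y, hy⟩ h
  obtain ⟨u, g, hug, rfl⟩ := exists_eq_pack hy
  have hu : u = 0 := h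
  have hg : g = 0 := by
    ext1 i
    have h1 := hug.hasWD M.L_pos i
    refine h1.unique M.L_pos fun φ => ?_
    simp [hu]
  ext1
  ext1 i
  refine Fin.cases ?_ (fun i => ?_) i <;> simp [pack, hu, hg]

/-- The energy product contains the `L²` product as well, so it represents `1 + 𝓛`; this is why `1 +
λ` appears below. The identity extends from test functions by density. -/
theorem inner_energy_eq_of_isWeakSolution {u f : M.L2} {g : Fin 3 → M.L2}
    (h : M.IsWeakSolution u g f) (v : M.energySpace) :
    inner ℝ (⟨pack u g, pack_mem_energySpace h.inH10⟩ : M.energySpace) v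
      = inner ℝ (u + f) (M.embed v) := by
  obtain ⟨v, hv⟩ := v
  obtain ⟨u', g', hug', rfl⟩ := exists_eq_pack hv
  rw [Submodule.coe_inner]
  simp only
  rw [embed_pack hug', inner_pack, inner_add_left]
  congr 1
  obtain ⟨φ, hφ, hφ'⟩ := hug'
  have h1 : Tendsto (fun n => ∑ i, inner ℝ (M.mulD (g i)) (testDeriv i (φ n))) atTop
      (𝓝 (∑ i, inner ℝ (M.mulD (g i)) (g' i))) :=
    tendsto_finsetSum _ fun i _ => Filter.Tendsto.inner (𝕜 := ℝ) tendsto_const_nhds (hφ' i)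
  have h2 : Tendsto (fun n => inner ℝ f (testL2 (φ n))) atTop (𝓝 (inner ℝ f u')) :=
    Filter.Tendsto.inner (𝕜 := ℝ) tendsto_const_nhds hφ
  exact tendsto_nhds_unique h1 (h2.congr fun n => (h.eq _).symm)

theorem isWeakSolution_of_inner_energy {u f : M.L2} {g : Fin 3 → M.L2} (hug : InH10 u g)
    (h : ∀ v : M.energySpace, inner ℝ (⟨pack u g, pack_mem_energySpace hug⟩ : M.energySpace) v
      = inner ℝ (u + f) (M.embed v)) : M.IsWeakSolution u g f := by
  refine ⟨hug, fun χ => ?_⟩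
  have hχ : InH10 (testL2 χ) fun i => testDeriv i χ :=
    ⟨fun _ => χ, tendsto_const_nhds, fun _ => tendsto_const_nhds⟩
  have := h ⟨_, pack_mem_energySpace hχ⟩
  rw [Submodule.coe_inner, embed_pack hχ] at this
  simp only at this
  rw [inner_pack, inner_add_left] at this
  linarith

theorem denseRange_embed (M : Medium l) : DenseRange M.embed := by
  refine (dense_range_testL2 (a := -M.H) (b := 0) M.L_pos).mono ?_
  rintro _ ⟨φ, rfl⟩
  have hφ : InH10 (testL2 φ) fun i => testDeriv i φ :=
    ⟨fun _ => φ, tendsto_const_nhds, fun _ => tendsto_const_nhds⟩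
  exact ⟨⟨_, pack_mem_energySpace hφ⟩, rfl⟩

/-! ### Expansions with respect to an eigenbasis of the medium -/

/-- The energy of a normalized eigenfunction is its eigenvalue, and the Poincaré inequality gives `1
≤ 2H ‖∂_z w‖`; this is the spectral gap. The rescaled eigenfunctions form a basis of the energy
space. -/
theorem exists_energy_basis {lam : ℕ → ℝ} {w : HilbertBasis ℕ ℝ M.L2} (h : M.IsEigenbasis lam w) :
    (∀ k, M.dMin / (4 * M.H ^ 2) ≤ lam k) ∧ ∃ e : HilbertBasis ℕ ℝ M.energySpace, ∀ k v,
      inner ℝ (e k) v = Real.sqrt (1 + lam k) * inner ℝ (w k) (M.embed v) := by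
  have hd := M.dMin_pos
  have hH := M.H_pos
  have hsol : ∀ k, ∃ g, M.IsWeakSolution (w k) g (lam k • w k) := by
    intro k
    obtain ⟨g, f, hs, hop, -⟩ := exists_isWeakSolution_of_mem_W (h k).1
    have : f = lam k • w k := by
      refine Lp.ext ?_
      filter_upwards [hop, (h k).2, Lp.coeFn_smul (lam k) (w k)] with p h1 h2 h3
      rw [← h1, h2, h3, Pi.smul_apply, smul_eq_mul]
    exact ⟨g, this ▸ hs⟩
  choose g hg using hsol
  have hlam : ∀ k, M.dMin / (4 * M.H ^ 2) ≤ lam k := by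
    intro k
    have h1 := (hg k).energy
    rw [real_inner_smul_left, real_inner_self_eq_norm_sq, w.orthonormal.1 k, one_pow, mul_one] at h1
    have h2 : M.dMin * ‖g k 2‖ ^ 2 ≤ lam k := by
      rw [← h1]
      exact (M.dMin_mul_norm_sq_le _).trans (Finset.single_le_sum
        (f := fun i => (inner ℝ (M.mulD (g k i)) (g k i) : ℝ))
        (fun i _ => (by positivity : 0 ≤ M.dMin * ‖g k i‖ ^ 2).trans (M.dMin_mul_norm_sq_le _))
        (Finset.mem_univ 2))
    have h3 := (hg k).inH10.norm_le
    rw [w.orthonormal.1 k] at h3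
    rw [div_le_iff₀ (by positivity)]
    have h4 : 1 ≤ (2 * M.H * ‖g k 2‖) ^ 2 := one_le_pow₀ h3
    nlinarith [mul_le_mul_of_nonneg_right h2 (sq_nonneg M.H)]
  refine ⟨hlam, ?_⟩
  have hpos : ∀ k, 0 < 1 + lam k := fun k => by
    have := hlam k
    have : 0 < M.dMin / (4 * M.H ^ 2) := by positivity
    linarith [hlam k]
  refine exists_hilbertBasis_of_eigen M.embed M.embed_injective w
    (fun k => ⟨pack (w k) (g k), pack_mem_energySpace (hg k).inH10⟩) (fun k => 1 + lam k) hpos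
    (fun k => rfl) fun k v => ?_
  rw [inner_energy_eq_of_isWeakSolution (hg k), inner_add_left, real_inner_smul_left]
  ring

/-- The sum `∑ λₖ^n |(u, wₖ)|²`. -/
def specSum (lam : ℕ → ℝ) (w : HilbertBasis ℕ ℝ M.L2) (n : ℕ) (u : M.L2) : ℝ≥0∞ :=
  ∑' k, ENNReal.ofReal (lam k ^ n * inner ℝ u (w k) ^ 2)

theorem summable_of_tsum_ofReal_lt_top {f : ℕ → ℝ} (hf : ∀ k, 0 ≤ f k)
    (h : ∑' k, ENNReal.ofReal (f k) < ⊤) : Summable f := by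
  have := ENNReal.summable_toReal h.ne
  simpa [ENNReal.toReal_ofReal, hf] using this

section eigen

variable {lam : ℕ → ℝ} {w : HilbertBasis ℕ ℝ M.L2}

theorem IsEigenbasis.le_lam (h : M.IsEigenbasis lam w) (k : ℕ) : M.dMin / (4 * M.H ^ 2) ≤ lam k := (exists_energy_basis h).1 k

theorem IsEigenbasis.lam_pos (h : M.IsEigenbasis lam w) (k : ℕ) : 0 < lam k :=
  lt_of_lt_of_le (div_pos M.dMin_pos (by have := M.H_pos; positivity)) (h.le_lam k)

/-- Parseval in the energy space has weights `1 + λ`; subtracting Parseval in `L²` leaves `λ`. -/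
theorem IsEigenbasis.vSq_eq (h : M.IsEigenbasis lam w) {u : M.L2} (hu : u ∈ M.V) : M.vSq u = specSum lam w 1 u := by
  obtain ⟨g, hg⟩ := mem_V_iff.1 hu
  obtain ⟨-, e, he⟩ := exists_energy_basis h
  set y : M.energySpace := ⟨pack u g, pack_mem_energySpace hg⟩ with hy
  have h1 := e.hasSum_inner_sq y
  have h2 := w.hasSum_inner_sq u
  have h3 : ‖y‖ ^ 2 = ‖u‖ ^ 2 + ∑ i, inner ℝ (M.mulD (g i)) (g i) := by
    rw [← real_inner_self_eq_norm_sq, Submodule.coe_inner, inner_pack, real_inner_self_eq_norm_sq]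
  have h4 : HasSum (fun k => lam k ^ 1 * inner ℝ u (w k) ^ 2) (∑ i, inner ℝ (M.mulD (g i)) (g i)) := by
    have h5 := h1.sub h2
    rw [h3, add_sub_cancel_left] at h5
    refine h5.congr_fun ?_ |> fun h => h
    intro k
    have : 0 ≤ 1 + lam k := by linarith [h.lam_pos k]
    rw [real_inner_comm (e k) y, he, hy, embed_pack hg, mul_pow, Real.sq_sqrt this,
      real_inner_comm u (w k)]
    ring
  rw [M.vSq_eq hg, specSum, ← h4.tsum_eq, ENNReal.ofReal_tsum_of_nonneg _ h4.summable]
  intro k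
  have := h.lam_pos k
  positivity

/-- The coefficients `√(1+λ) c` are square summable and define an element of the energy space, whose
embedding has the coefficients of `u`. -/
theorem IsEigenbasis.mem_V_of_specSum (h : M.IsEigenbasis lam w) {u : M.L2} (hu : specSum lam w 1 u < ⊤) : u ∈ M.V := by
  obtain ⟨-, e, he⟩ := exists_energy_basis h
  have hs : Summable fun k => lam k ^ 1 * inner ℝ u (w k) ^ 2 :=
    summable_of_tsum_ofReal_lt_top (fun k => by have := h.lam_pos k; positivity) hu
  have hs2 : Summable fun k => (Real.sqrt (1 + lam k) * inner ℝ u (w k)) ^ 2 := by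
    refine ((w.hasSum_inner_sq u).summable.add hs).congr fun k => ?_
    have : 0 ≤ 1 + lam k := by linarith [h.lam_pos k]
    rw [mul_pow, Real.sq_sqrt this]
    ring
  obtain ⟨y, hy⟩ := e.exists_of_summable_sq hs2
  obtain ⟨u', g, hug, hpack⟩ := exists_eq_pack y.2
  have hu' : M.embed y = u' := by
    have : y = ⟨pack u' g, pack_mem_energySpace hug⟩ := Subtype.ext hpack
    rw [this, embed_pack hug]
  have : u' = u := by
    refine w.repr.injective ?_
    ext k
    rw [w.repr_apply_apply, w.repr_apply_apply]
    have h1 := hy k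
    rw [real_inner_comm, he, hu'] at h1
    have h2 : Real.sqrt (1 + lam k) ≠ 0 :=
      (Real.sqrt_pos.2 (by linarith [h.lam_pos k])).ne'
    rw [mul_left_cancel₀ h2 h1, real_inner_comm]
  rw [← this]
  exact mem_V_iff.2 ⟨g, hug⟩

/-- Symmetry of the energy form gives `⟨f, w k⟩ = λ ⟨u, w k⟩`. -/
theorem IsEigenbasis.norm_sq_eq (h : M.IsEigenbasis lam w) {u f : M.L2} {g : Fin 3 → M.L2} (hs : M.IsWeakSolution u g f) :
    ENNReal.ofReal (‖f‖ ^ 2) = specSum lam w 2 u := by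
  obtain ⟨-, e, he⟩ := exists_energy_basis h
  have hf : ∀ k, inner ℝ f (w k) = lam k * inner ℝ u (w k) := by
    intro k
    obtain ⟨g', f', hs', hop, -⟩ := exists_isWeakSolution_of_mem_W (h k).1
    have hf' : f' = lam k • w k := by
      refine Lp.ext ?_
      filter_upwards [hop, (h k).2, Lp.coeFn_smul (lam k) (w k)] with p h1 h2 h3
      rw [← h1, h2, h3, Pi.smul_apply, smul_eq_mul]
    have h1 := inner_energy_eq_of_isWeakSolution hs ⟨_, pack_mem_energySpace hs'.inH10⟩
    have h2 := inner_energy_eq_of_isWeakSolution hs' ⟨_, pack_mem_energySpace hs.inH10⟩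
    rw [real_inner_comm, h2, embed_pack hs.inH10, embed_pack hs'.inH10, hf', inner_add_left, inner_add_left,
      real_inner_smul_left, real_inner_comm] at h1
    linarith [real_inner_comm u (w k)]
  have h1 := w.hasSum_inner_sq f
  rw [specSum, ← h1.tsum_eq, ENNReal.ofReal_tsum_of_nonneg (fun k => sq_nonneg _) h1.summable]
  refine tsum_congr fun k => ?_
  rw [hf, mul_pow]

theorem IsEigenbasis.specSum_one_lt_top (h : M.IsEigenbasis lam w) {u : M.L2} (hu : specSum lam w 2 u < ⊤) :
    specSum lam w 1 u < ⊤ := by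
  set c := M.dMin / (4 * M.H ^ 2) with hc
  have hc0 : 0 < c := div_pos M.dMin_pos (by have := M.H_pos; positivity)
  have hle : specSum lam w 1 u ≤ ENNReal.ofReal c⁻¹ * specSum lam w 2 u := by
    rw [specSum, specSum, ← ENNReal.tsum_mul_left]
    refine ENNReal.tsum_le_tsum fun k => ?_
    rw [← ENNReal.ofReal_mul (by positivity)]
    refine ENNReal.ofReal_le_ofReal ?_
    rw [← mul_assoc]
    refine mul_le_mul_of_nonneg_right ?_ (sq_nonneg _)
    rw [pow_one, le_inv_mul_iff₀ hc0, sq]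
    exact mul_le_mul_of_nonneg_right (h.le_lam k) (h.lam_pos k).le
  exact hle.trans_lt (ENNReal.mul_lt_top ENNReal.ofReal_lt_top hu)

/-- The right-hand side is defined by its coefficients `λ c`; the weak equation is checked by
comparing the two Parseval expansions term by term. -/
theorem IsEigenbasis.exists_isWeakSolution (h : M.IsEigenbasis lam w) {u : M.L2} (hu : specSum lam w 2 u < ⊤) :
    ∃ g f, M.IsWeakSolution u g f := by
  obtain ⟨g, hug⟩ := mem_V_iff.1 (h.mem_V_of_specSum (h.specSum_one_lt_top hu))
  obtain ⟨-, e, he⟩ := exists_energy_basis h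
  have hs : Summable fun k => (lam k * inner ℝ u (w k)) ^ 2 := by
    have := summable_of_tsum_ofReal_lt_top (fun k => by have := h.lam_pos k; positivity) hu
    simpa [mul_pow] using this
  obtain ⟨f, hf⟩ := w.exists_of_summable_sq hs
  refine ⟨g, f, isWeakSolution_of_inner_energy hug fun v => ?_⟩
  set y : M.energySpace := ⟨pack u g, pack_mem_energySpace hug⟩ with hy
  have h1 := e.hasSum_inner_mul_inner y v
  have h2 := w.hasSum_inner_mul_inner (u + f) (M.embed v)
  refine h1.unique (h2.congr_fun ?_ |> fun h => h)
  intro k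
  have : 0 ≤ 1 + lam k := by linarith [h.lam_pos k]
  rw [real_inner_comm (e k) y, he, he, inner_add_left, hf, hy, embed_pack hug,
    real_inner_comm u (w k)]
  linear_combination (inner ℝ u (w k) * inner ℝ (w k) (M.embed v)) * Real.mul_self_sqrt this

end eigen

end Medium

end Layered

end

noncomputable section

namespace Layered

variable {L a b : ℝ}

/-! ### Integrals of differences -/

/-- Tonelli in the variables `p` and `h`: for fixed `h`, the points with `p` and `p + h` both at
heights in the slab form the box in the definition of `shiftSq`. -/
theorem lintegral_box_shift (L a b : ℝ) {g : Space → ℝ} (hg : Measurable g) {κ : Space → ℝ≥0∞}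
    (hκ : Measurable κ) :
    ∫⁻ p in box L a b, ∫⁻ h, {h : Space | (p + h) 2 ∈ Ioo a b}.indicator
        (fun h => κ h * ‖g (p + h) - g p‖ₑ ^ 2) h = ∫⁻ h, κ h * shiftSq L a b g h := by
  have hset : MeasurableSet {x : Space × Space | (x.1 + x.2) 2 ∈ Ioo a b} :=
    ((measurable_coord 2).comp (measurable_fst.add measurable_snd)) measurableSet_Ioo
  have hm : Measurable (Function.uncurry fun p h : Space => {h : Space | (p + h) 2 ∈ Ioo a b}.indicator
      (fun h => κ h * ‖g (p + h) - g p‖ₑ ^ 2) h) := by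
    have h1 : Measurable fun x : Space × Space => κ x.2 * ‖g (x.1 + x.2) - g x.1‖ₑ ^ 2 := by
      fun_prop
    exact h1.indicator hset
  rw [lintegral_lintegral_swap hm.aemeasurable]
  refine lintegral_congr fun h => ?_
  have hmeas : MeasurableSet {p : Space | (p + h) 2 ∈ Ioo a b} :=
    ((measurable_coord 2).comp (measurable_id.add_const h)) measurableSet_Ioo
  have hbox : {p : Space | (p + h) 2 ∈ Ioo a b} ∩ box L a b
      = box L (max a (a - h 2)) (min b (b - h 2)) := by
    ext p
    simp only [box, mem_inter_iff, mem_ofPred_eq, PiLp.add_apply, mem_Ioo, max_lt_iff, lt_min_iff,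
      sub_lt_iff_lt_add, lt_sub_iff_add_lt]
    tauto
  rw [shiftSq, l2Sq, ← lintegral_const_mul _ (by fun_prop), ← hbox, ← setLIntegral_indicator hmeas]
  rfl

theorem sq_lintegral_le {X : Type*} [MeasurableSpace X] (μ : Measure X) {F : X → ℝ≥0∞}
    (hF : AEMeasurable F μ) : (∫⁻ x, F x ∂μ) ^ 2 ≤ μ univ * ∫⁻ x, F x ^ 2 ∂μ := by
  have h := ENNReal.lintegral_mul_le_Lp_mul_Lq μ Real.HolderConjugate.two_two
    (aemeasurable_const (b := (1 : ℝ≥0∞))) hF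
  simp only [Pi.mul_apply, one_mul, ENNReal.one_rpow, lintegral_one] at h
  calc (∫⁻ x, F x ∂μ) ^ 2 ≤ (μ univ ^ (1 / 2 : ℝ) * (∫⁻ x, F x ^ (2 : ℝ) ∂μ) ^ (1 / 2 : ℝ)) ^ 2 := by
        gcongr
    _ = μ univ * ∫⁻ x, F x ^ 2 ∂μ := by
        rw [mul_pow]
        simp only [← ENNReal.rpow_natCast, ← ENNReal.rpow_mul]
        norm_num

theorem enorm_sub_average_sq_le {X : Type*} [MeasurableSpace X] (μ : Measure X) [IsFiniteMeasure μ]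
    (hμ : μ univ ≠ 0) {u : X → ℝ} (hu : Integrable u μ) (y : ℝ) :
    ‖y - ⨍ q, u q ∂μ‖ₑ ^ 2 ≤ (μ univ)⁻¹ * ∫⁻ q, ‖y - u q‖ₑ ^ 2 ∂μ := by
  have : NeZero μ := ⟨fun h => hμ (by simp [h])⟩
  have h1 : y - ⨍ q, u q ∂μ = (μ.real univ)⁻¹ * ∫ q, (y - u q) ∂μ := by
    have h0 : μ.real univ ≠ 0 := by simp [measureReal_def, ENNReal.toReal_eq_zero_iff, hμ]
    rw [average_eq, integral_sub (integrable_const _) hu, integral_const, smul_eq_mul, smul_eq_mul]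
    field_simp
  have h2 : ‖(μ.real univ)⁻¹‖ₑ = (μ univ)⁻¹ := by
    have h0 : 0 < μ.real univ := by
      rw [measureReal_def]; exact ENNReal.toReal_pos hμ (measure_ne_top _ _)
    rw [Real.enorm_of_nonneg (inv_nonneg.2 h0.le), ENNReal.ofReal_inv_of_pos h0,
      ofReal_measureReal]
  rw [h1, enorm_mul, h2, mul_pow]
  calc (μ univ)⁻¹ ^ 2 * ‖∫ q, (y - u q) ∂μ‖ₑ ^ 2
      ≤ (μ univ)⁻¹ ^ 2 * (μ univ * ∫⁻ q, ‖y - u q‖ₑ ^ 2 ∂μ) := by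
        gcongr
        refine (pow_le_pow_left' (enorm_integral_le_lintegral_enorm _) 2).trans
          (sq_lintegral_le μ ?_)
        exact (aestronglyMeasurable_const.sub hu.aestronglyMeasurable).enorm
    _ = (μ univ)⁻¹ * ∫⁻ q, ‖y - u q‖ₑ ^ 2 ∂μ := by
        rw [sq, mul_assoc, ← mul_assoc (μ univ)⁻¹ (μ univ),
          ENNReal.inv_mul_cancel hμ (measure_ne_top _ _), one_mul]

/-- Approximation in `L²` by a function that is constant on the parts of a finite partition. -/
theorem exists_mem_span_indicator {ι : Type*} [MeasurableSpace ι] [MeasurableSingletonClass ι]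
    {c : Space → ι} (hc : Measurable c) (T : Finset ι) (hT : ∀ p ∈ box L a b, c p ∈ T)
    {v : ℝ≥0∞} (hv : v ≠ 0) (hvT : ∀ k ∈ T, v ≤ boxMeasure L a b (c ⁻¹' {k})) (u : BoxL2 L a b) :
    ∃ x ∈ Submodule.span ℝ (range fun k : T => (indicatorConstLp 2
        (hc (measurableSet_singleton (k : ι))) (measure_ne_top (boxMeasure L a b) _) (1 : ℝ))),
      ENNReal.ofReal (‖u - x‖ ^ 2) ≤ v⁻¹ * ∫⁻ p in box L a b,
        ∫⁻ q in c ⁻¹' {c p}, ‖u p - u q‖ₑ ^ 2 ∂(boxMeasure L a b) := by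
  classical
  set μ := boxMeasure L a b with hμ
  set χ : ι → BoxL2 L a b := fun k => indicatorConstLp 2
    (hc (measurableSet_singleton k)) (measure_ne_top μ _) (1 : ℝ) with hχ
  set m : ι → ℝ := fun k => ⨍ q in c ⁻¹' {k}, u q ∂μ with hm
  refine ⟨∑ k : T, m k • χ k, Submodule.sum_mem _ fun k _ => Submodule.smul_mem _ _
    (Submodule.subset_span ⟨k, rfl⟩), ?_⟩
  have hx : (∑ k : T, m k • χ k : BoxL2 L a b) =ᵐ[μ] fun p => m (c p) := by
    have h1 : ∀ᵐ p ∂μ, ∀ k : T, (m k • χ k : BoxL2 L a b) p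
        = m k * (c ⁻¹' {(k : ι)}).indicator (fun _ => (1 : ℝ)) p := by
      rw [ae_all_iff]
      intro k
      filter_upwards [Lp.coeFn_smul (m k) (χ k), indicatorConstLp_coeFn (p := 2)
        (hs := hc (measurableSet_singleton (k : ι))) (hμs := measure_ne_top μ _) (c := (1 : ℝ))]
        with p h1 h2
      rw [h1, Pi.smul_apply, smul_eq_mul, hχ, h2]
    filter_upwards [Lp.coeFn_finsetSum (Finset.univ : Finset T) (fun k : T => m k • χ k), h1,
      ae_boxMeasure_mem L a b] with p h2 h1 hp
    rw [h2, Finset.sum_apply, Finset.sum_congr rfl fun k _ => h1 k,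
      Finset.sum_eq_single ⟨c p, hT p hp⟩]
    · simp
    · intro k _ hk
      rw [indicator_of_notMem, mul_zero]
      intro h
      exact hk (Subtype.ext (by simpa using h.symm))
    · simp
  have hux : (u - ∑ k : T, m k • χ k : BoxL2 L a b) =ᵐ[μ] fun p => u p - m (c p) := by
    filter_upwards [hx, Lp.coeFn_sub u (∑ k : T, m k • χ k)] with p h1 h2
    rw [h2, Pi.sub_apply, h1]
  rw [← l2Sq_eq_of_ae_eq hux, l2Sq]
  calc ∫⁻ p in box L a b, ‖u p - m (c p)‖ₑ ^ 2
      ≤ ∫⁻ p in box L a b, v⁻¹ * ∫⁻ q in c ⁻¹' {c p}, ‖u p - u q‖ₑ ^ 2 ∂μ := by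
        refine lintegral_mono_ae ?_
        filter_upwards [ae_boxMeasure_mem L a b] with p hp
        have h1 := hvT _ (hT p hp)
        have h2 : (μ.restrict (c ⁻¹' {c p})) univ ≠ 0 := by
          rw [Measure.restrict_apply_univ]
          exact fun h => hv (le_antisymm (h ▸ h1) bot_le)
        have h3 : Integrable u μ := Lp.memLp u |>.integrable (by norm_num)
        refine (enorm_sub_average_sq_le _ h2 h3.integrableOn (u p)).trans ?_
        gcongr
        rwa [Measure.restrict_apply_univ]
    _ ≤ _ := by
        rw [lintegral_const_mul' _ _ (ENNReal.inv_ne_top.2 hv)]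

/-- A horizontally periodic measurable representative. -/
theorem exists_periodic_rep (hL : 0 < L) (u : BoxL2 L a b) :
    ∃ g : Space → ℝ, Measurable g ∧ HPeriodic L g ∧ u =ᵐ[boxMeasure L a b] g := by
  obtain ⟨f, hf, hfu⟩ := Lp.aestronglyMeasurable u
  refine ⟨periodize L f, measurable_periodize L hf.measurable, periodize_hperiodic hL f, ?_⟩
  filter_upwards [hfu, ae_boxMeasure_mem L a b] with p h1 hp
  rw [h1, periodize_of_mem_box f hp]

theorem norm_sum_smul_sq_le (h : Space) (k : Fin 3 → BoxL2 L a b) :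
    ‖∑ i, h i • k i‖ ^ 2 ≤ ‖h‖ ^ 2 * ∑ i, ‖k i‖ ^ 2 := by
  calc ‖∑ i, h i • k i‖ ^ 2 ≤ (∑ i, ‖h i‖ * ‖k i‖) ^ 2 := by
        gcongr
        exact (norm_sum_le _ _).trans (Finset.sum_le_sum fun i _ => (norm_smul _ _).le)
    _ ≤ (∑ i, ‖h i‖ ^ 2) * ∑ i, ‖k i‖ ^ 2 := Finset.sum_mul_sq_le_sq_mul_sq _ _ _
    _ = ‖h‖ ^ 2 * ∑ i, ‖k i‖ ^ 2 := by rw [EuclideanSpace.norm_sq_eq]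

theorem shiftSq_le_norm (hL : 0 < L) {g : Space → ℝ} (hg : Measurable g)
    (hp : HPeriodic L g) {u : BoxL2 L a b} (hu : u =ᵐ[boxMeasure L a b] g)
    {k : Fin 3 → BoxL2 L a b} (hk : ∀ i, HasWD i u (k i)) (h : Space) :
    shiftSq L a b g h ≤ ENNReal.ofReal (‖h‖ ^ 2 * ∑ i, ‖k i‖ ^ 2) :=
  (shiftSq_le hL hg hp hu hk h).trans (ENNReal.ofReal_le_ofReal (norm_sum_smul_sq_le h k))

/-! ### The grid of a box -/

/-- The lower corner of the box. -/
def gridCorner (a : ℝ) (i : Fin 3) : ℝ := if i = 2 then a else 0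

/-- The side lengths of the box. -/
def gridSide (L a b : ℝ) (i : Fin 3) : ℝ := if i = 2 then b - a else L

/-- The position in the grid with `N³` cells. -/
def gridIndex (L a b : ℝ) (N : ℕ) (p : Space) (i : Fin 3) : ℤ :=
  ⌊N * (p i - gridCorner a i) / gridSide L a b i⌋

theorem gridSide_pos (hL : 0 < L) (hab : a < b) (i : Fin 3) : 0 < gridSide L a b i := by
  rw [gridSide]; split_ifs <;> linarith

theorem mem_box_iff_grid {p : Space} : p ∈ box L a b ↔
    ∀ i, p i ∈ Ioo (gridCorner a i) (gridCorner a i + gridSide L a b i) := by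
  rw [Fin.forall_fin_succ, Fin.forall_fin_succ, Fin.forall_fin_one]
  simp [box, gridCorner, gridSide]

theorem measurable_gridIndex (L a b : ℝ) (N : ℕ) : Measurable (gridIndex L a b N) := by
  refine measurable_pi_lambda _ fun i => ?_
  unfold gridIndex
  fun_prop

theorem gridIndex_mem (hL : 0 < L) (hab : a < b) {N : ℕ} (hN : 0 < N) {p : Space}
    (hp : p ∈ box L a b) :
    gridIndex L a b N p ∈ Fintype.piFinset fun _ : Fin 3 => Finset.Ico (0 : ℤ) N := by
  rw [Fintype.mem_piFinset]
  intro i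
  have h1 := mem_box_iff_grid.1 hp i
  have h2 := gridSide_pos hL hab i
  have hN' : (0 : ℝ) < N := by exact_mod_cast hN
  rw [Finset.mem_Ico, gridIndex, Int.floor_nonneg, Int.floor_lt]
  constructor
  · exact div_nonneg (mul_nonneg hN'.le (by linarith [h1.1])) h2.le
  · rw [div_lt_iff₀ h2]
    push_cast
    exact mul_lt_mul_of_pos_left (by linarith [h1.2]) hN'

theorem norm_sub_le_of_gridIndex_eq (hL : 0 < L) (hab : a < b) {N : ℕ} (hN : 0 < N) {p q : Space}
    (h : gridIndex L a b N p = gridIndex L a b N q) :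
    ‖p - q‖ ≤ (∑ i, gridSide L a b i) / N := by
  have hN' : (0 : ℝ) < N := by exact_mod_cast hN
  rw [space_eq_sum (p - q), Finset.sum_div]
  refine (norm_sum_le _ _).trans (Finset.sum_le_sum fun i _ => ?_)
  have h2 := gridSide_pos hL hab i
  have h3 := Int.abs_sub_lt_one_of_floor_eq_floor (congrFun h i)
  rw [norm_smul, unitVec, PiLp.norm_single, norm_one, mul_one, PiLp.sub_apply,
    Real.norm_eq_abs, le_div_iff₀ hN']
  rw [← sub_div, ← mul_sub, sub_sub_sub_cancel_right, abs_div, abs_mul, abs_of_pos hN',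
    abs_of_pos h2, div_lt_one h2] at h3
  linarith

theorem le_boxMeasure_gridIndex (hL : 0 < L) (hab : a < b) {N : ℕ} (hN : 0 < N) {k : Fin 3 → ℤ}
    (hk : k ∈ Fintype.piFinset fun _ : Fin 3 => Finset.Ico (0 : ℤ) N) :
    ENNReal.ofReal ((∏ i, gridSide L a b i) / N ^ 3)
      ≤ boxMeasure L a b (gridIndex L a b N ⁻¹' {k}) := by
  have hN' : (0 : ℝ) < N := by exact_mod_cast hN
  set lo : Fin 3 → ℝ := fun i => gridCorner a i + k i * gridSide L a b i / N with hlo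
  set hi : Fin 3 → ℝ := fun i => gridCorner a i + (k i + 1) * gridSide L a b i / N with hhi
  have hvol : volume (WithLp.ofLp ⁻¹' (Set.univ.pi fun i => Ioo (lo i) (hi i)) : Set Space)
      = ENNReal.ofReal ((∏ i, gridSide L a b i) / N ^ 3) := by
    rw [(PiLp.volume_preserving_ofLp (Fin 3)).measure_preimage
      (MeasurableSet.univ_pi fun i => measurableSet_Ioo).nullMeasurableSet, Real.volume_pi_Ioo,
      ← ENNReal.ofReal_prod_of_nonneg]
    · congr 1
      rw [Fin.prod_univ_three, Fin.prod_univ_three, hlo, hhi]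
      field_simp
      ring
    · intro i _
      have h2 := gridSide_pos hL hab i
      have : hi i - lo i = gridSide L a b i / N := by
        rw [hlo, hhi]; ring
      rw [this]
      positivity
  rw [← hvol, Measure.restrict_apply (measurable_gridIndex L a b N (measurableSet_singleton k))]
  refine measure_mono fun p hp => ?_
  have hp' : ∀ i, lo i < p i ∧ p i < hi i := fun i => hp i (mem_univ i)
  rw [Fintype.mem_piFinset] at hk
  refine ⟨?_, mem_box_iff_grid.2 fun i => ?_⟩
  · rw [mem_preimage, mem_singleton_iff]
    ext i
    have h2 := gridSide_pos hL hab i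
    obtain ⟨h3, h4⟩ := hp' i
    rw [gridIndex, Int.floor_eq_iff, le_div_iff₀ h2, div_lt_iff₀ h2]
    simp only [hlo, hhi, ← lt_sub_iff_add_lt', ← sub_lt_iff_lt_add', div_lt_iff₀ hN', lt_div_iff₀ hN'] at h3 h4
    constructor <;> linarith
  · have h2 := gridSide_pos hL hab i
    obtain ⟨h3, h4⟩ := hp' i
    obtain ⟨h5, h6⟩ := Finset.mem_Ico.1 (hk i)
    have h5' : (0 : ℝ) ≤ k i := by exact_mod_cast h5
    have h6' : (k i : ℝ) + 1 ≤ N := by exact_mod_cast h6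
    constructor
    · refine lt_of_le_of_lt ?_ h3
      rw [hlo]
      have : 0 ≤ k i * gridSide L a b i / N := by positivity
      linarith
    · refine lt_of_lt_of_le h4 ?_
      rw [hhi]
      have : (k i + 1) * gridSide L a b i / N ≤ gridSide L a b i := by
        rw [div_le_iff₀ hN', mul_comm]
        exact mul_le_mul_of_nonneg_left h6' h2.le
      linarith

/-! ### Compactness -/

/-- Points with the same label differ by at most `ρ`. The translation estimate contributes `ρ²` and
the ball of displacements `ρ³`. -/
theorem lintegral_fiber_le (hL : 0 < L) {u : BoxL2 L a b} {k : Fin 3 → BoxL2 L a b}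
    (hk : ∀ i, HasWD i u (k i)) {ι : Type*} [MeasurableSpace ι] [MeasurableSingletonClass ι]
    {c : Space → ι} (hc : Measurable c) {ρ : ℝ} (hρ : 0 ≤ ρ)
    (hcρ : ∀ p q, c p = c q → ‖p - q‖ ≤ ρ) :
    ∫⁻ p in box L a b, ∫⁻ q in c ⁻¹' {c p}, ‖u p - u q‖ₑ ^ 2 ∂(boxMeasure L a b)
      ≤ ENNReal.ofReal (ρ ^ 5 * ∑ i, ‖k i‖ ^ 2) * volume (Metric.ball (0 : Space) 1) := by
  obtain ⟨g, hg, hgp, hug⟩ := exists_periodic_rep hL u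
  set κ : Space → ℝ≥0∞ := (Metric.closedBall (0 : Space) ρ).indicator 1 with hκ
  have hκm : Measurable κ := measurable_one.indicator Metric.isClosed_closedBall.measurableSet
  calc ∫⁻ p in box L a b, ∫⁻ q in c ⁻¹' {c p}, ‖u p - u q‖ₑ ^ 2 ∂(boxMeasure L a b)
      ≤ ∫⁻ p in box L a b, ∫⁻ h, {h : Space | (p + h) 2 ∈ Ioo a b}.indicator
        (fun h => κ h * ‖g (p + h) - g p‖ₑ ^ 2) h := by
        refine lintegral_mono_ae ?_
        filter_upwards [hug] with p hp
        have hA : MeasurableSet (c ⁻¹' {c p}) := hc (measurableSet_singleton _)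
        have h1 : ∫⁻ q in c ⁻¹' {c p}, ‖u p - u q‖ₑ ^ 2 ∂(boxMeasure L a b)
            = ∫⁻ q, (c ⁻¹' {c p} ∩ box L a b).indicator (fun q => ‖g p - g q‖ₑ ^ 2) q := by
          rw [lintegral_indicator (hA.inter (measurableSet_box L a b)),
            ← Measure.restrict_restrict hA]
          refine lintegral_congr_ae (ae_restrict_of_ae ?_)
          filter_upwards [hug] with q hq
          rw [hp, hq]
        rw [h1, ← lintegral_add_left_eq_self _ p]
        refine lintegral_mono fun h => ?_
        by_cases hh : p + h ∈ c ⁻¹' {c p} ∩ box L a b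
        · have h2 : h ∈ Metric.closedBall (0 : Space) ρ := by
            rw [mem_closedBall_zero_iff]
            simpa using hcρ (p + h) p hh.1
          have h3 : h ∈ {h : Space | (p + h) 2 ∈ Ioo a b} := hh.2.2.2
          rw [indicator_of_mem hh, indicator_of_mem h3, hκ, indicator_of_mem h2, Pi.one_apply,
            one_mul, enorm_sub_rev]
        · rw [indicator_of_notMem hh]
          exact bot_le
    _ = ∫⁻ h, κ h * shiftSq L a b g h := lintegral_box_shift L a b hg hκm
    _ ≤ ∫⁻ h, (Metric.closedBall (0 : Space) ρ).indicator
          (fun _ => ENNReal.ofReal (ρ ^ 2 * ∑ i, ‖k i‖ ^ 2)) h := by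
        refine lintegral_mono fun h => ?_
        by_cases hh : h ∈ Metric.closedBall (0 : Space) ρ
        · rw [hκ, indicator_of_mem hh, indicator_of_mem hh, Pi.one_apply, one_mul]
          refine (shiftSq_le_norm hL hg hgp hug hk h).trans (ENNReal.ofReal_le_ofReal ?_)
          rw [mem_closedBall_zero_iff] at hh
          gcongr
        · rw [hκ, indicator_of_notMem hh, indicator_of_notMem hh, zero_mul]
    _ = _ := by
        rw [lintegral_indicator_const Metric.isClosed_closedBall.measurableSet,
          Measure.addHaar_closedBall _ _ hρ, ← mul_assoc, ← ENNReal.ofReal_mul (by positivity)]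
        simp only [finrank_euclideanSpace, Fintype.card_fin]
        ring_nf

/-- The approximation is the average over each of the `N³` cells. Cells of volume `Q / N³` and
diameter at most `R / N` give the error factor `(N³ / Q)(R / N)⁵`, of order `N⁻²`. -/
theorem exists_finite_dimensional_approx (hL : 0 < L) (hab : a < b) {ε : ℝ} (hε : 0 < ε) :
    ∃ K : Submodule ℝ (BoxL2 L a b), FiniteDimensional ℝ K ∧
      ∀ (u : BoxL2 L a b) (k : Fin 3 → BoxL2 L a b), (∀ i, HasWD i u (k i)) →
        ∃ x ∈ K, ‖u - x‖ ^ 2 ≤ ε * ∑ i, ‖k i‖ ^ 2 := by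
  set R := ∑ i, gridSide L a b i with hR
  set Q := ∏ i, gridSide L a b i with hQ
  have hR0 : 0 < R := Finset.sum_pos (fun i _ => gridSide_pos hL hab i) Finset.univ_nonempty
  have hQ0 : 0 < Q := Finset.prod_pos fun i _ => gridSide_pos hL hab i
  set B := (volume (Metric.ball (0 : Space) 1)).toReal with hB
  have hBv : volume (Metric.ball (0 : Space) 1) = ENNReal.ofReal B :=
    (ENNReal.ofReal_toReal measure_ball_lt_top.ne).symm
  have hB0 : 0 ≤ B := ENNReal.toReal_nonneg
  obtain ⟨N, hN⟩ := exists_nat_gt (max 1 (R ^ 5 * B / Q / ε))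
  have hN1 : (1 : ℝ) < N := (le_max_left _ _).trans_lt hN
  have hN0 : (0 : ℝ) < N := by linarith
  have hNn : 0 < N := by exact_mod_cast hN0
  have hN2 : R ^ 5 * B / Q / ε < N := (le_max_right _ _).trans_lt hN
  have hc := measurable_gridIndex L a b N
  refine ⟨_, FiniteDimensional.span_of_finite ℝ (finite_range fun k : Fintype.piFinset fun _ : Fin 3 =>
    Finset.Ico (0 : ℤ) N => (indicatorConstLp 2 (hc (measurableSet_singleton (k : Fin 3 → ℤ)))
      (measure_ne_top (boxMeasure L a b) _) (1 : ℝ))), fun u k hk => ?_⟩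
  have hv0 : 0 < Q / N ^ 3 := by positivity
  obtain ⟨x, hx, hle⟩ := exists_mem_span_indicator hc _ (fun p hp => gridIndex_mem hL hab hNn hp)
    (ENNReal.ofReal_pos.2 hv0).ne' (fun k hk => le_boxMeasure_gridIndex hL hab hNn hk) u
  refine ⟨x, hx, ?_⟩
  have h1 := hle.trans (mul_le_mul_right (lintegral_fiber_le hL hk hc (ρ := R / N) (by positivity)
    fun p q h => norm_sub_le_of_gridIndex_eq hL hab hNn h) _)
  rw [hBv, ← ENNReal.ofReal_mul (by positivity), ← ENNReal.ofReal_inv_of_pos hv0,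
    ← ENNReal.ofReal_mul (by positivity), ENNReal.ofReal_le_ofReal_iff (by positivity)] at h1
  refine h1.trans ?_
  have h2 : (Q / N ^ 3)⁻¹ * ((R / N) ^ 5 * (∑ i, ‖k i‖ ^ 2) * B)
      = (R ^ 5 * B / Q) / N ^ 2 * ∑ i, ‖k i‖ ^ 2 := by
    field_simp
  rw [h2]
  refine mul_le_mul_of_nonneg_right ?_ (Finset.sum_nonneg fun i _ => sq_nonneg _)
  rw [div_lt_iff₀ hε] at hN2
  rw [div_le_iff₀ (by positivity)]
  nlinarith [mul_pos hε hN0]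

/-- Orthogonal projection onto `K` does at least as well as the given approximant, so `J` is an
operator-norm limit of finite-rank operators. -/
theorem isCompactOperator_of_finite_dimensional_approx {Y E : Type*} [NormedAddCommGroup Y]
    [InnerProductSpace ℝ Y] [NormedAddCommGroup E] [InnerProductSpace ℝ E] [CompleteSpace E]
    (J : Y →L[ℝ] E) (h : ∀ ε : ℝ, 0 < ε → ∃ K : Submodule ℝ E, FiniteDimensional ℝ K ∧
      ∀ y, ∃ x ∈ K, ‖J y - x‖ ≤ ε * ‖y‖) : IsCompactOperator J := by
  have key : J ∈ closure {T : Y →L[ℝ] E | IsCompactOperator T} := by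
    rw [Metric.mem_closure_iff]
    intro ε hε
    obtain ⟨K, hK, hy⟩ := h (ε / 2) (half_pos hε)
    refine ⟨K.starProjection.comp J, ?_, ?_⟩
    · exact ((isCompactOperator_of_locallyCompactSpace_rng K.subtypeL).comp_clm
        K.orthogonalProjectionOnto).comp_clm J
    · rw [dist_eq_norm]
      refine lt_of_le_of_lt (ContinuousLinearMap.opNorm_le_bound _ (half_pos hε).le fun y => ?_)
        (half_lt_self hε)
      obtain ⟨x, hx, hxy⟩ := hy y
      refine le_trans ?_ hxy
      rw [sub_apply, ContinuousLinearMap.comp_apply,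
        Submodule.starProjection_minimal]
      exact ciInf_le ⟨0, forall_mem_range.2 fun _ => norm_nonneg _⟩ (⟨x, hx⟩ : K)
  rw [IsClosed.closure_eq] at key
  · exact key
  · exact isClosed_setOfPred_isCompactOperator

end Layered

end

noncomputable section

namespace Layered

/-! ### Compact positive operators -/

/-- The indices are ordered by decreasing `μ`, ties being broken by an enumeration. Initial segments
are finite, so the order type is that of `ℕ`. -/
theorem exists_equiv_nat_antitone {ι : Type*} [Infinite ι] (μ : ι → ℝ) (hpos : ∀ i, 0 < μ i)
    (hfin : ∀ ε : ℝ, 0 < ε → {i | ε ≤ μ i}.Finite) : ∃ e : ℕ ≃ ι, Antitone (μ ∘ e) := by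
  have hcount : Countable ι := by
    have h1 : (⋃ n : ℕ, {i | 1 / ((n : ℝ) + 1) ≤ μ i}) = univ := by
      refine eq_univ_of_forall fun i => mem_iUnion.2 ?_
      obtain ⟨n, hn⟩ := exists_nat_one_div_lt (hpos i)
      exact ⟨n, hn.le⟩
    rw [← countable_univ_iff, ← h1]
    exact countable_iUnion fun n => (hfin _ (by positivity)).countable
  obtain ⟨enc, henc⟩ := exists_injective_nat ι
  set key : ι → ℝᵒᵈ ×ₗ ℕ := fun i => toLex (OrderDual.toDual (μ i), enc i) with hkey
  have hinj : Function.Injective key := fun i j h => henc (congrArg (fun x => (ofLex x).2) h)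
  let : LinearOrder ι := LinearOrder.lift' key hinj
  have hle : ∀ i j : ι, i ≤ j → μ j ≤ μ i := by
    intro i j h
    have h' : key i ≤ key j := h
    rcases Prod.Lex.le_iff.1 h' with h1 | h1
    · exact (show μ j < μ i from h1).le
    · exact (show μ i = μ j from congrArg OrderDual.ofDual h1.1).ge
  have hIic : ∀ i : ι, (Iic i).Finite := fun i =>
    (hfin (μ i) (hpos i)).subset fun j hj => hle j i hj
  let : LocallyFiniteOrder ι :=
    LocallyFiniteOrder.ofFiniteIcc fun a b => (hIic b).subset fun x hx => hx.2
  obtain ⟨i₀⟩ : Nonempty ι := inferInstance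
  obtain ⟨m, hm, hmin⟩ := (hIic i₀).exists_minimalFor id _ ⟨i₀, le_refl i₀⟩
  have hbot : ∀ x, m ≤ x := fun x => by
    rcases le_total m x with h | h
    · exact h
    · exact hmin (h.trans hm) h
  let _ : OrderBot ι := { bot := m, bot_le := hbot }
  have : NoMaxOrder ι := ⟨fun i => by
    by_contra! h
    exact infinite_univ ((hIic i).subset fun j _ => h j)⟩
  let _ : SuccOrder ι := LinearLocallyFiniteOrder.succOrder ι
  let _ : PredOrder ι := LinearLocallyFiniteOrder.predOrder ι
  let e : ι ≃o ℕ := orderIsoNatOfLinearSuccPredArch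
  exact ⟨e.symm.toEquiv, fun k k' h => hle _ _ (e.symm.monotone h)⟩

section spectral

universe v

variable {E : Type v} [NormedAddCommGroup E] [InnerProductSpace ℝ E]

-- Hilbert bases of the eigenspaces are put together; by the spectral theorem for compact symmetric
-- operators the eigenspaces have no common orthogonal vector but `0`.
open Module.End in
theorem exists_orthonormal_eigenvectors [CompleteSpace E] {T : E →L[ℝ] E} (hc : IsCompactOperator T)
    (hs : T.IsSymmetric) : ∃ (ι : Type v) (μ : ι → ℝ) (w : ι → E), Orthonormal ℝ w ∧
      (Submodule.span ℝ (range w))ᗮ = ⊥ ∧ ∀ i, T (w i) = μ i • w i := by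
  have hcl : ∀ μ : ℝ, IsClosed (eigenspace (T : E →ₗ[ℝ] E) μ : Set E) := by
    intro μ
    have : (eigenspace (T : E →ₗ[ℝ] E) μ : Set E) = {x | T x = μ • x} := by
      ext x
      simp
    rw [this]
    exact isClosed_eq T.continuous (continuous_const_smul μ)
  have : ∀ μ : ℝ, CompleteSpace (eigenspace (T : E →ₗ[ℝ] E) μ) :=
    fun μ => (hcl μ).completeSpace_coe
  choose s v hv using fun μ : ℝ => exists_hilbertBasis ℝ (eigenspace (T : E →ₗ[ℝ] E) μ)
  refine ⟨Σ μ : ℝ, s μ, Sigma.fst, fun i => ((v i.1 i.2 : eigenspace (T : E →ₗ[ℝ] E) i.1) : E),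
    hs.orthogonalFamily_eigenspaces.orthonormal_sigma_orthonormal fun μ => (v μ).orthonormal, ?_,
    fun i => ?_⟩
  · rw [Submodule.eq_bot_iff]
    intro x hx
    have h0 : x ∈ (⨆ μ, eigenspace (T : E →ₗ[ℝ] E) μ)ᗮ := by
      rw [← Submodule.iInf_orthogonal]
      refine Submodule.mem_iInf _ |>.2 fun μ => ?_
      rw [Submodule.mem_orthogonal]
      intro y hy
      have h1 := (v μ).hasSum_repr ⟨y, hy⟩
      have h2 := (h1.mapL (eigenspace (T : E →ₗ[ℝ] E) μ).subtypeL).mapL (innerSL ℝ x)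
      have h3 : ∀ i, innerSL ℝ x ((eigenspace (T : E →ₗ[ℝ] E) μ).subtypeL
          ((v μ).repr ⟨y, hy⟩ i • v μ i)) = 0 := by
        intro i
        have := (Submodule.mem_orthogonal' _ _).1 hx _ (Submodule.subset_span ⟨⟨μ, i⟩, rfl⟩)
        simp only [map_smul, Submodule.subtypeL_apply, innerSL_apply_apply, smul_eq_mul]
        simp only at this
        rw [this, mul_zero]
      simp only [h3] at h2
      rw [real_inner_comm]
      exact h2.unique hasSum_zero
    rwa [ContinuousLinearMap.orthogonalComplement_iSup_eigenspaces_eq_bot hc hs,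
      Submodule.mem_bot] at h0
  · exact mem_eigenspace_iff.1 (v i.1 i.2).2

/-- Images of distinct basis vectors satisfy `‖T wᵢ - T wⱼ‖² = μᵢ² + μⱼ²`, so infinitely many
eigenvalues above `ε` would give a sequence in a compact set without Cauchy subsequence. -/
theorem finite_setOf_le_eigenvalue {T : E →L[ℝ] E} (hc : IsCompactOperator T) {ι : Type*}
    {μ : ι → ℝ} {w : ι → E} (hw : Orthonormal ℝ w) (hT : ∀ i, T (w i) = μ i • w i) {ε : ℝ}
    (hε : 0 < ε) : {i | ε ≤ μ i}.Finite := by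
  by_contra hinf
  have : Infinite {i | ε ≤ μ i} := Set.infinite_coe_iff.2 hinf
  set f : ℕ ↪ {i | ε ≤ μ i} := Infinite.natEmbedding _
  obtain ⟨K, hK, hKsub⟩ := IsCompactOperator.image_closedBall_subset_compact
    (f := (T : E →ₗ[ℝ] E)) hc 1
  obtain ⟨x, -, φ, hφ, hlim⟩ := hK.tendsto_subseq (x := fun n => T (w (f n)))
    fun n => hKsub ⟨w (f n), by simp [hw.1], rfl⟩
  have hcau := hlim.cauchySeq
  rw [Metric.cauchySeq_iff'] at hcau
  obtain ⟨N, hN⟩ := hcau ε hε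
  have h1 := hN (N + 1) (Nat.le_succ N)
  set i := f (φ (N + 1)) with hi
  set j := f (φ N) with hj
  have hij : (i : ι) ≠ j := fun h => by
    have := hφ.injective (f.injective (Subtype.ext h))
    omega
  have h2 : ‖T (w i) - T (w j)‖ ^ 2 = μ i ^ 2 + μ j ^ 2 := by
    have hin : inner ℝ (T (w i)) (T (w j)) = 0 := by
      rw [hT, hT, real_inner_smul_left, real_inner_smul_right, hw.2 hij]
      ring
    rw [norm_sub_sq_real, hin, hT, hT, norm_smul, norm_smul, hw.1, hw.1]
    simp
  have h3 : ‖T (w i) - T (w j)‖ < ε := by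
    rw [← dist_eq_norm]; exact h1
  have h4 : ε ≤ μ i := i.2
  have h5 : ‖T (w i) - T (w j)‖ ^ 2 < ε ^ 2 := by gcongr
  nlinarith [sq_nonneg (μ j), pow_le_pow_left₀ hε.le h4 2]

theorem exists_eigenbasis_of_compact_pos [CompleteSpace E] {T : E →L[ℝ] E} (hc : IsCompactOperator T)
    (hs : T.IsSymmetric) (hpos : ∀ x, x ≠ 0 → 0 < inner ℝ (T x) x)
    (hinf : ¬ FiniteDimensional ℝ E) : ∃ (μ : ℕ → ℝ) (w : HilbertBasis ℕ ℝ E),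
      (∀ k, T (w k) = μ k • w k) ∧ (∀ k, 0 < μ k) ∧ Antitone μ ∧ Tendsto μ atTop (𝓝 0) := by
  obtain ⟨ι, μ, w, hw, hspan, hT⟩ := exists_orthonormal_eigenvectors hc hs
  have hμ : ∀ i, 0 < μ i := fun i => by
    have h1 := hpos (w i) (hw.ne_zero i)
    rwa [hT, real_inner_smul_left, real_inner_self_eq_norm_sq, hw.1, one_pow, mul_one] at h1
  have hfin : ∀ ε : ℝ, 0 < ε → {i | ε ≤ μ i}.Finite := fun ε hε =>
    finite_setOf_le_eigenvalue hc hw hT hε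
  have : Infinite ι := by
    rw [← not_finite_iff_infinite]
    intro hι
    refine hinf ?_
    have : FiniteDimensional ℝ (Submodule.span ℝ (range w)) :=
      FiniteDimensional.span_of_finite ℝ (finite_range w)
    rw [Submodule.orthogonal_eq_bot_iff] at hspan
    rw [hspan] at this
    exact Module.Finite.equiv Submodule.topEquiv
  obtain ⟨e, he⟩ := exists_equiv_nat_antitone μ hμ hfin
  refine ⟨μ ∘ e, HilbertBasis.mkOfOrthogonalEqBot (hw.comp e e.injective)
    (by rw [e.surjective.range_comp]; exact hspan), fun k => ?_, fun k => hμ _, he, ?_⟩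
  · rw [HilbertBasis.coe_mkOfOrthogonalEqBot]
    exact hT _
  · rw [Metric.tendsto_atTop]
    intro ε hε
    have h1 : (e ⁻¹' {i | ε ≤ μ i}).Finite := (hfin ε hε).preimage e.injective.injOn
    obtain ⟨N, hN⟩ := h1.bddAbove
    refine ⟨N + 1, fun n hn => ?_⟩
    rw [dist_zero_right, Real.norm_eq_abs, Function.comp_apply, abs_of_pos (hμ _)]
    by_contra! h
    have := hN h
    omega

end spectral

/-! ### The eigenbasis of the medium -/

/-- The indicators of the `N³` grid cells are orthogonal and nonzero; `N` is taken larger than the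
supposed dimension. -/
theorem not_finiteDimensional_boxL2 {L a b : ℝ} (hL : 0 < L) (hab : a < b) :
    ¬ FiniteDimensional ℝ (BoxL2 L a b) := by
  intro hfd
  set N := Module.finrank ℝ (BoxL2 L a b) + 1 with hN
  have hN0 : 0 < N := Nat.succ_pos _
  set T := Fintype.piFinset fun _ : Fin 3 => Finset.Ico (0 : ℤ) N with hT
  have hc := measurable_gridIndex L a b N
  have hv : 0 < (∏ i, gridSide L a b i) / (N : ℝ) ^ 3 := by
    have := Finset.prod_pos fun i (_ : i ∈ Finset.univ) => gridSide_pos hL hab i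
    positivity
  have hinner : ∀ k m : Fin 3 → ℤ, inner ℝ
      (indicatorConstLp 2 (hc (measurableSet_singleton k)) (measure_ne_top (boxMeasure L a b) _) (1 : ℝ))
      (indicatorConstLp 2 (hc (measurableSet_singleton m)) (measure_ne_top (boxMeasure L a b) _) (1 : ℝ))
      = (boxMeasure L a b).real (gridIndex L a b N ⁻¹' {k} ∩ gridIndex L a b N ⁻¹' {m}) := by
    intro k m
    rw [L2.inner_indicatorConstLp_indicatorConstLp]
    simp
  have hli : LinearIndependent ℝ fun k : T => (indicatorConstLp 2
      (hc (measurableSet_singleton (k : Fin 3 → ℤ))) (measure_ne_top (boxMeasure L a b) _) (1 : ℝ)) := by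
    refine linearIndependent_of_ne_zero_of_inner_eq_zero (𝕜 := ℝ) (fun k h => ?_) fun k m hkm => ?_
    · have h1 := hinner k k
      rw [h, inner_zero_left, inter_self] at h1
      have h2 := le_boxMeasure_gridIndex hL hab hN0 k.2
      rw [measureReal_def, eq_comm, ENNReal.toReal_eq_zero_iff, or_iff_left (measure_ne_top _ _)] at h1
      rw [h1] at h2
      exact absurd (ENNReal.ofReal_pos.2 hv) (not_lt.2 h2)
    · change inner ℝ _ _ = (0 : ℝ)
      rw [hinner, ← preimage_inter, singleton_inter_eq_empty.2, preimage_empty, measureReal_empty]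
      exact fun h => hkm (Subtype.ext (mem_singleton_iff.1 h))
  have h1 := hli.fintype_card_le_finrank
  rw [Fintype.card_coe, hT, Fintype.card_piFinset_const, Int.card_Ico, sub_zero, Int.toNat_natCast] at h1
  change N ^ 3 ≤ Module.finrank ℝ (BoxL2 L a b) at h1
  have h2 : N ≤ N ^ 3 := Nat.le_self_pow (by norm_num) N
  omega

namespace Medium

variable {l : ℕ}

theorem isCompactOperator_embed (M : Medium l) : IsCompactOperator M.embed := by
  have hd := M.dMin_pos
  refine isCompactOperator_of_finite_dimensional_approx _ fun ε hε => ?_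
  obtain ⟨K, hK, happ⟩ := exists_finite_dimensional_approx (L := M.L) M.L_pos
    (neg_lt_zero.2 M.H_pos) (ε := ε ^ 2 * M.dMin) (by positivity)
  refine ⟨K, hK, fun y => ?_⟩
  obtain ⟨u, g, hug, hy⟩ := exists_eq_pack y.2
  obtain rfl : y = ⟨pack u g, pack_mem_energySpace hug⟩ := Subtype.ext hy
  obtain ⟨x, hx, hle⟩ := happ u g fun i => hug.hasWD M.L_pos i
  refine ⟨x, hx, ?_⟩
  rw [embed_pack hug]
  refine abs_le_of_sq_le_sq' ?_ (by positivity) |>.2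
  refine hle.trans ?_
  rw [mul_pow, mul_assoc]
  refine mul_le_mul_of_nonneg_left ?_ (sq_nonneg ε)
  rw [← real_inner_self_eq_norm_sq, Submodule.coe_inner, inner_pack, Finset.mul_sum]
  have := Finset.sum_le_sum fun i (_ : i ∈ Finset.univ) => M.dMin_mul_norm_sq_le (g i)
  have h2 : 0 ≤ inner ℝ u u := real_inner_self_nonneg
  linarith

/-- The spectral theorem is applied to `J J*`, whose positivity uses that `J` has dense range. For
an eigenvalue `μ`, the vector `μ⁻¹ J* w` lifts `w` to the energy space and solves the weak equation
with `λ = 1/μ - 1`; regularity places `w` in `𝓦`. -/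
theorem exists_eigenbasis (M : Medium l) :
    ∃ (lam : ℕ → ℝ) (w : HilbertBasis ℕ ℝ M.L2), M.IsEigenbasis lam w ∧
      (∀ k, 0 < lam k) ∧ Monotone lam ∧ Tendsto lam atTop atTop := by
  set J := M.embed with hJ
  set A := ContinuousLinearMap.adjoint J with hA
  have hAinj : ∀ x, A x = 0 → x = 0 := by
    intro x hx
    have h1 : ∀ y, inner ℝ x y = 0 := by
      intro y
      refine M.denseRange_embed.induction_on (p := fun y => inner ℝ x y = 0) y
        (isClosed_eq (by fun_prop) continuous_const) fun v => ?_
      rw [← ContinuousLinearMap.adjoint_inner_left]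
      change inner ℝ (A x) v = 0
      rw [hx, inner_zero_left]
    exact inner_self_eq_zero.1 (h1 x)
  have hin : ∀ x y, inner ℝ ((J.comp A) x) y = inner ℝ (A x) (A y) := fun x y => by
    rw [ContinuousLinearMap.comp_apply, ← ContinuousLinearMap.adjoint_inner_right]
  have hc : IsCompactOperator (J.comp A) := M.isCompactOperator_embed.comp_clm A
  have hs : (J.comp A).IsSymmetric := fun x y => by
    have h2 := hin y x
    rw [real_inner_comm] at h2
    exact (hin x y).trans ((real_inner_comm _ _).trans h2.symm)
  obtain ⟨μ, w, hw, hμ, hanti, hlim⟩ := exists_eigenbasis_of_compact_pos hc hs (fun x hx => by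
    rw [hin, real_inner_self_eq_norm_sq]
    have : A x ≠ 0 := fun h => hx (hAinj x h)
    positivity) (not_finiteDimensional_boxL2 M.L_pos (neg_lt_zero.2 M.H_pos))
  obtain ⟨C, -, hreg⟩ := M.exists_regularity_const
  have hbasis : M.IsEigenbasis (fun k => (μ k)⁻¹ - 1) w := by
    intro k
    obtain ⟨u, g, hug, hy⟩ := exists_eq_pack ((μ k)⁻¹ • A (w k)).2
    have hy' : (μ k)⁻¹ • A (w k) = ⟨pack u g, pack_mem_energySpace hug⟩ := Subtype.ext hy
    have hu : u = w k := by
      have h1 := congrArg J hy'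
      rw [map_smul, embed_pack hug] at h1
      rw [← h1]
      have h2 := hw k
      rw [ContinuousLinearMap.comp_apply] at h2
      rw [h2, smul_smul, inv_mul_cancel₀ (hμ k).ne', one_smul]
    subst hu
    have hsol : M.IsWeakSolution (w k) g (((μ k)⁻¹ - 1) • w k) := by
      refine isWeakSolution_of_inner_energy hug fun v => ?_
      rw [← hy']
      refine (real_inner_smul_left (A (w k)) v (μ k)⁻¹).trans ?_
      rw [ContinuousLinearMap.adjoint_inner_left, inner_add_left,
        real_inner_smul_left]
      ring
    obtain ⟨h1, h2, -⟩ := hreg _ _ _ hsol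
    refine ⟨h1, ?_⟩
    filter_upwards [h2, Lp.coeFn_smul ((μ k)⁻¹ - 1) (w k)] with p h2 h3
    rw [h2, h3, Pi.smul_apply, smul_eq_mul]
  refine ⟨_, w, hbasis, fun k => hbasis.lam_pos k, fun k k' h => ?_, ?_⟩
  · exact sub_le_sub_right (inv_anti₀ (hμ k') (hanti h)) 1
  · refine tendsto_atTop_add_const_right _ (-1) ?_
    refine Tendsto.inv_tendsto_nhdsGT_zero (tendsto_nhdsWithin_iff.2 ⟨hlim, Eventually.of_forall hμ⟩)

end Medium

end Layered

end

noncomputable section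

namespace Layered

/-! ### The interpolation weight -/

/-- The minimum over `v` of `λ (1 - v)² + t² λ² v²`. -/
def modeK (t lam : ℝ) : ℝ := t ^ 2 * lam ^ 2 / (1 + t ^ 2 * lam)

theorem modeK_nonneg (t : ℝ) {lam : ℝ} (h : 0 < lam) : 0 ≤ modeK t lam := by
  unfold modeK; positivity

/-- The two sides, multiplied by `1 + t²λ`, differ by the square `λ ((1 + t²λ) v - u)²`. -/
theorem modeK_mul_le (t : ℝ) {lam : ℝ} (h : 0 < lam) (u v : ℝ) :
    modeK t lam * u ^ 2 ≤ lam * (u - v) ^ 2 + t ^ 2 * (lam ^ 2 * v ^ 2) := by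
  have h1 : 0 < 1 + t ^ 2 * lam := by positivity
  rw [modeK, div_mul_eq_mul_div, div_le_iff₀ h1]
  have : 0 ≤ lam * ((1 + t ^ 2 * lam) * v - u) ^ 2 := by positivity
  nlinarith

theorem lintegral_comp_smul {E : Type*} [NormedAddCommGroup E] [NormedSpace ℝ E]
    [FiniteDimensional ℝ E] [MeasurableSpace E] [BorelSpace E] (μ : Measure E) [μ.IsAddHaarMeasure]
    {r : ℝ} (hr : 0 < r) {f : E → ℝ≥0∞} (hf : Measurable f) :
    ENNReal.ofReal (r ^ Module.finrank ℝ E) * ∫⁻ x, f (r • x) ∂μ = ∫⁻ x, f x ∂μ := by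
  have h := lintegral_map (μ := μ) hf (measurable_const_smul r)
  rw [Measure.map_addHaar_smul μ hr.ne', lintegral_smul_measure, smul_eq_mul] at h
  have h0 : 0 < r ^ Module.finrank ℝ E := by positivity
  rw [← h, ← mul_assoc, ← ENNReal.ofReal_mul h0.le, abs_of_pos (inv_pos.2 h0),
    mul_inv_cancel₀ h0.ne', ENNReal.ofReal_one, one_mul]

section weight

variable {s : ℝ}

/-- `modeK t 1` is at most `t²` and at most `1`. The first bound settles integrability at `0`
because `s < 1`, the second at infinity because `0 < s`. -/
theorem integrableOn_weight (hs : 0 < s) (hs1 : s < 1) :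
    IntegrableOn (fun t : ℝ => t ^ (-2 * s) / t * modeK t 1) (Ioi 0) := by
  have hm : AEStronglyMeasurable (fun t : ℝ => t ^ (-2 * s) / t * modeK t 1) volume := by
    unfold modeK
    exact (by fun_prop : Measurable _).aestronglyMeasurable
  have hrew : ∀ t : ℝ, 0 < t → t ^ (-2 * s) / t * t ^ 2 = t ^ (1 - 2 * s) := by
    intro t ht
    rw [sub_eq_neg_add, ← neg_mul, Real.rpow_add ht, Real.rpow_one]
    field_simp
  have hrew' : ∀ t : ℝ, 0 < t → t ^ (-2 * s) / t = t ^ (-2 * s - 1) := by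
    intro t ht
    rw [Real.rpow_sub ht, Real.rpow_one]
  rw [← Ioc_union_Ioi_eq_Ioi zero_le_one]
  refine IntegrableOn.union ?_ ?_
  · have h1 : IntegrableOn (fun t : ℝ => t ^ (1 - 2 * s)) (Ioc 0 1) := by
      rw [← intervalIntegrable_iff_integrableOn_Ioc_of_le zero_le_one]
      exact intervalIntegral.intervalIntegrable_rpow' (by linarith)
    refine Integrable.mono' h1 hm.restrict ?_
    filter_upwards [ae_restrict_mem measurableSet_Ioc] with t ht
    have ht0 := ht.1
    rw [Real.norm_of_nonneg (by unfold modeK; positivity), ← hrew t ht0]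
    refine mul_le_mul_of_nonneg_left ?_ (by positivity)
    rw [modeK]
    simp only [one_pow, mul_one]
    exact div_le_self (sq_nonneg t) (by linarith [sq_nonneg t])
  · refine Integrable.mono' (integrableOn_Ioi_rpow_of_lt (by linarith : -2 * s - 1 < -1) zero_lt_one)
      hm.restrict ?_
    filter_upwards [ae_restrict_mem measurableSet_Ioi] with t ht
    have ht0 : 0 < t := zero_lt_one.trans ht
    rw [Real.norm_of_nonneg (by unfold modeK; positivity), ← hrew' t ht0]
    refine mul_le_of_le_one_right (by positivity) ?_
    rw [modeK]
    simp only [one_pow, mul_one]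
    exact (div_le_one (by positivity)).2 (by linarith)

/-- The constant in the one-dimensional weighted integral. -/
def weightConst (s : ℝ) : ℝ≥0∞ :=
  ∫⁻ t in Ioi (0 : ℝ), ENNReal.ofReal (t ^ (-2 * s) / t * modeK t 1)

theorem weightConst_lt_top (hs : 0 < s) (hs1 : s < 1) : weightConst s < ⊤ :=
  (integrableOn_weight hs hs1).lintegral_lt_top

theorem weightConst_pos : 0 < weightConst s := by
  rw [weightConst, pos_iff_ne_zero]
  have hm : Measurable fun t : ℝ => ENNReal.ofReal (t ^ (-2 * s) / t * modeK t 1) := by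
    unfold modeK; fun_prop
  rw [Ne, setLIntegral_eq_zero_iff measurableSet_Ioi hm]
  intro h
  have h1 : volume (Ioi (0 : ℝ)) = 0 := by
    refine measure_mono_null (fun t ht => ?_) (ae_iff.1 h)
    have ht0 : (0 : ℝ) < t := ht
    simp only [mem_ofPred_eq, not_forall]
    exact ⟨ht, (ENNReal.ofReal_pos.2 (by unfold modeK; positivity)).ne'⟩
  simp at h1

theorem modeK_scaling {t lam : ℝ} (hl : 0 < lam) :
    modeK t lam = lam * modeK (Real.sqrt lam * t) 1 := by
  rw [modeK, modeK, mul_pow, Real.sq_sqrt hl.le]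
  field_simp

/-- Substituting `√λ t` extracts `λ` from `modeK` and `λ^s` from the weight. -/
theorem lintegral_modeK {lam x : ℝ} (hl : 0 < lam) (hx : 0 ≤ x) :
    ∫⁻ t in Ioi (0 : ℝ), ENNReal.ofReal (t ^ (-2 * s) / t) * ENNReal.ofReal (modeK t lam * x)
      = weightConst s * ENNReal.ofReal (lam ^ (1 + s) * x) := by
  set r := Real.sqrt lam with hr
  have hr0 : 0 < r := Real.sqrt_pos.2 hl
  set F : ℝ → ℝ≥0∞ :=
    (Ioi (0 : ℝ)).indicator fun t => ENNReal.ofReal (t ^ (-2 * s) / t * modeK t 1) with hF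
  have hFm : Measurable F := by
    refine Measurable.indicator ?_ measurableSet_Ioi
    unfold modeK; fun_prop
  have h1 := lintegral_comp_smul volume hr0 hFm
  rw [Module.finrank_self, pow_one] at h1
  have h2 : ∫⁻ t, F t = weightConst s := by
    rw [hF, lintegral_indicator measurableSet_Ioi, weightConst]
  rw [← h2, ← h1, ← lintegral_indicator measurableSet_Ioi,
    mul_comm _ (ENNReal.ofReal (lam ^ (1 + s) * x)), ← mul_assoc,
    ← ENNReal.ofReal_mul (by positivity), ← lintegral_const_mul' _ _ ENNReal.ofReal_ne_top]
  refine lintegral_congr fun t => ?_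
  by_cases ht : 0 < t
  · have ht' : 0 < r • t := mul_pos hr0 ht
    rw [indicator_of_mem (mem_Ioi.2 ht), hF, indicator_of_mem (mem_Ioi.2 ht'), ← ENNReal.ofReal_mul (by positivity),
      ← ENNReal.ofReal_mul (by positivity)]
    congr 1
    rw [modeK_scaling hl, smul_eq_mul, ← hr, Real.mul_rpow hr0.le ht.le]
    have h3 : lam ^ (1 + s) * r ^ (-2 * s) = lam := by
      rw [hr, Real.sqrt_eq_rpow, ← Real.rpow_mul hl.le, ← Real.rpow_add hl]
      convert Real.rpow_one lam using 2
      ring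
    calc t ^ (-2 * s) / t * (lam * modeK (r * t) 1 * x)
        = lam * (t ^ (-2 * s) / t * modeK (r * t) 1 * x) := by ring
      _ = (lam ^ (1 + s) * r ^ (-2 * s)) * (t ^ (-2 * s) / t * modeK (r * t) 1 * x) := by rw [h3]
      _ = _ := by field_simp
  · have ht' : ¬ 0 < r • t := by
      rw [smul_eq_mul, mul_pos_iff_of_pos_left hr0]; exact ht
    rw [indicator_of_notMem (notMem_Ioi.2 (not_lt.1 ht)), hF,
      indicator_of_notMem (notMem_Ioi.2 (not_lt.1 ht')), mul_zero]

/-- The constant in the three-dimensional weighted integral. -/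
def weightConstSpace (s : ℝ) : ℝ≥0∞ :=
  ∫⁻ h : Space, ENNReal.ofReal (1 / ‖h‖ ^ (3 + 2 * s) * modeK ‖h‖ 1)

/-- In polar coordinates the Jacobian `t²` turns the weight `t^{-3-2s}` into the one-dimensional
`t^{-2s}/t`. -/
theorem weightConstSpace_lt_top (hs : 0 < s) (hs1 : s < 1) : weightConstSpace s < ⊤ := by
  have h1 : Integrable (fun h : Space => (fun t : ℝ => 1 / t ^ (3 + 2 * s) * modeK t 1) ‖h‖) := by
    refine (integrable_fun_norm_addHaar (μ := volume)
      (f := fun t : ℝ => 1 / t ^ (3 + 2 * s) * modeK t 1)).2 ?_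
    refine (integrableOn_weight hs hs1).congr_fun (fun t ht => ?_) measurableSet_Ioi
    have ht0 : (0 : ℝ) < t := ht
    simp only [finrank_euclideanSpace, Fintype.card_fin, smul_eq_mul]
    rw [Real.rpow_add ht0, neg_mul, Real.rpow_neg ht0.le]
    norm_num
    field_simp
  exact h1.lintegral_lt_top

theorem lintegral_space_modeK {lam x : ℝ} (hl : 0 < lam) (hx : 0 ≤ x) :
    ∫⁻ h : Space, ENNReal.ofReal (1 / ‖h‖ ^ (3 + 2 * s)) * ENNReal.ofReal (modeK ‖h‖ lam * x)
      = weightConstSpace s * ENNReal.ofReal (lam ^ (1 + s) * x) := by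
  set r := Real.sqrt lam with hr
  have hr0 : 0 < r := Real.sqrt_pos.2 hl
  set F : Space → ℝ≥0∞ := fun h => ENNReal.ofReal (1 / ‖h‖ ^ (3 + 2 * s) * modeK ‖h‖ 1) with hF
  have hFm : Measurable F := by
    unfold F modeK; fun_prop
  have h1 := lintegral_comp_smul volume hr0 hFm
  rw [finrank_euclideanSpace, Fintype.card_fin] at h1
  rw [weightConstSpace, ← h1, mul_comm _ (ENNReal.ofReal (lam ^ (1 + s) * x)), ← mul_assoc,
    ← ENNReal.ofReal_mul (by positivity), ← lintegral_const_mul' _ _ ENNReal.ofReal_ne_top]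
  refine lintegral_congr fun h => ?_
  have hm := modeK_nonneg (r * ‖h‖) one_pos
  rw [hF, ← ENNReal.ofReal_mul (by positivity), ← ENNReal.ofReal_mul (by positivity)]
  congr 1
  rw [modeK_scaling hl, norm_smul, Real.norm_of_nonneg hr0.le, ← hr,
    Real.mul_rpow hr0.le (norm_nonneg h)]
  have h3 : lam ^ (1 + s) * r ^ 3 = lam * r ^ (3 + 2 * s) := by
    rw [hr, Real.sqrt_eq_rpow, ← Real.rpow_natCast, ← Real.rpow_mul hl.le, ← Real.rpow_mul hl.le,
      ← Real.rpow_add hl]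
    nth_rewrite 2 [← Real.rpow_one lam]
    rw [← Real.rpow_add hl]
    congr 1
    push_cast
    ring
  have h4 : r ^ (3 + 2 * s) ≠ 0 := (Real.rpow_pos_of_pos hr0 _).ne'
  calc 1 / ‖h‖ ^ (3 + 2 * s) * (lam * modeK (r * ‖h‖) 1 * x)
      = (lam * r ^ (3 + 2 * s)) * x * (1 / (r ^ (3 + 2 * s) * ‖h‖ ^ (3 + 2 * s))
          * modeK (r * ‖h‖) 1) := by
        rw [← one_div_mul_one_div]
        field_simp
    _ = _ := by rw [← h3]; ring

end weight

/-! ### The `K`-functional in spectral terms and the interpolation norm -/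

namespace Medium

variable {l : ℕ} {M : Medium l}

/-- The sum that is equivalent to the `K`-functional. -/
def modeSum (lam : ℕ → ℝ) (w : HilbertBasis ℕ ℝ M.L2) (t : ℝ) (u : M.L2) : ℝ≥0∞ :=
  ∑' k, ENNReal.ofReal (modeK t (lam k) * inner ℝ u (w k) ^ 2)

/-- The square of the norm of a fractional-power space. -/
def fracSum (lam : ℕ → ℝ) (w : HilbertBasis ℕ ℝ M.L2) (σ : ℝ) (u : M.L2) : ℝ≥0∞ :=
  ∑' k, ENNReal.ofReal (lam k ^ σ * inner ℝ u (w k) ^ 2)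

/-- Stated for a general measure space because it is used twice: on the half-line for the
interpolation norm, and on `Space` with `r = ‖·‖` for the Slobodeckij seminorm. -/
theorem lintegral_modeSum {lam : ℕ → ℝ} (w : HilbertBasis ℕ ℝ M.L2) (u : M.L2)
    {X : Type*} [MeasurableSpace X] {ν : Measure X} {κ : X → ℝ≥0∞} {r : X → ℝ} (hκ : Measurable κ)
    (hr : Measurable r) {c : ℝ≥0∞} {σ : ℝ} (h : ∀ k, ∀ y : ℝ, 0 ≤ y →
      ∫⁻ x, κ x * ENNReal.ofReal (modeK (r x) (lam k) * y) ∂ν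
        = c * ENNReal.ofReal (lam k ^ σ * y)) :
    ∫⁻ x, κ x * modeSum lam w (r x) u ∂ν = c * fracSum lam w σ u := by
  simp only [modeSum, fracSum, ← ENNReal.tsum_mul_left]
  rw [lintegral_tsum fun k => ?_]
  · exact tsum_congr fun k => h k _ (sq_nonneg _)
  · unfold modeK
    exact (hκ.mul (by fun_prop)).aemeasurable

theorem _root_.Layered.InH10.sub {L a b : ℝ} {u v : BoxL2 L a b} {g k : Fin 3 → BoxL2 L a b} (hu : InH10 u g)
    (hv : InH10 v k) : InH10 (u - v) (g - k) := by
  obtain ⟨φ, hφ, hφ'⟩ := hu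
  obtain ⟨χ, hχ, hχ'⟩ := hv
  refine ⟨fun n => φ n - χ n, ?_, fun i => ?_⟩
  · simpa using hφ.sub hχ
  · simpa using (hφ' i).sub (hχ' i)

theorem sub_mem_V {u v : M.L2} (hu : u ∈ M.V) (hv : v ∈ M.V) : u - v ∈ M.V := by
  obtain ⟨g, hg⟩ := mem_V_iff.1 hu
  obtain ⟨k, hk⟩ := mem_V_iff.1 hv
  exact mem_V_iff.2 ⟨g - k, hg.sub hk⟩

section eigen

variable {lam : ℕ → ℝ} {w : HilbertBasis ℕ ℝ M.L2}

theorem IsEigenbasis.specSum_two_le (h : M.IsEigenbasis lam w) {v : M.L2} (hv : v ∈ M.W) :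
    specSum lam w 2 v ≤ ENNReal.ofReal (3 * (M.dMax ^ 2 + 1)) * M.wSq v := by
  obtain ⟨g, f, hs, -, hle⟩ := exists_isWeakSolution_of_mem_W hv
  rwa [← h.norm_sq_eq hs]

/-- For every competitor `v`, each mode costs at least its own minimum `modeK`. -/
theorem IsEigenbasis.modeSum_le_KSq (h : M.IsEigenbasis lam w) (t : ℝ) {u : M.L2} (hu : u ∈ M.V) :
    modeSum lam w t u ≤ ENNReal.ofReal (3 * (M.dMax ^ 2 + 1)) * M.KSq t u := by
  set C := 3 * (M.dMax ^ 2 + 1) with hC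
  have hC1 : 1 ≤ C := by nlinarith [sq_nonneg M.dMax]
  rw [KSq, ENNReal.mul_iInf_of_ne (ENNReal.ofReal_pos.2 (by positivity)).ne' ENNReal.ofReal_ne_top]
  refine le_iInf fun v => ?_
  by_cases hv : v ∈ M.W
  · rw [iInf_pos hv, mul_add, h.vSq_eq (sub_mem_V hu hv.1)]
    have h1 := h.specSum_two_le hv
    calc modeSum lam w t u ≤ specSum lam w 1 (u - v) + ENNReal.ofReal (t ^ 2) * specSum lam w 2 v := by
          rw [modeSum, specSum, specSum, ← ENNReal.tsum_mul_left, ← ENNReal.tsum_add]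
          refine ENNReal.tsum_le_tsum fun k => ?_
          have hl := h.lam_pos k
          rw [← ENNReal.ofReal_mul (by positivity), ← ENNReal.ofReal_add (by positivity)
            (by positivity), inner_sub_left, pow_one]
          exact ENNReal.ofReal_le_ofReal (modeK_mul_le t hl _ _)
      _ ≤ ENNReal.ofReal C * specSum lam w 1 (u - v)
          + ENNReal.ofReal (t ^ 2) * (ENNReal.ofReal C * M.wSq v) := by
          gcongr
          exact le_mul_of_one_le_left bot_le (ENNReal.one_le_ofReal.2 hC1)
      _ = _ := by ring
  · rw [iInf_neg hv, ENNReal.mul_top (ENNReal.ofReal_pos.2 (by positivity)).ne']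
    exact le_top

end eigen

theorem exists_KSq_le_const (M : Medium l) : ∃ C : ℝ, 0 < C ∧
    ∀ (lam : ℕ → ℝ) (w : HilbertBasis ℕ ℝ M.L2), M.IsEigenbasis lam w →
      ∀ t : ℝ, 0 < t → ∀ u ∈ M.V, M.KSq t u ≤ ENNReal.ofReal C * modeSum lam w t u := by
  obtain ⟨C, hC, hreg⟩ := M.exists_regularity_const
  refine ⟨1 + C, by positivity, fun lam w h t ht u hu => ?_⟩
  have hl := h.lam_pos
  have hfrac : ∀ k, 0 < 1 + t ^ 2 * lam k := fun k => by have := hl k; positivity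
  -- The competitor has coefficients `c / (1 + t²λ)`, the minimizer in each mode.
  have hsum : Summable fun k => (inner ℝ u (w k) / (1 + t ^ 2 * lam k)) ^ 2 := by
    refine Summable.of_nonneg_of_le (fun k => sq_nonneg _) (fun k => ?_)
      (w.hasSum_inner_sq u).summable
    rw [div_pow]
    refine div_le_self (sq_nonneg _) (one_le_pow₀ ?_)
    have := hl k
    nlinarith [mul_pos (pow_pos ht 2) this]
  obtain ⟨v, hv⟩ := w.exists_of_summable_sq hsum
  have hbound : specSum lam w 2 v ≤ ENNReal.ofReal (t ^ 2)⁻¹ * modeSum lam w t u := by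
    rw [specSum, modeSum, ← ENNReal.tsum_mul_left]
    refine ENNReal.tsum_le_tsum fun k => ?_
    have hk := hl k
    have hf := hfrac k
    rw [← ENNReal.ofReal_mul (by positivity), hv, modeK]
    refine ENNReal.ofReal_le_ofReal ?_
    have : (t ^ 2)⁻¹ * (t ^ 2 * lam k ^ 2 / (1 + t ^ 2 * lam k) * inner ℝ u (w k) ^ 2)
        = lam k ^ 2 * (inner ℝ u (w k) ^ 2 / (1 + t ^ 2 * lam k)) := by field_simp
    rw [this, div_pow]
    gcongr
    exact le_self_pow₀ (by nlinarith [mul_pos (pow_pos ht 2) hk]) (by norm_num)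
  -- Finiteness of the spectral sum of order two of `v` comes from `u ∈ 𝓥`; regularity then puts `v`
  -- in `𝓦`, so that it is admissible.
  have hmode : modeSum lam w t u ≤ specSum lam w 1 u := by
    rw [specSum, modeSum]
    refine ENNReal.tsum_le_tsum fun k => ?_
    have hk := hl k
    have hf := hfrac k
    refine ENNReal.ofReal_le_ofReal (mul_le_mul_of_nonneg_right ?_ (sq_nonneg _))
    rw [modeK, pow_one, div_le_iff₀ hf]
    nlinarith
  have hV1 : specSum lam w 1 u < ⊤ := by
    obtain ⟨g, hg⟩ := mem_V_iff.1 hu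
    rw [← h.vSq_eq hu, M.vSq_eq hg]
    exact ENNReal.ofReal_lt_top
  have hv2 : specSum lam w 2 v < ⊤ :=
    hbound.trans_lt (ENNReal.mul_lt_top ENNReal.ofReal_lt_top (hmode.trans_lt hV1))
  obtain ⟨g, f, hsol⟩ := h.exists_isWeakSolution hv2
  obtain ⟨hvW, -, hwSq⟩ := hreg v g f hsol
  rw [ENNReal.ofReal_mul hC.le, h.norm_sq_eq hsol] at hwSq
  calc M.KSq t u ≤ M.vSq (u - v : M.L2) + ENNReal.ofReal (t ^ 2) * M.wSq v :=
        iInf₂_le (f := fun v (_ : v ∈ M.W) =>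
          M.vSq (u - v : M.L2) + ENNReal.ofReal (t ^ 2) * M.wSq v) v hvW
    _ ≤ specSum lam w 1 (u - v) + ENNReal.ofReal (t ^ 2) * (ENNReal.ofReal C * specSum lam w 2 v) := by
        rw [h.vSq_eq (sub_mem_V hu hvW.1)]
        gcongr
    _ ≤ modeSum lam w t u + ENNReal.ofReal (t ^ 2) * (ENNReal.ofReal C *
          (ENNReal.ofReal (t ^ 2)⁻¹ * modeSum lam w t u)) := by
        gcongr
        rw [specSum, modeSum]
        refine ENNReal.tsum_le_tsum fun k => ENNReal.ofReal_le_ofReal ?_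
        have hk := hl k
        have hf := hfrac k
        rw [inner_sub_left, hv, modeK, pow_one]
        have h1 : inner ℝ u (w k) - inner ℝ u (w k) / (1 + t ^ 2 * lam k)
            = t ^ 2 * lam k / (1 + t ^ 2 * lam k) * inner ℝ u (w k) := by field_simp; ring
        rw [h1, mul_pow, ← mul_assoc]
        refine mul_le_mul_of_nonneg_right ?_ (sq_nonneg _)
        rw [div_pow, ← mul_div_assoc, div_le_div_iff₀ (by positivity) hf]
        have h2 : 0 ≤ t ^ 2 * lam k ^ 2 * (1 + t ^ 2 * lam k) := by positivity
        nlinarith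
    _ = _ := by
        have h2 : ENNReal.ofReal (t ^ 2) * ENNReal.ofReal (t ^ 2)⁻¹ = 1 := by
          rw [← ENNReal.ofReal_mul (by positivity), mul_inv_cancel₀ (by positivity),
            ENNReal.ofReal_one]
        rw [ENNReal.ofReal_add zero_le_one hC.le, ENNReal.ofReal_one, add_mul, one_mul]
        congr 1
        calc _ = (ENNReal.ofReal (t ^ 2) * ENNReal.ofReal (t ^ 2)⁻¹) *
              (ENNReal.ofReal C * modeSum lam w t u) := by ring
          _ = _ := by rw [h2, one_mul]

/-- The square of the interpolation norm. -/
def interpSq (M : Medium l) (s : ℝ) (u : M.L2) : ℝ≥0∞ :=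
  ∫⁻ t in Ioi (0 : ℝ), ENNReal.ofReal (t ^ (-2 * s) / t) * M.KSq t u

theorem IsEigenbasis.lintegral_modeSum_line {lam : ℕ → ℝ} {w : HilbertBasis ℕ ℝ M.L2}
    (h : M.IsEigenbasis lam w) (s : ℝ) (u : M.L2) :
    ∫⁻ t in Ioi (0 : ℝ), ENNReal.ofReal (t ^ (-2 * s) / t) * modeSum lam w t u
      = weightConst s * fracSum lam w (1 + s) u :=
  lintegral_modeSum w u (r := fun t => t) (by fun_prop) measurable_id
    fun k _ hy => lintegral_modeK (h.lam_pos k) hy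

theorem IsEigenbasis.fracSum_le_interpSq {lam : ℕ → ℝ} {w : HilbertBasis ℕ ℝ M.L2}
    (h : M.IsEigenbasis lam w) (s : ℝ) {u : M.L2} (hu : u ∈ M.V) :
    weightConst s * fracSum lam w (1 + s) u
      ≤ ENNReal.ofReal (3 * (M.dMax ^ 2 + 1)) * M.interpSq s u := by
  rw [← h.lintegral_modeSum_line, interpSq, ← lintegral_const_mul' _ _ ENNReal.ofReal_ne_top]
  refine lintegral_mono fun t => ?_
  rw [mul_left_comm]
  gcongr
  exact h.modeSum_le_KSq t hu

theorem exists_interpSq_le_const (M : Medium l) : ∃ C : ℝ, 0 < C ∧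
    ∀ (lam : ℕ → ℝ) (w : HilbertBasis ℕ ℝ M.L2), M.IsEigenbasis lam w → ∀ s : ℝ, ∀ u ∈ M.V,
      M.interpSq s u ≤ ENNReal.ofReal C * (weightConst s * fracSum lam w (1 + s) u) := by
  obtain ⟨C, hC, hK⟩ := M.exists_KSq_le_const
  refine ⟨C, hC, fun lam w h s u hu => ?_⟩
  rw [← h.lintegral_modeSum_line, interpSq, ← lintegral_const_mul' _ _ ENNReal.ofReal_ne_top]
  refine setLIntegral_mono' measurableSet_Ioi fun t ht => ?_
  rw [mul_left_comm]
  gcongr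
  exact hK lam w h t ht u hu

theorem IsEigenbasis.specSum_one_le_fracSum {lam : ℕ → ℝ} {w : HilbertBasis ℕ ℝ M.L2}
    (h : M.IsEigenbasis lam w) {s : ℝ} (hs : 0 < s) (u : M.L2) :
    specSum lam w 1 u
      ≤ ENNReal.ofReal ((M.dMin / (4 * M.H ^ 2)) ^ s)⁻¹ * fracSum lam w (1 + s) u := by
  have hc0 : 0 < M.dMin / (4 * M.H ^ 2) :=
    div_pos M.dMin_pos (by have := M.H_pos; positivity)
  rw [specSum, fracSum, ← ENNReal.tsum_mul_left]
  refine ENNReal.tsum_le_tsum fun k => ?_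
  have hk := h.lam_pos k
  rw [← ENNReal.ofReal_mul (by positivity), ← mul_assoc]
  refine ENNReal.ofReal_le_ofReal (mul_le_mul_of_nonneg_right ?_ (sq_nonneg _))
  rw [pow_one, le_inv_mul_iff₀ (by positivity), Real.rpow_add hk, Real.rpow_one, mul_comm]
  exact mul_le_mul_of_nonneg_left (Real.rpow_le_rpow hc0.le (h.le_lam k) hs.le) hk.le

end Medium

theorem rpow_half_le_of_le {X Y : ℝ≥0∞} {A : ℝ} (hA : 0 ≤ A) (h : X ≤ ENNReal.ofReal A * Y) :
    X ^ (1 / 2 : ℝ) ≤ (Real.sqrt A).toNNReal * Y ^ (1 / 2 : ℝ) := by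
  refine (ENNReal.rpow_le_rpow h (by norm_num)).trans_eq ?_
  rw [ENNReal.mul_rpow_of_nonneg _ _ (by norm_num), ENNReal.ofReal_rpow_of_nonneg hA (by norm_num),
    Real.sqrt_eq_rpow]
  rfl

theorem Medium.exists_interp_equiv {l : ℕ} (M : Medium l) {s : ℝ} (hs : 0 < s) (hs1 : s < 1) :
    ∃ c C : ℝ≥0, 0 < c ∧ 0 < C ∧
      ∀ (lam : ℕ → ℝ) (w : HilbertBasis ℕ ℝ M.L2), M.IsEigenbasis lam w →
        {ψ : M.L2 | M.fracNorm lam w (1 + s) ψ < ⊤} = {ψ ∈ M.V | M.interpNorm s ψ < ⊤} ∧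
        ∀ ψ ∈ M.V, c * M.interpNorm s ψ ≤ M.fracNorm lam w (1 + s) ψ ∧
          M.fracNorm lam w (1 + s) ψ ≤ C * M.interpNorm s ψ := by
  obtain ⟨C, hC, hle⟩ := M.exists_interpSq_le_const
  set b := (weightConst s).toReal with hb
  have hb0 : 0 < b := ENNReal.toReal_pos weightConst_pos.ne' (weightConst_lt_top hs hs1).ne
  have hbc : weightConst s = ENNReal.ofReal b :=
    (ENNReal.ofReal_toReal (weightConst_lt_top hs hs1).ne).symm
  set A := 3 * (M.dMax ^ 2 + 1) with hA
  have hA0 : 0 < A := by positivity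
  have h1 : 0 < (Real.sqrt (C * b)).toNNReal := by
    rw [Real.toNNReal_pos, Real.sqrt_pos]; positivity
  have h2 : 0 < (Real.sqrt (A / b)).toNNReal := by
    rw [Real.toNNReal_pos, Real.sqrt_pos]; positivity
  have key : ∀ (lam : ℕ → ℝ) (w : HilbertBasis ℕ ℝ M.L2), M.IsEigenbasis lam w → ∀ ψ ∈ M.V,
      (Real.sqrt (C * b)).toNNReal⁻¹ * M.interpNorm s ψ ≤ M.fracNorm lam w (1 + s) ψ ∧
      M.fracNorm lam w (1 + s) ψ ≤ (Real.sqrt (A / b)).toNNReal * M.interpNorm s ψ := by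
    intro lam w h ψ hψ
    constructor
    · have h3 := hle lam w h s ψ hψ
      rw [hbc, ← mul_assoc, ← ENNReal.ofReal_mul hC.le] at h3
      have h4 := rpow_half_le_of_le (by positivity) h3
      rw [ENNReal.coe_inv h1.ne', mul_comm, ← div_eq_mul_inv]
      exact ENNReal.div_le_of_le_mul' h4
    · have h3 := h.fracSum_le_interpSq s hψ
      rw [hbc, mul_comm, ← ENNReal.le_div_iff_mul_le (Or.inl (ENNReal.ofReal_pos.2 hb0).ne')
        (Or.inl ENNReal.ofReal_ne_top), ENNReal.mul_div_right_comm,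
        ← ENNReal.ofReal_div_of_pos hb0] at h3
      exact rpow_half_le_of_le (by positivity) h3
  refine ⟨_, _, inv_pos.2 h1, h2, fun lam w h => ⟨?_, key lam w h⟩⟩
  ext ψ
  constructor
  · intro hψ
    have hψ' : M.fracNorm lam w (1 + s) ψ < ⊤ := hψ
    -- Membership in `𝓥` has to come first, since the two-sided estimate is only available there.
    -- The spectral gap bounds `λ` by a multiple of `λ^{1+s}`.
    have hV : ψ ∈ M.V := by
      refine h.mem_V_of_specSum ((h.specSum_one_le_fracSum hs ψ).trans_lt
        (ENNReal.mul_lt_top ENNReal.ofReal_lt_top ?_))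
      exact (ENNReal.rpow_lt_top_iff_of_pos (by norm_num)).1 hψ'
    refine ⟨hV, ?_⟩
    have h3 := ((key lam w h ψ hV).1).trans_lt hψ'
    exact (ENNReal.mul_lt_top_iff.1 h3).elim (fun h => h.2) fun h4 => h4.elim
      (fun h4 => absurd h4 (by exact_mod_cast (inv_pos.2 h1).ne')) fun h4 => h4 ▸ ENNReal.zero_lt_top
  · rintro ⟨hV, hψ⟩
    exact ((key lam w h ψ hV).2).trans_lt (ENNReal.mul_lt_top ENNReal.coe_lt_top hψ)

end Layered

end

noncomputable section

namespace Layered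

variable {L a b a' b' : ℝ}

/-! ### Restriction to a thinner box -/

theorem boxMeasure_mono (ha : a ≤ a') (hb : b' ≤ b) : boxMeasure L a' b' ≤ boxMeasure L a b :=
  Measure.restrict_mono (box_mono ha hb) le_rfl

/-- The restriction of a function in `L²` to a thinner box. -/
def restrictL2 (ha : a ≤ a') (hb : b' ≤ b) (u : BoxL2 L a b) : BoxL2 L a' b' :=
  ((Lp.memLp u).mono_measure (boxMeasure_mono ha hb)).toLp u

theorem coeFn_restrictL2 (ha : a ≤ a') (hb : b' ≤ b) (u : BoxL2 L a b) :
    restrictL2 ha hb u =ᵐ[boxMeasure L a' b'] u := MemLp.coeFn_toLp _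

theorem ae_eq_restrict (ha : a ≤ a') (hb : b' ≤ b) {f g : Space → ℝ}
    (h : f =ᵐ[boxMeasure L a b] g) : f =ᵐ[boxMeasure L a' b'] g :=
  ae_mono (boxMeasure_mono ha hb) h

theorem l2Sq_mono (ha : a ≤ a') (hb : b' ≤ b) (f : Space → ℝ) :
    l2Sq L a' b' f ≤ l2Sq L a b f :=
  lintegral_mono_set (box_mono ha hb)

theorem norm_restrictL2_sq_le (ha : a ≤ a') (hb : b' ≤ b) (u : BoxL2 L a b) :
    ‖restrictL2 ha hb u‖ ^ 2 ≤ ‖u‖ ^ 2 := by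
  rw [← ENNReal.ofReal_le_ofReal_iff (by positivity),
    ← l2Sq_eq_of_ae_eq (coeFn_restrictL2 ha hb u), ← l2Sq_eq_of_ae_eq (ae_eq_refl u)]
  exact l2Sq_mono ha hb _

theorem integral_box_restrict (ha : a ≤ a') (hb : b' ≤ b) (f : Space → ℝ) {φ : Space → ℝ}
    (hφ : IsTest L a' b' φ) :
    ∫ p in box L a' b', f p * φ p = ∫ p in box L a b, f p * φ p := by
  refine (setIntegral_eq_of_subset_of_forall_sdiff_eq_zero (measurableSet_box L a b)
    (box_mono ha hb) fun p hp => ?_).symm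
  by_contra h
  have h1 := hφ.mem_Ioo (right_ne_zero_of_mul h)
  exact hp.2 ⟨hp.1.1, hp.1.2.1, h1⟩

theorem HasWD.restrict (ha : a ≤ a') (hb : b' ≤ b) {i : Fin 3} {u g : BoxL2 L a b}
    (h : HasWD i u g) : HasWD i (restrictL2 ha hb u) (restrictL2 ha hb g) := by
  intro φ
  have hφ : IsTest L a b φ := φ.2.mono ha hb
  have h1 := h ⟨φ, hφ⟩
  rw [inner_eq_integral (ae_eq_refl _) (coeFn_testDeriv i _),
    inner_eq_integral (ae_eq_refl _) (coeFn_testL2 _)] at h1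
  rw [inner_eq_integral (coeFn_restrictL2 ha hb u) (coeFn_testDeriv i _),
    inner_eq_integral (coeFn_restrictL2 ha hb g) (coeFn_testL2 _),
    integral_box_restrict ha hb _ (φ.2.partialDeriv i), integral_box_restrict ha hb _ φ.2]
  exact h1

/-! ### Differences and the Slobodeckij seminorm -/

theorem enorm_add_sq_le (x y : ℝ) : ‖x + y‖ₑ ^ 2 ≤ 2 * (‖x‖ₑ ^ 2 + ‖y‖ₑ ^ 2) := by
  have h : ∀ z : ℝ, ‖z‖ₑ ^ 2 = ENNReal.ofReal (z ^ 2) := fun z => by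
    rw [Real.enorm_eq_ofReal_abs, ← ENNReal.ofReal_pow (abs_nonneg z), sq_abs]
  rw [h, h, h, ← ENNReal.ofReal_add (sq_nonneg _) (sq_nonneg _),
    show (2 : ℝ≥0∞) = ENNReal.ofReal 2 by simp, ← ENNReal.ofReal_mul (by norm_num)]
  exact ENNReal.ofReal_le_ofReal (by nlinarith [sq_nonneg (x - y)])

theorem l2Sq_add_le (L a b : ℝ) {f g : Space → ℝ} (hf : Measurable f) :
    l2Sq L a b (fun p => f p + g p) ≤ 2 * (l2Sq L a b f + l2Sq L a b g) := by
  rw [l2Sq, l2Sq, l2Sq, ← lintegral_add_left (by fun_prop), ← lintegral_const_mul' _ _ (by simp)]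
  exact lintegral_mono fun p => enorm_add_sq_le _ _

theorem shiftSq_le_l2Sq (hL : 0 < L) {f : Space → ℝ} (hf : Measurable f) (hp : HPeriodic L f)
    (h : Space) : shiftSq L a b f h ≤ 4 * l2Sq L a b f := by
  set c := max a (a - h 2) with hc
  set d := min b (b - h 2) with hd
  have h1 : l2Sq L c d (fun p => f (p + h)) ≤ l2Sq L a b f := by
    rw [l2Sq_translate hL _ _ hp]
    refine l2Sq_mono ?_ ?_ f
    · have := le_max_right a (a - h 2); linarith
    · have := min_le_right b (b - h 2); linarith
  have h2 : l2Sq L c d (fun p => -f p) ≤ l2Sq L a b f := by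
    have : l2Sq L c d (fun p => -f p) = l2Sq L c d f := by simp [l2Sq]
    rw [this]
    exact l2Sq_mono (le_max_left _ _) (min_le_left _ _) f
  calc shiftSq L a b f h = l2Sq L c d fun p => f (p + h) + -f p := by
        simp only [shiftSq, sub_eq_add_neg, hc, hd]
    _ ≤ 2 * (l2Sq L c d (fun p => f (p + h)) + l2Sq L c d fun p => -f p) :=
        l2Sq_add_le L c d (by fun_prop)
    _ ≤ 2 * (l2Sq L a b f + l2Sq L a b f) := by gcongr
    _ = 4 * l2Sq L a b f := by ring

theorem shiftSq_le_add {f g : Space → ℝ} (hf : Measurable f) (hg : Measurable g) (h : Space) :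
    shiftSq L a b f h ≤ 2 * (shiftSq L a b (fun p => f p - g p) h + shiftSq L a b g h) := by
  have : (fun p => f (p + h) - f p)
      = fun p => ((f (p + h) - g (p + h)) - (f p - g p)) + (g (p + h) - g p) := by
    ext p; ring
  rw [shiftSq, this]
  exact l2Sq_add_le L _ _ (by fun_prop)

/-- A horizontal displacement of at most half a period in each direction is already the shortest
modulo the lattice. -/
theorem perDist_add {L : ℝ} (hL : 0 < L) (p h : Space) (h0 : |h 0| ≤ L / 2) (h1 : |h 1| ≤ L / 2) :
    perDist L p (p + h) = ‖h‖ := by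
  have key : ∀ i : Fin 3, |h i| ≤ L / 2 → ‖((p i - (p + h) i : ℝ) : AddCircle L)‖ ^ 2 = ‖h i‖ ^ 2 := by
    intro i hi
    have h2 : p i - (p + h) i = -h i := by rw [PiLp.add_apply]; ring
    rw [h2, (AddCircle.norm_coe_eq_abs_iff L hL.ne').2 (by rwa [abs_neg, abs_of_pos hL]), abs_neg,
      Real.norm_eq_abs]
  rw [perDist, key 0 h0, key 1 h1, EuclideanSpace.norm_eq, Fin.sum_univ_three]
  congr 2
  rw [PiLp.add_apply, Real.norm_eq_abs, sq_abs]
  ring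

theorem perDist_periodic (L : ℝ) (p : Space) : HPeriodic L (perDist L p) := by
  have key : ∀ x y : ℝ, ((x - (y + L) : ℝ) : AddCircle L) = ((x - y : ℝ) : AddCircle L) := by
    intro x y
    rw [← sub_sub, AddCircle.coe_sub _ (x - y), AddCircle.coe_period, sub_zero]
  intro i hi q
  fin_cases i
  · simp [perDist, unitVec_apply, key]
  · simp [perDist, unitVec_apply, key]
  · exact absurd rfl hi

/-- By periodicity the variable `q` may range over the cell centred at `p` instead of the box. There
the periodic distance is `‖q - p‖`, and the displacements may then be enlarged to all of space. -/
theorem slobodeckijSq_le (hL : 0 < L) {g : Space → ℝ} (hg : Measurable g) (hp : HPeriodic L g)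
    (s : ℝ) : slobodeckijSq L a b s g
      ≤ ∫⁻ h : Space, ENNReal.ofReal (1 / ‖h‖ ^ (3 + 2 * s)) * shiftSq L a b g h := by
  rw [← lintegral_box_shift L a b hg (by fun_prop), slobodeckijSq]
  refine lintegral_mono fun p => ?_
  have hper : HPeriodic L fun q => ENNReal.ofReal ((g p - g q) ^ 2 / perDist L p q ^ (3 + 2 * s)) :=
    fun i hi q => by simp only [hp i hi q, perDist_periodic L p i hi q]
  rw [setLIntegral_box_eq_cell hL (p 0 - L / 2) (p 1 - L / 2) a b hper,
    ← lintegral_indicator (measurableSet_cell _ _ _ _ _), ← lintegral_add_left_eq_self _ p]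
  refine lintegral_mono fun h => ?_
  by_cases hh : p + h ∈ cell L (p 0 - L / 2) (p 1 - L / 2) a b
  · obtain ⟨h0, h1, h2⟩ := id hh
    have h2' : h ∈ {h : Space | (p + h) 2 ∈ Ioo a b} := h2
    rw [PiLp.add_apply] at h0 h1
    rw [indicator_of_mem hh, indicator_of_mem h2', perDist_add hL p h
      (abs_le.2 ⟨by linarith [h0.1], by linarith [h0.2]⟩)
      (abs_le.2 ⟨by linarith [h1.1], by linarith [h1.2]⟩), Real.enorm_eq_ofReal_abs,
      ← ENNReal.ofReal_pow (abs_nonneg _), sq_abs, ← ENNReal.ofReal_mul (by positivity)]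
    exact le_of_eq (by congr 1; ring)
  · rw [indicator_of_notMem hh]
    exact bot_le

theorem slobodeckijSq_congr {s : ℝ} {f g : Space → ℝ} (h : f =ᵐ[boxMeasure L a b] g) :
    slobodeckijSq L a b s f = slobodeckijSq L a b s g := by
  refine lintegral_congr_ae ?_
  filter_upwards [h] with p hp
  refine lintegral_congr_ae ?_
  filter_upwards [h] with q hq
  rw [hp, hq]

/-! ### The layers -/

namespace Medium

variable {l : ℕ} {M : Medium l}

/-- Only the vertical component is an issue: `∂_z u` may jump at interfaces, but inside a layer it
is the constant multiple `D_j⁻¹` of the flux, which is in `H¹`. -/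
theorem IsWData.exists_hasWD_layer {u : M.L2} {g k₀ k₁ m : Fin 3 → M.L2}
    (h : M.IsWData u g k₀ k₁ m) (j : Fin l) (i : Fin 3) :
    ∃ k : Fin 3 → BoxL2 M.L (M.z j.succ) (M.z j.castSucc),
      (∀ i', HasWD i' (restrictL2 (M.neg_H_le_z j.succ) (M.z_nonpos j.castSucc) (g i)) (k i')) ∧
      ENNReal.ofReal (∑ i', ‖k i'‖ ^ 2) ≤ ENNReal.ofReal (1 + (M.dMin⁻¹) ^ 2) * M.wSq u := by
  set ha := M.neg_H_le_z j.succ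
  set hb := M.z_nonpos j.castSucc
  have hd := M.dMin_pos
  rw [h.wSq_eq, ← ENNReal.ofReal_mul (by positivity)]
  set S := (‖u‖ ^ 2 + ∑ i, ‖g i‖ ^ 2) + (‖g 0‖ ^ 2 + ∑ i, ‖k₀ i‖ ^ 2)
      + (‖g 1‖ ^ 2 + ∑ i, ‖k₁ i‖ ^ 2) + (‖M.mulD (g 2)‖ ^ 2 + ∑ i, ‖m i‖ ^ 2) with hS
  have hr : ∀ k : Fin 3 → M.L2, ∑ i', ‖restrictL2 ha hb (k i')‖ ^ 2 ≤ ∑ i', ‖k i'‖ ^ 2 := fun k =>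
    Finset.sum_le_sum fun i' _ => norm_restrictL2_sq_le ha hb _
  have n0 : 0 ≤ ∑ i, ‖k₀ i‖ ^ 2 := by positivity
  have n1 : 0 ≤ ∑ i, ‖k₁ i‖ ^ 2 := by positivity
  have n2 : 0 ≤ ∑ i, ‖m i‖ ^ 2 := by positivity
  have n3 : 0 ≤ ∑ i, ‖g i‖ ^ 2 := by positivity
  have e0 : ∑ i, ‖k₀ i‖ ^ 2 ≤ S := by
    rw [hS]; nlinarith [sq_nonneg ‖u‖, sq_nonneg ‖g 0‖, sq_nonneg ‖g 1‖, sq_nonneg ‖M.mulD (g 2)‖]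
  have e1 : ∑ i, ‖k₁ i‖ ^ 2 ≤ S := by
    rw [hS]; nlinarith [sq_nonneg ‖u‖, sq_nonneg ‖g 0‖, sq_nonneg ‖g 1‖, sq_nonneg ‖M.mulD (g 2)‖]
  have e2 : ∑ i, ‖m i‖ ^ 2 ≤ S := by
    rw [hS]; nlinarith [sq_nonneg ‖u‖, sq_nonneg ‖g 0‖, sq_nonneg ‖g 1‖, sq_nonneg ‖M.mulD (g 2)‖]
  have hS0 : 0 ≤ S := n0.trans e0
  have hone : S ≤ (1 + (M.dMin⁻¹) ^ 2) * S := by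
    nlinarith [mul_nonneg (sq_nonneg M.dMin⁻¹) hS0]
  by_cases hi : i = 2
  · subst hi
    have heq : restrictL2 ha hb (g 2) = (M.diff j)⁻¹ • restrictL2 ha hb (M.mulD (g 2)) := by
      refine Lp.ext ?_
      filter_upwards [coeFn_restrictL2 ha hb (g 2), coeFn_restrictL2 ha hb (M.mulD (g 2)),
        Lp.coeFn_smul (M.diff j)⁻¹ (restrictL2 ha hb (M.mulD (g 2))),
        ae_eq_restrict ha hb (M.coeFn_mulD (g 2)),
        ae_boxMeasure_mem M.L (M.z j.succ) (M.z j.castSucc)] with p h1 h2 h3 h4 hp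
      rw [h1, h3, Pi.smul_apply, h2, h4, M.D_eq ⟨hp.2.2.1, hp.2.2.2.le⟩, smul_eq_mul,
        inv_mul_cancel_left₀ (M.diff_pos j).ne']
    refine ⟨fun i' => (M.diff j)⁻¹ • restrictL2 ha hb (m i'), fun i' => ?_, ?_⟩
    · rw [heq]
      exact ((h.hasWD_two i').restrict ha hb).smul _
    · refine ENNReal.ofReal_le_ofReal ?_
      have h5 : (M.diff j)⁻¹ ≤ M.dMin⁻¹ := inv_anti₀ hd (M.dMin_le j)
      have h6 : 0 < (M.diff j)⁻¹ := inv_pos.2 (M.diff_pos j)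
      calc ∑ i', ‖(M.diff j)⁻¹ • restrictL2 ha hb (m i')‖ ^ 2
          = (M.diff j)⁻¹ ^ 2 * ∑ i', ‖restrictL2 ha hb (m i')‖ ^ 2 := by
            rw [Finset.mul_sum]
            refine Finset.sum_congr rfl fun i' _ => ?_
            rw [norm_smul, mul_pow, Real.norm_of_nonneg h6.le]
        _ ≤ (M.dMin⁻¹) ^ 2 * S := by
            gcongr
            exact (hr m).trans e2
        _ ≤ _ := by nlinarith
  · have hi' : i = 0 ∨ i = 1 := by
      fin_cases i
      · exact Or.inl rfl
      · exact Or.inr rfl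
      · exact absurd rfl hi
    rcases hi' with rfl | rfl
    · exact ⟨fun i' => restrictL2 ha hb (k₀ i'), fun i' => (h.hasWD_zero i').restrict ha hb,
        ENNReal.ofReal_le_ofReal ((hr k₀).trans (e0.trans hone))⟩
    · exact ⟨fun i' => restrictL2 ha hb (k₁ i'), fun i' => (h.hasWD_one i').restrict ha hb,
        ENNReal.ofReal_le_ofReal ((hr k₁).trans (e1.trans hone))⟩

theorem dMin_mul_sum_le_vSq {u : M.L2} {g : Fin 3 → M.L2} (h : InH10 u g) :
    ENNReal.ofReal (∑ i, ‖g i‖ ^ 2) ≤ ENNReal.ofReal M.dMin⁻¹ * M.vSq u := by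
  have hd := M.dMin_pos
  rw [M.vSq_eq h, ← ENNReal.ofReal_mul (by positivity)]
  refine ENNReal.ofReal_le_ofReal ?_
  rw [le_inv_mul_iff₀ hd, Finset.mul_sum]
  exact Finset.sum_le_sum fun i _ => M.dMin_mul_norm_sq_le (g i)

/-- For each `v ∈ 𝓦`, the increment of `∂ᵢ(u - v)` is bounded by its norm, hence by the norm of `𝓥`;
the increment of `∂ᵢv` gains a factor `|h|` from its gradient in the layer. This is the
`K`-functional at `t = ‖h‖`. -/
theorem shiftSq_le_KSq {u : M.L2} {g : Fin 3 → M.L2} (hu : InH10 u g) (j : Fin l) (i : Fin 3)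
    {G : Space → ℝ} (hG : Measurable G) (hGp : HPeriodic M.L G)
    (hgG : g i =ᵐ[boxMeasure M.L (-M.H) 0] G) (h : Space) :
    shiftSq M.L (M.z j.succ) (M.z j.castSucc) G h
      ≤ ENNReal.ofReal (8 * M.dMin⁻¹ + 2 * (1 + (M.dMin⁻¹) ^ 2)) * M.KSq ‖h‖ u := by
  have hd := M.dMin_pos
  set C := 8 * M.dMin⁻¹ + 2 * (1 + (M.dMin⁻¹) ^ 2) with hC
  have hC0 : 0 < C := by positivity
  rw [KSq, ENNReal.mul_iInf_of_ne (ENNReal.ofReal_pos.2 hC0).ne' ENNReal.ofReal_ne_top]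
  refine le_iInf fun v => ?_
  by_cases hv : v ∈ M.W
  swap
  · rw [iInf_neg hv, ENNReal.mul_top (ENNReal.ofReal_pos.2 hC0).ne']
    exact le_top
  rw [iInf_pos hv]
  obtain ⟨g', k₀, k₁, m, hW⟩ := mem_W_iff.1 hv
  obtain ⟨G', hG', hGp', hgG'⟩ := exists_periodic_rep M.L_pos (g' i)
  obtain ⟨k, hk, hkle⟩ := hW.exists_hasWD_layer j i
  generalize M.neg_H_le_z j.succ = ha at hk
  generalize M.z_nonpos j.castSucc = hb at hk
  generalize M.z j.succ = a at *
  generalize M.z j.castSucc = b at *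
  have h1 : shiftSq M.L a b (fun p => G p - G' p) h
      ≤ 4 * (ENNReal.ofReal M.dMin⁻¹ * M.vSq (u - v : M.L2)) := by
    refine (shiftSq_le_l2Sq (f := fun p => G p - G' p) M.L_pos (hG.sub hG') (fun i hi p => by
      simp only [hGp i hi p, hGp' i hi p]) h).trans ?_
    gcongr
    refine (l2Sq_mono ha hb _).trans ?_
    have hsub : (g i - g' i : M.L2) =ᵐ[boxMeasure M.L (-M.H) 0] fun p => G p - G' p := by
      filter_upwards [hgG, hgG', Lp.coeFn_sub (g i) (g' i)] with p h1 h2 h3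
      rw [h3, Pi.sub_apply, h1, h2]
    rw [l2Sq_eq_of_ae_eq hsub]
    refine le_trans (ENNReal.ofReal_le_ofReal ?_) (dMin_mul_sum_le_vSq (hu.sub hW.inH10))
    exact Finset.single_le_sum (f := fun i => ‖(g - g') i‖ ^ 2) (fun i _ => sq_nonneg _)
      (Finset.mem_univ i)
  have h2 : shiftSq M.L a b G' h
      ≤ ENNReal.ofReal (‖h‖ ^ 2) * (ENNReal.ofReal (1 + (M.dMin⁻¹) ^ 2) * M.wSq v) := by
    have hrep : restrictL2 ha hb (g' i) =ᵐ[boxMeasure M.L a b] G' :=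
      (coeFn_restrictL2 ha hb (g' i)).trans (ae_eq_restrict ha hb hgG')
    refine (shiftSq_le_norm M.L_pos hG' hGp' hrep hk h).trans ?_
    rw [ENNReal.ofReal_mul (sq_nonneg _)]
    gcongr
  have c1 : 2 * (4 * ENNReal.ofReal M.dMin⁻¹) ≤ ENNReal.ofReal C := by
    rw [show (2 : ℝ≥0∞) = ENNReal.ofReal 2 by simp, show (4 : ℝ≥0∞) = ENNReal.ofReal 4 by simp,
      ← ENNReal.ofReal_mul (by norm_num), ← ENNReal.ofReal_mul (by norm_num)]
    refine ENNReal.ofReal_le_ofReal ?_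
    rw [hC]
    nlinarith [sq_nonneg M.dMin⁻¹]
  have c2 : 2 * ENNReal.ofReal (1 + (M.dMin⁻¹) ^ 2) ≤ ENNReal.ofReal C := by
    rw [show (2 : ℝ≥0∞) = ENNReal.ofReal 2 by simp, ← ENNReal.ofReal_mul (by norm_num)]
    refine ENNReal.ofReal_le_ofReal ?_
    rw [hC]
    have : 0 < M.dMin⁻¹ := inv_pos.2 hd
    linarith
  calc shiftSq M.L a b G h
      ≤ 2 * (shiftSq M.L a b (fun p => G p - G' p) h + shiftSq M.L a b G' h) :=
        shiftSq_le_add hG hG' h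
    _ ≤ 2 * (4 * (ENNReal.ofReal M.dMin⁻¹ * M.vSq (u - v : M.L2))
        + ENNReal.ofReal (‖h‖ ^ 2) * (ENNReal.ofReal (1 + (M.dMin⁻¹) ^ 2) * M.wSq v)) := by
        gcongr
    _ = (2 * (4 * ENNReal.ofReal M.dMin⁻¹)) * M.vSq (u - v : M.L2)
        + (2 * ENNReal.ofReal (1 + (M.dMin⁻¹) ^ 2)) * (ENNReal.ofReal (‖h‖ ^ 2) * M.wSq v) := by
        ring
    _ ≤ ENNReal.ofReal C * M.vSq (u - v : M.L2)
        + ENNReal.ofReal C * (ENNReal.ofReal (‖h‖ ^ 2) * M.wSq v) := by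
        gcongr
    _ = _ := by ring

/-- For `0 < s < 1` one has `λ^{1+s} ≤ λ + λ²`. -/
theorem IsEigenbasis.fracSum_lt_top {lam : ℕ → ℝ} {w : HilbertBasis ℕ ℝ M.L2}
    (h : M.IsEigenbasis lam w) {s : ℝ} (hs : 0 < s) (hs1 : s < 1) {u : M.L2} (hu : u ∈ M.W) :
    fracSum lam w (1 + s) u < ⊤ := by
  obtain ⟨g, f, hsol, -⟩ := exists_isWeakSolution_of_mem_W hu
  have h2 : specSum lam w 2 u < ⊤ := by
    rw [← h.norm_sq_eq hsol]; exact ENNReal.ofReal_lt_top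
  refine lt_of_le_of_lt ?_ (ENNReal.add_lt_top.2 ⟨h.specSum_one_lt_top h2, h2⟩)
  rw [fracSum, specSum, specSum, ← ENNReal.tsum_add]
  refine ENNReal.tsum_le_tsum fun k => ?_
  have hk := h.lam_pos k
  rw [← ENNReal.ofReal_add (by positivity) (by positivity), ← add_mul]
  refine ENNReal.ofReal_le_ofReal (mul_le_mul_of_nonneg_right ?_ (sq_nonneg _))
  rcases le_total (lam k) 1 with h1 | h1
  · have := Real.rpow_le_rpow_of_exponent_ge hk h1 (by linarith : (1 : ℝ) ≤ 1 + s)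
    rw [Real.rpow_one] at this
    rw [pow_one]
    nlinarith [sq_nonneg (lam k)]
  · have := Real.rpow_le_rpow_of_exponent_le h1 (by linarith : 1 + s ≤ (2 : ℝ))
    rw [Real.rpow_two] at this
    rw [pow_one]
    linarith

theorem exists_layer_estimate (M : Medium l) {s : ℝ} (hs : 0 < s) (hs1 : s < 1) (j : Fin l) :
    ∃ C : ℝ≥0, 0 < C ∧
      ∀ (lam : ℕ → ℝ) (w : HilbertBasis ℕ ℝ M.L2), M.IsEigenbasis lam w →
        ∀ ψ ∈ M.W, M.fracNorm lam w (1 + s) ψ < ⊤ ∧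
          MemH1 M.L (M.z j.succ) (M.z j.castSucc) ψ ∧
          sobolevNorm M.L (M.z j.succ) (M.z j.castSucc) s ψ
            ≤ C * M.fracNorm lam w (1 + s) ψ := by
  obtain ⟨CK, hCK, hK⟩ := M.exists_KSq_le_const
  have hd := M.dMin_pos
  have hH := M.H_pos
  set B := (weightConstSpace s).toReal with hB
  have hBc : weightConstSpace s = ENNReal.ofReal B :=
    (ENNReal.ofReal_toReal (weightConstSpace_lt_top hs hs1).ne).symm
  have hB0 : 0 ≤ B := ENNReal.toReal_nonneg
  set C₁ := 8 * M.dMin⁻¹ + 2 * (1 + (M.dMin⁻¹) ^ 2) with hC₁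
  have hC₁0 : 0 < C₁ := by positivity
  -- The factors come from the Poincaré inequality, from coercivity, and from the lower bound of the
  -- eigenvalues raised to the power `s`.
  set C₀ := (4 * M.H ^ 2 + 1) * M.dMin⁻¹ * ((M.dMin / (4 * M.H ^ 2)) ^ s)⁻¹ with hC₀
  have hC₀0 : 0 < C₀ := by positivity
  set A := C₀ + 3 * (C₁ * CK * B) with hA
  have hA0 : 0 < A := by positivity
  refine ⟨(Real.sqrt A).toNNReal, by rw [Real.toNNReal_pos, Real.sqrt_pos]; exact hA0,
    fun lam w h ψ hψ => ⟨?_, ?_⟩⟩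
  · exact ENNReal.rpow_lt_top_of_nonneg (by norm_num) (h.fracSum_lt_top hs hs1 hψ).ne
  obtain ⟨g, hg⟩ := mem_V_iff.1 hψ.1
  set a := M.z j.succ
  set b := M.z j.castSucc
  have ha : -M.H ≤ a := M.neg_H_le_z _
  have hb : b ≤ 0 := M.z_nonpos _
  have hrψ := coeFn_restrictL2 ha hb ψ
  have hwd : ∀ i, HasWD i (restrictL2 ha hb ψ) (restrictL2 ha hb (g i)) := fun i =>
    (hg.hasWD M.L_pos i).restrict ha hb
  refine ⟨(memH1_iff hrψ).2 ⟨_, hwd⟩, ?_⟩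
  have e0 : h1Sq M.L a b ψ ≤ ENNReal.ofReal C₀ * fracSum lam w (1 + s) ψ := by
    rw [h1Sq_eq M.L_pos hrψ hwd]
    have hn := hg.norm_le
    have h1 : ‖restrictL2 ha hb ψ‖ ^ 2 + ∑ i, ‖restrictL2 ha hb (g i)‖ ^ 2
        ≤ (4 * M.H ^ 2 + 1) * ∑ i, ‖g i‖ ^ 2 := by
      have h2 : ∑ i, ‖restrictL2 ha hb (g i)‖ ^ 2 ≤ ∑ i, ‖g i‖ ^ 2 :=
        Finset.sum_le_sum fun i _ => norm_restrictL2_sq_le ha hb _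
      have h3 : ‖g 2‖ ^ 2 ≤ ∑ i, ‖g i‖ ^ 2 :=
        Finset.single_le_sum (f := fun i => ‖g i‖ ^ 2) (fun i _ => sq_nonneg _) (Finset.mem_univ 2)
      have h4 : ‖restrictL2 ha hb ψ‖ ^ 2 ≤ 4 * M.H ^ 2 * ‖g 2‖ ^ 2 :=
        (norm_restrictL2_sq_le ha hb ψ).trans
          ((pow_le_pow_left₀ (norm_nonneg _) hn 2).trans_eq (by ring))
      have h5 := mul_le_mul_of_nonneg_left h3 (by positivity : 0 ≤ 4 * M.H ^ 2)
      linarith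
    calc ENNReal.ofReal (‖restrictL2 ha hb ψ‖ ^ 2 + ∑ i, ‖restrictL2 ha hb (g i)‖ ^ 2)
        ≤ ENNReal.ofReal (4 * M.H ^ 2 + 1) * ENNReal.ofReal (∑ i, ‖g i‖ ^ 2) := by
          rw [← ENNReal.ofReal_mul (by positivity)]
          exact ENNReal.ofReal_le_ofReal h1
      _ ≤ ENNReal.ofReal (4 * M.H ^ 2 + 1) * (ENNReal.ofReal M.dMin⁻¹ *
          (ENNReal.ofReal ((M.dMin / (4 * M.H ^ 2)) ^ s)⁻¹ * fracSum lam w (1 + s) ψ)) := by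
          gcongr
          refine (dMin_mul_sum_le_vSq hg).trans ?_
          rw [h.vSq_eq hψ.1]
          gcongr
          exact h.specSum_one_le_fracSum hs ψ
      _ = _ := by
          rw [hC₀, ENNReal.ofReal_mul (by positivity), ENNReal.ofReal_mul (by positivity)]
          ring
  have e1 : ∀ i, slobodeckijSq M.L a b s (weakPartial M.L a b i ψ)
      ≤ ENNReal.ofReal (C₁ * CK * B) * fracSum lam w (1 + s) ψ := by
    intro i
    obtain ⟨G, hG, hGp, hgG⟩ := exists_periodic_rep M.L_pos (g i)
    have hw : weakPartial M.L a b i ψ =ᵐ[boxMeasure M.L a b] G :=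
      (weakPartial_ae_eq_of_hasWD M.L_pos hrψ (hwd i)).trans
        ((coeFn_restrictL2 ha hb (g i)).trans (ae_eq_restrict ha hb hgG))
    rw [slobodeckijSq_congr hw]
    refine (slobodeckijSq_le M.L_pos hG hGp s).trans ?_
    have hInt : ∫⁻ x : Space, ENNReal.ofReal (1 / ‖x‖ ^ (3 + 2 * s)) * modeSum lam w ‖x‖ ψ
        = weightConstSpace s * fracSum lam w (1 + s) ψ :=
      lintegral_modeSum w ψ (by fun_prop) measurable_norm
        fun k _ hy => lintegral_space_modeK (h.lam_pos k) hy
    calc ∫⁻ x : Space, ENNReal.ofReal (1 / ‖x‖ ^ (3 + 2 * s)) * shiftSq M.L a b G x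
        ≤ ∫⁻ x : Space, ENNReal.ofReal (C₁ * CK) *
          (ENNReal.ofReal (1 / ‖x‖ ^ (3 + 2 * s)) * modeSum lam w ‖x‖ ψ) := by
          refine lintegral_mono fun x => ?_
          -- The comparison with `modeSum` needs `t > 0`; at the origin the weight is `1 / 0 = 0`.
          by_cases hx : x = 0
          · have : (0 : ℝ) ^ (3 + 2 * s) = 0 := Real.zero_rpow (by linarith)
            simp [hx, this]
          · rw [mul_left_comm]
            gcongr
            refine (shiftSq_le_KSq hg j i hG hGp hgG x).trans ?_
            rw [ENNReal.ofReal_mul hC₁0.le, mul_assoc]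
            gcongr
            exact hK lam w h _ (norm_pos_iff.2 hx) ψ hψ.1
      _ = _ := by
          rw [lintegral_const_mul' _ _ ENNReal.ofReal_ne_top, hInt, hBc,
            ENNReal.ofReal_mul (by positivity : 0 ≤ C₁ * CK), mul_assoc]
  refine rpow_half_le_of_le hA0.le ?_
  calc h1Sq M.L a b ψ + ∑ i, slobodeckijSq M.L a b s (weakPartial M.L a b i ψ)
      ≤ ENNReal.ofReal C₀ * fracSum lam w (1 + s) ψ
        + ∑ _i : Fin 3, ENNReal.ofReal (C₁ * CK * B) * fracSum lam w (1 + s) ψ := by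
        gcongr with i
        exact e1 i
    _ = ENNReal.ofReal A * fracSum lam w (1 + s) ψ := by
        rw [Finset.sum_const, Finset.card_univ, Fintype.card_fin, hA,
          ENNReal.ofReal_add hC₀0.le (by positivity), ENNReal.ofReal_mul (by norm_num : (0:ℝ) ≤ 3)]
        simp only [nsmul_eq_mul]
        norm_num
        ring

end Medium

end Layered

end

theorem mainTheorem9 {l : ℕ} (M : Layered.Medium l) :
    (∃ (lam : ℕ → ℝ) (w : HilbertBasis ℕ ℝ M.L2), M.IsEigenbasis lam w ∧
      (∀ k, 0 < lam k) ∧ Monotone lam ∧ Tendsto lam atTop atTop) ∧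
    ∀ s : ℝ, 0 < s → s < 1 →
      (∃ c C : ℝ≥0, 0 < c ∧ 0 < C ∧
        ∀ (lam : ℕ → ℝ) (w : HilbertBasis ℕ ℝ M.L2), M.IsEigenbasis lam w →
          {ψ : M.L2 | M.fracNorm lam w (1 + s) ψ < ⊤} = {ψ ∈ M.V | M.interpNorm s ψ < ⊤} ∧
          ∀ ψ ∈ M.V, c * M.interpNorm s ψ ≤ M.fracNorm lam w (1 + s) ψ ∧
            M.fracNorm lam w (1 + s) ψ ≤ C * M.interpNorm s ψ) ∧
      ∀ j : Fin l, ∃ C : ℝ≥0, 0 < C ∧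
        ∀ (lam : ℕ → ℝ) (w : HilbertBasis ℕ ℝ M.L2), M.IsEigenbasis lam w →
          ∀ ψ ∈ M.W, M.fracNorm lam w (1 + s) ψ < ⊤ ∧
            Layered.MemH1 M.L (M.z j.succ) (M.z j.castSucc) ψ ∧
            Layered.sobolevNorm M.L (M.z j.succ) (M.z j.castSucc) s ψ
              ≤ C * M.fracNorm lam w (1 + s) ψ :=
  ⟨M.exists_eigenbasis, fun _ hs hs1 =>
    ⟨M.exists_interp_equiv hs hs1, fun j => M.exists_layer_estimate hs hs1 j⟩⟩
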